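/- Let $n\ge 2$, let $\Omega\subset\mathbb{R}^n$ be a bounded domain (a nonempty connected bounded open set, with no regularity assumed on its boundary), let $0<T<\infty$, and put $Q=\Omega\times(0,T)$. Let $$Ay=-\sum_{i,j=1}^n\partial_{x_j}\big(a_{ij}\,\partial_{x_i}y\big)+a_0\,y,$$ where $a_{ij},a_0\in L^\infty(\Omega)$, $a_0\ge 0$ a.e. in $\Omega$, and for some $\Lambda_A>0$ we have $\sum_{i,j}a_{ij}(x)\xi_i\xi_j\ge\Lambda_A|\xi|^2$ for a.e. $x\in\Omega$ and all $\xi\in\mathbb{R}^n$. Let $f:\mathbb{R}\to\mathbb{R}$ be of class $C^1$ with $f(0)=0$ and $f'(s)\ge-\Lambda_f$ for all $s\in\mathbb{R}$, for some $\Lambda_f\ge 0$; no growth condition is imposed on $f$ and no upper bound on $n$. Let $H_0^1(\Omega)$ be the closure of $C_c^\infty(\Omega)$ in $H^1(\Omega)$, with the norm $\|\nabla v\|_{L^2(\Omega)}$, let $H^{-1}(\Omega)$ be its dual, and let $W(0,T)=L^2(0,T;H_0^1(\Omega))\cap H^1(0,T;H^{-1}(\Omega))$, with $\|y\|_{W(0,T)}^2=\|y\|^2_{L^2(0,T;H_0^1(\Omega))}+\|y_t\|^2_{L^2(0,T;H^{-1}(\Omega))}$.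 For $u\in L^2(Q)$ and $y_0\in L^\infty(\Omega)$, a solution of $$y_t+Ay+f(y)=u\ \text{ in }Q,\qquad y=0\ \text{ on }\partial\Omega\times(0,T),\qquad y(0)=y_0\ \text{ in }\Omega, \tag{1}$$ is a function $y\in W(0,T)$ such that, for a.e. $t\in(0,T)$, $f(y(t))\in L^1_{\mathrm{loc}}(\Omega)$ and $y_t(t)+Ay(t)+f(y(t))=u(t)$ in the sense of distributions on $\Omega$, and such that the representative of $y$ in $C([0,T];L^2(\Omega))$ takes the value $y_0$ at $t=0$. Then, for every $y_0\in L^\infty(\Omega)$, the following hold. 1. For every $u\in L^2(Q)$, problem (1) has a unique solution $y_u\in W(0,T)$. 2. For every $u\in L^2(Q)$ we have $f(y_u)\in L^2(Q)$ and $$\|y_u\|_{W(0,T)}+\|f(y_u)\|_{L^2(Q)}\le C\big(\|u\|_{L^2(Q)}+\|y_0\|_{L^\infty(\Omega)}\big),$$ where, for given $\Omega,T,A,f$, the constant $C$ depends only on $\|y_0\|_{L^\infty(\Omega)}$; in particular $C$ does not depend on $u$. 3. If $u_k\rightharpoonup u$ weakly in $L^2(Q)$, then $y_{u_k}\rightharpoonup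 y_u$ weakly in $W(0,T)$ and $f(y_{u_k})\rightharpoonup f(y_u)$ weakly in $L^2(Q)$. -/

import Mathlib

open MeasureTheory Set Filter Topology TopologicalSpace InnerProductSpace
open scoped Distributions ENNReal ContDiff

noncomputable section

namespace SemilinearParabolic

/-- The Euclidean space `ℝⁿ`. -/
abbrev Sp (n : ℕ) : Type := EuclideanSpace ℝ (Fin n)

/-- A bounded domain (nonempty, open, connected, bounded set) in `ℝⁿ`, `n ≥ 2`.
No regularity of the boundary is imposed. -/
structure BoundedDomain (n : ℕ) where
  /-- the underlying open set -/
  carrier : Opens (Sp n)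
  connected : IsConnected (carrier : Set (Sp n))
  bounded : Bornology.IsBounded (carrier : Set (Sp n))
  two_le : 2 ≤ n

variable {n : ℕ}

/-- Lebesgue measure on `Ω`. -/
abbrev BoundedDomain.vol (Ω : BoundedDomain n) : Measure (Sp n) :=
  (volume : Measure (Sp n)).restrict (Ω.carrier : Set (Sp n))

/-- `C_c^∞(Ω)`. -/
abbrev BoundedDomain.Test (Ω : BoundedDomain n) : Type := 𝓓(Ω.carrier, ℝ)

/-- `L²(Ω)`. -/
abbrev L2 (Ω : BoundedDomain n) : Type := Lp ℝ 2 Ω.vol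

/-- `L²(Ω; ℝⁿ)`. -/
abbrev L2v (Ω : BoundedDomain n) : Type := Lp (Sp n) 2 Ω.vol

/-! ### The space `H₀¹(Ω)` -/

section H10

variable {Ω : BoundedDomain n}

theorem test_differentiable (φ : Ω.Test) : Differentiable ℝ φ :=
  φ.contDiff.differentiable (by simp)

theorem test_gradient_continuous (φ : Ω.Test) : Continuous (gradient φ) :=
  (toDual ℝ (Sp n)).symm.continuous.comp (φ.contDiff.continuous_fderiv (by simp))

theorem test_gradient_compact (φ : Ω.Test) : HasCompactSupport (gradient φ) :=
  (φ.hasCompactSupport.fderiv ℝ).comp_left (g := (toDual ℝ (Sp n)).symm) (map_zero _)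

theorem test_memLp (φ : Ω.Test) : MemLp φ 2 Ω.vol :=
  (φ.continuous.memLp_of_hasCompactSupport φ.hasCompactSupport (μ := volume)).restrict _

theorem test_gradient_memLp (φ : Ω.Test) : MemLp (gradient φ) 2 Ω.vol :=
  ((test_gradient_continuous φ).memLp_of_hasCompactSupport (test_gradient_compact φ)
    (μ := volume)).restrict _

theorem test_gradient_add (φ ψ : Ω.Test) :
    gradient (φ + ψ : Ω.Test) = gradient φ + gradient ψ := by
  funext x
  have : fderiv ℝ ((φ + ψ : Ω.Test) : Sp n → ℝ) x = fderiv ℝ φ x + fderiv ℝ ψ x := by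
    rw [← fderiv_add (test_differentiable φ x) (test_differentiable ψ x)]; rfl
  simp only [gradient, Pi.add_apply, this, map_add]

theorem test_gradient_smul (c : ℝ) (φ : Ω.Test) :
    gradient (c • φ : Ω.Test) = c • gradient φ := by
  funext x
  have : fderiv ℝ ((c • φ : Ω.Test) : Sp n → ℝ) x = c • fderiv ℝ φ x := by
    rw [← fderiv_const_smul (test_differentiable φ x)]; rfl
  simp only [gradient, Pi.smul_apply, this, map_smul]

variable (Ω) in
/-- The map `φ ↦ (φ, ∇φ)` from `C_c^∞(Ω)` to `L²(Ω) × L²(Ω; ℝⁿ)`. -/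
def testGraph : Ω.Test →ₗ[ℝ] L2 Ω × L2v Ω where
  toFun φ := ((test_memLp φ).toLp φ, (test_gradient_memLp φ).toLp (gradient φ))
  map_add' φ ψ := by
    refine Prod.ext ?_ ?_
    · exact MemLp.toLp_add (test_memLp φ) (test_memLp ψ)
    · refine Eq.trans (b := (((test_gradient_memLp φ).add (test_gradient_memLp ψ)).toLp _)) ?_
        (MemLp.toLp_add (test_gradient_memLp φ) (test_gradient_memLp ψ))
      exact MemLp.toLp_congr (test_gradient_memLp (φ + ψ)) _ (by rw [test_gradient_add])
  map_smul' c φ := by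
    refine Prod.ext ?_ ?_
    · exact MemLp.toLp_const_smul c (test_memLp φ)
    · refine Eq.trans (b := (((test_gradient_memLp φ).const_smul c).toLp _)) ?_
        (MemLp.toLp_const_smul c (test_gradient_memLp φ))
      exact MemLp.toLp_congr (test_gradient_memLp (c • φ)) _ (by rw [test_gradient_smul])

variable (Ω) in
/-- The pairs `(v, ∇v)` with `v ∈ H₀¹(Ω)`: the closure of `{(φ, ∇φ) : φ ∈ C_c^∞(Ω)}` in
`L²(Ω) × L²(Ω; ℝⁿ)`. -/
def h10Submodule : Submodule ℝ (L2 Ω × L2v Ω) :=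
  (LinearMap.range (testGraph Ω)).topologicalClosure

variable (Ω) in
/-- The Sobolev space `H₀¹(Ω)`, an element `v` being stored as the pair `(v, ∇v)`.
Its norm, defined below, is `‖∇v‖_{L²(Ω)}`. -/
def H10 : Type := ↥(h10Submodule Ω)

instance : AddCommGroup (H10 Ω) := inferInstanceAs (AddCommGroup ↥(h10Submodule Ω))

instance : Module ℝ (H10 Ω) := inferInstanceAs (Module ℝ ↥(h10Submodule Ω))

/-- The element of `L²(Ω)` underlying an element of `H₀¹(Ω)`. -/
def H10.fnLin : H10 Ω →ₗ[ℝ] L2 Ω := (LinearMap.fst ℝ _ _).comp (h10Submodule Ω).subtype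

/-- The weak gradient. -/
def H10.gradLin : H10 Ω →ₗ[ℝ] L2v Ω := (LinearMap.snd ℝ _ _).comp (h10Submodule Ω).subtype

theorem norm_toLp_sq {F : Type*} [NormedAddCommGroup F] [InnerProductSpace ℝ F]
    {μ : Measure (Sp n)} {g : Sp n → F} (hg : MemLp g 2 μ) :
    ‖hg.toLp g‖ ^ 2 = ∫ x, ‖g x‖ ^ 2 ∂μ := by
  rw [← real_inner_self_eq_norm_sq, L2.inner_def]
  refine integral_congr_ae ?_
  filter_upwards [hg.coeFn_toLp] with x hx
  rw [hx, real_inner_self_eq_norm_sq]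

/-- Poincaré's inequality for test functions. -/
theorem poincare_test (Ω : BoundedDomain n) :
    ∃ R : ℝ, 0 ≤ R ∧ ∀ φ : Ω.Test, ‖(testGraph Ω φ).1‖ ≤ R * ‖(testGraph Ω φ).2‖ := by
  obtain ⟨R, hR0, hR⟩ := Ω.bounded.exists_pos_norm_le
  refine ⟨2 * R, by positivity, fun φ => ?_⟩
  have hn : 0 < n := by have := Ω.two_le; omega
  let i : Fin n := ⟨0, hn⟩
  let e : Sp n := EuclideanSpace.single i 1
  let g : Sp n →L[ℝ] ℝ := EuclideanSpace.proj i
  have hge : g e = 1 := by simp [g, e]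
  have he : ‖e‖ = 1 := by simp [e]
  have hfd : ∀ x, fderiv ℝ φ x e = inner ℝ (gradient φ x) e := fun x => by
    simp [gradient]
  have hsupp : ∀ x, x ∉ (Ω.carrier : Set (Sp n)) → φ x = 0 := fun x hx =>
    image_eq_zero_of_notMem_tsupport (fun h => hx (φ.tsupport_subset h))
  have hc := φ.continuous
  have hd := test_differentiable φ
  have hcg := test_gradient_continuous φ
  have hcf : Continuous fun x => fderiv ℝ φ x e :=
    (φ.contDiff.continuous_fderiv (by simp)).clm_apply continuous_const
  have hsq : ∀ x, fderiv ℝ (fun y => φ y ^ 2) x e = 2 * φ x * fderiv ℝ φ x e := fun x => by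
    rw [fderiv_fun_pow 2 (hd x)]; simp
  have hint : ∀ F : Sp n → ℝ, Continuous F → (∀ x, φ x = 0 → F x = 0) →
      Integrable F (volume : Measure (Sp n)) := fun F hF h0 =>
    hF.integrable_of_hasCompactSupport
      (φ.hasCompactSupport.mono (fun x hx hx0 => hx (h0 x hx0)))
  have hi0 : Integrable (fun x => 2 * φ x * fderiv ℝ φ x e * g x)
      (volume : Measure (Sp n)) := hint _ (by fun_prop) (fun x hx => by simp [hx])
  have hi1 : Integrable (fun x => φ x ^ 2) (volume : Measure (Sp n)) :=
    hint _ (by fun_prop) (fun x hx => by simp [hx])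
  have hi2 : Integrable (fun x => ‖gradient φ x‖ ^ 2) (volume : Measure (Sp n)) := by
    refine Continuous.integrable_of_hasCompactSupport (by fun_prop) ?_
    exact (test_gradient_compact φ).comp_left (g := fun v : Sp n => ‖v‖ ^ 2) (by simp)
  have ibp := integral_mul_fderiv_eq_neg_fderiv_mul_of_integrable (μ := (volume : Measure (Sp n)))
    (f := fun y => φ y ^ 2) (g := g) (v := e)
    (by simpa only [hsq] using hi0)
    (by simpa only [ContinuousLinearMap.fderiv, hge, mul_one] using hi1)
    (hint _ (by fun_prop) (fun x hx => by simp [hx]))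
    (fun x _ => (hd x).fun_pow 2) (fun x _ => g.differentiableAt)
  simp only [hsq, ContinuousLinearMap.fderiv, hge, mul_one] at ibp
  have key : ∫ x, φ x ^ 2 ≤ ∫ x, ((1 / 2 : ℝ) * φ x ^ 2 + 2 * R ^ 2 * ‖gradient φ x‖ ^ 2) := by
    rw [ibp, ← integral_neg]
    refine integral_mono hi0.neg ((hi1.const_mul _).add (hi2.const_mul _)) fun x => ?_
    by_cases hx : x ∈ (Ω.carrier : Set (Sp n))
    · have h1 : |g x| ≤ R := (PiLp.norm_apply_le x i).trans (hR x hx)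
      have h2 : |fderiv ℝ φ x e| ≤ ‖gradient φ x‖ := by
        rw [hfd]
        simpa [he] using abs_real_inner_le_norm (gradient φ x) e
      have h3 : |fderiv ℝ φ x e * g x| ≤ ‖gradient φ x‖ * R := by
        rw [abs_mul]; gcongr
      have h4 : (fderiv ℝ φ x e * g x) ^ 2 ≤ (‖gradient φ x‖ * R) ^ 2 := by
        rw [← sq_abs]; gcongr
      simp only
      nlinarith [sq_nonneg (φ x + 2 * (fderiv ℝ φ x e * g x))]
    · simp only [hsupp x hx]
      simp only [mul_zero, zero_mul, neg_zero]
      positivity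
  rw [integral_add (hi1.const_mul _) (hi2.const_mul _), integral_const_mul,
    integral_const_mul] at key
  have e1 : ‖(testGraph Ω φ).1‖ ^ 2 = ∫ x, φ x ^ 2 := by
    refine (norm_toLp_sq (test_memLp φ)).trans ?_
    rw [setIntegral_eq_integral_of_forall_compl_eq_zero (fun x hx => by simp [hsupp x hx])]
    simp
  have e2 : ‖(testGraph Ω φ).2‖ ^ 2 = ∫ x, ‖gradient φ x‖ ^ 2 := by
    refine (norm_toLp_sq (test_gradient_memLp φ)).trans ?_
    refine setIntegral_eq_integral_of_forall_compl_eq_zero (fun x hx => ?_)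
    have : x ∉ tsupport (fderiv ℝ φ) := fun h =>
      hx (φ.tsupport_subset (tsupport_fderiv_subset ℝ h))
    simp [gradient, image_eq_zero_of_notMem_tsupport this]
  refine (sq_le_sq₀ (norm_nonneg _) (by positivity)).1 ?_
  rw [mul_pow, e1, e2]
  linarith

/-- Poincaré's inequality on `H₀¹(Ω)`. -/
theorem poincare (Ω : BoundedDomain n) :
    ∃ R : ℝ, 0 ≤ R ∧ ∀ v : H10 Ω, ‖H10.fnLin v‖ ≤ R * ‖H10.gradLin v‖ := by
  obtain ⟨R, hR0, hR⟩ := poincare_test Ω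
  refine ⟨R, hR0, fun v => ?_⟩
  have hcl : IsClosed {p : L2 Ω × L2v Ω | ‖p.1‖ ≤ R * ‖p.2‖} :=
    isClosed_le (by fun_prop) (by fun_prop)
  have hsub : ((LinearMap.range (testGraph Ω) : Submodule ℝ (L2 Ω × L2v Ω)) :
      Set (L2 Ω × L2v Ω)) ⊆ {p | ‖p.1‖ ≤ R * ‖p.2‖} := by
    rintro _ ⟨φ, rfl⟩
    exact hR φ
  exact closure_minimal hsub hcl v.2

theorem H10.gradLin_injective : Function.Injective (H10.gradLin (Ω := Ω)) := by
  refine (injective_iff_map_eq_zero _).2 fun v hv => ?_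
  obtain ⟨R, -, hR⟩ := poincare Ω
  have h0 : H10.fnLin v = 0 := by
    have := hR v
    rw [hv, norm_zero, mul_zero] at this
    exact norm_le_zero_iff.1 this
  exact Subtype.ext (Prod.ext h0 hv)

/-- The norm `‖v‖ = ‖∇v‖_{L²(Ω)}` on `H₀¹(Ω)`. -/
instance : NormedAddCommGroup (H10 Ω) :=
  NormedAddCommGroup.induced (H10 Ω) (L2v Ω) H10.gradLin H10.gradLin_injective

instance : NormedSpace ℝ (H10 Ω) := NormedSpace.induced ℝ (H10 Ω) (L2v Ω) H10.gradLin

theorem H10.norm_def (v : H10 Ω) : ‖v‖ = ‖H10.gradLin v‖ := rfl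

theorem H10.fnLin_bounded (Ω : BoundedDomain n) :
    ∃ R : ℝ, ∀ v : H10 Ω, ‖H10.fnLin v‖ ≤ R * ‖v‖ :=
  let ⟨R, _, hR⟩ := poincare Ω
  ⟨R, hR⟩

/-- The embedding `H₀¹(Ω) ↪ L²(Ω)`. -/
def H10.fn : H10 Ω →L[ℝ] L2 Ω := H10.fnLin.mkContinuousOfExistsBound (H10.fnLin_bounded Ω)

/-- The weak gradient `H₀¹(Ω) → L²(Ω; ℝⁿ)`. -/
def H10.grad : H10 Ω →L[ℝ] L2v Ω :=
  H10.gradLin.mkContinuous 1 fun v => by rw [one_mul, H10.norm_def]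

/-- A test function, as an element of `H₀¹(Ω)`. -/
def H10.ofTest (φ : Ω.Test) : H10 Ω :=
  ⟨testGraph Ω φ, (LinearMap.range (testGraph Ω)).le_topologicalClosure ⟨φ, rfl⟩⟩

variable (Ω) in
/-- `H⁻¹(Ω)`, the dual of `H₀¹(Ω)` with the dual norm. -/
abbrev Hm1 : Type := StrongDual ℝ (H10 Ω)

/-- The embedding `H₀¹(Ω) ↪ L²(Ω) ↪ H⁻¹(Ω)`, `v ↦ (w ↦ ∫_Ω v w)`. -/
def H10.toHm1 : H10 Ω →L[ℝ] Hm1 Ω :=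
  ((ContinuousLinearMap.compL ℝ (H10 Ω) (L2 Ω) ℝ).flip H10.fn).comp
    ((innerSL ℝ).comp H10.fn)

theorem H10.toHm1_apply (v w : H10 Ω) :
    H10.toHm1 v w = ∫ x, H10.fn v x * H10.fn w x ∂Ω.vol := by
  change inner ℝ (H10.fn v) (H10.fn w) = _
  rw [L2.inner_def]
  exact integral_congr_ae (ae_of_all _ fun x => mul_comm _ _)

end H10

/-! ### Functions of time and space -/

/-- Lebesgue measure on `(0, T)`. -/
abbrev timeVol (T : ℝ) : Measure ℝ := volume.restrict (Ioo 0 T)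

/-- `L²(Q)`, where `Q = Ω × (0, T)`. -/
abbrev L2Q (Ω : BoundedDomain n) (T : ℝ) : Type := Lp ℝ 2 (Ω.vol.prod (timeVol T))

/-- `C_c^∞(0, T)`. -/
abbrev TimeTest (T : ℝ) : Type := 𝓓((⟨Ioo 0 T, isOpen_Ioo⟩ : Opens ℝ), ℝ)

theorem timeTest_integrable {F : Type*} [NormedAddCommGroup F] [NormedSpace ℝ F] {T : ℝ}
    {ψ : ℝ → ℝ} (hψ : Continuous ψ) (hc : HasCompactSupport ψ) {g : ℝ → F}
    (hg : MemLp g 2 (timeVol T)) : Integrable (fun t => ψ t • g t) (timeVol T) := by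
  obtain ⟨C, hC⟩ := hψ.bounded_above_of_compact_support hc
  exact (hg.integrable (by norm_num)).bdd_smul C hψ.aestronglyMeasurable (ae_of_all _ hC)

/-- `z = y'` in the sense of `H⁻¹(Ω)`-valued distributions on `(0, T)`. -/
def IsTimeDeriv {Ω : BoundedDomain n} {T : ℝ} (y : Lp (H10 Ω) 2 (timeVol T))
    (z : Lp (Hm1 Ω) 2 (timeVol T)) : Prop :=
  ∀ ψ : TimeTest T,
    ∫ t in Ioo 0 T, deriv ψ t • H10.toHm1 (y t) = -∫ t in Ioo 0 T, ψ t • z t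

/-- `W(0,T) = L²(0,T;H₀¹(Ω)) ∩ H¹(0,T;H⁻¹(Ω))`, an element `y` being stored as the pair `(y, y')`;
its norm is `(‖y‖²_{L²(0,T;H₀¹)} + ‖y'‖²_{L²(0,T;H⁻¹)})^{1/2}`. -/
def W (Ω : BoundedDomain n) (T : ℝ) :
    Submodule ℝ (WithLp 2 (Lp (H10 Ω) 2 (timeVol T) × Lp (Hm1 Ω) 2 (timeVol T))) where
  carrier := {p | IsTimeDeriv p.fst p.snd}
  zero_mem' := fun ψ => by
    have h1 := Lp.coeFn_zero (H10 Ω) 2 (timeVol T)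
    have h2 := Lp.coeFn_zero (Hm1 Ω) 2 (timeVol T)
    rw [integral_eq_zero_of_ae, integral_eq_zero_of_ae, neg_zero]
    · filter_upwards [h2] with t ht
      rw [WithLp.zero_snd, ht, Pi.zero_apply, smul_zero]
    · filter_upwards [h1] with t ht
      rw [WithLp.zero_fst, ht, Pi.zero_apply, map_zero, smul_zero]
      rfl
  add_mem' := fun {p q} hp hq ψ => by
    have hψ := ψ.continuous
    have hψ' : Continuous (deriv ψ) := ψ.contDiff.continuous_deriv (by simp)
    have i1 : ∀ y : Lp (H10 Ω) 2 (timeVol T),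
        Integrable (fun t => deriv ψ t • H10.toHm1 (y t)) (timeVol T) := fun y => timeTest_integrable hψ'
      ψ.hasCompactSupport.deriv (H10.toHm1.comp_memLp' (Lp.memLp y))
    have i2 := fun z : Lp (Hm1 Ω) 2 (timeVol T) => timeTest_integrable hψ
      ψ.hasCompactSupport (Lp.memLp z)
    have e1 : ∫ t in Ioo 0 T, deriv ψ t • H10.toHm1 ((p + q).fst t) =
        (∫ t in Ioo 0 T, deriv ψ t • H10.toHm1 (p.fst t)) +
          ∫ t in Ioo 0 T, deriv ψ t • H10.toHm1 (q.fst t) := by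
      rw [← integral_add (i1 p.fst) (i1 q.fst)]
      refine integral_congr_ae ?_
      filter_upwards [Lp.coeFn_add p.fst q.fst] with t ht
      rw [WithLp.add_fst, ht, Pi.add_apply, map_add, smul_add]
    have e2 : ∫ t in Ioo 0 T, ψ t • (p + q).snd t =
        (∫ t in Ioo 0 T, ψ t • p.snd t) + ∫ t in Ioo 0 T, ψ t • q.snd t := by
      rw [← integral_add (i2 p.snd) (i2 q.snd)]
      refine integral_congr_ae ?_
      filter_upwards [Lp.coeFn_add p.snd q.snd] with t ht
      rw [WithLp.add_snd, ht, Pi.add_apply, smul_add]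
    rw [e1, e2, hp ψ, hq ψ, neg_add]
  smul_mem' := fun c p hp ψ => by
    have e1 : ∫ t in Ioo 0 T, deriv ψ t • H10.toHm1 ((c • p).fst t) =
        c • ∫ t in Ioo 0 T, deriv ψ t • H10.toHm1 (p.fst t) := by
      rw [← integral_smul]
      refine integral_congr_ae ?_
      filter_upwards [Lp.coeFn_smul c p.fst] with t ht
      rw [WithLp.smul_fst, ht, Pi.smul_apply, map_smul, smul_comm]
    have e2 : ∫ t in Ioo 0 T, ψ t • (c • p).snd t = c • ∫ t in Ioo 0 T, ψ t • p.snd t := by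
      rw [← integral_smul]
      refine integral_congr_ae ?_
      filter_upwards [Lp.coeFn_smul c p.snd] with t ht
      rw [WithLp.smul_snd, ht, Pi.smul_apply, smul_comm]
    rw [e1, e2, hp ψ, smul_neg]

section Equation

variable {Ω : BoundedDomain n} {T : ℝ}

/-- `y` as an element of `L²(0,T;H₀¹(Ω))`. -/
def W.val (y : W Ω T) : Lp (H10 Ω) 2 (timeVol T) := y.1.fst

/-- The time derivative `y_t ∈ L²(0,T;H⁻¹(Ω))`. -/
def W.timeDeriv (y : W Ω T) : Lp (Hm1 Ω) 2 (timeVol T) := y.1.snd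

/-- `y(0) = y₀`: the continuous representative `[0,T] → L²(Ω)` of `y` has the value `y₀` at
time `0`. -/
def HasInitialValue (y : W Ω T) (y₀ : Sp n → ℝ) : Prop :=
  ∃ Y : ℝ → L2 Ω, ContinuousOn Y (Icc 0 T) ∧ (∀ᵐ t ∂timeVol T, Y t = H10.fn (W.val y t)) ∧
    ⇑(Y 0) =ᵐ[Ω.vol] y₀

/-- The assumptions on `A y = -∑ ∂_{x_j} (a_{ij} ∂_{x_i} y) + a₀ y`: bounded measurable
coefficients, uniform ellipticity (the matrix need not be symmetric), and `a₀ ≥ 0`. -/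
structure IsEllipticOperator (Ω : BoundedDomain n) (a : Fin n → Fin n → Sp n → ℝ)
    (a₀ : Sp n → ℝ) : Prop where
  memLp : ∀ i j, MemLp (a i j) ∞ Ω.vol
  memLp_zero : MemLp a₀ ∞ Ω.vol
  elliptic : ∃ Λ : ℝ, 0 < Λ ∧ ∀ᵐ x ∂Ω.vol, ∀ ξ : Sp n,
    Λ * ‖ξ‖ ^ 2 ≤ ∑ i, ∑ j, a i j x * ξ i * ξ j
  nonneg : ∀ᵐ x ∂Ω.vol, 0 ≤ a₀ x

/-- `y ∈ W(0,T)` solves `y_t + A y + f(y) = u` in `Q`, `y = 0` on `∂Ω × (0,T)`, `y(0) = y₀`: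
for almost every `t`, `f(y(t))` is locally integrable and the equation holds in the sense of
distributions on `Ω`. -/
def IsSolution (a : Fin n → Fin n → Sp n → ℝ) (a₀ : Sp n → ℝ) (f : ℝ → ℝ)
    (u : L2Q Ω T) (y₀ : Sp n → ℝ) (y : W Ω T) : Prop :=
  (∀ᵐ t ∂timeVol T,
    LocallyIntegrableOn (fun x => f (H10.fn (W.val y t) x)) (Ω.carrier : Set (Sp n)) ∧
    ∀ φ : Ω.Test,
      W.timeDeriv y t (H10.ofTest φ) +
        ∫ x, ((∑ i, ∑ j, a i j x * H10.grad (W.val y t) x i * gradient φ x j) +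
          a₀ x * H10.fn (W.val y t) x * φ x + f (H10.fn (W.val y t) x) * φ x) ∂Ω.vol =
      ∫ x, u (x, t) * φ x ∂Ω.vol) ∧
  HasInitialValue y y₀

/-- The element `g` of `L²(Q)` is the function `f(y)`: `g(x,t) = f(y(x,t))` a.e. in `Q`. In
particular `f(y) ∈ L²(Q)`, and `g` is uniquely determined by `f` and `y`. -/
def IsSuperposition (f : ℝ → ℝ) (y : W Ω T) (g : L2Q Ω T) : Prop :=
  ∀ᵐ t ∂timeVol T, ∀ᵐ x ∂Ω.vol, g (x, t) = f (H10.fn (W.val y t) x)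

/-- Weak convergence of sequences in a normed space. -/
def WeaklyTendsto {X : Type*} [NormedAddCommGroup X] [NormedSpace ℝ X] (x : ℕ → X) (z : X) :
    Prop :=
  Tendsto (fun k => toWeakSpace ℝ X (x k)) atTop (𝓝 (toWeakSpace ℝ X z))

end Equation

end SemilinearParabolic

end

open SemilinearParabolic

/-!
# Well-posedness and weak continuity of a semilinear parabolic equation

The equation is treated as an evolution equation in the Hilbert triple `V ⊂ H ⊂ V*` with `V =
H₀¹(Ω)` and `H = L²(Ω)`. The predicate `IsPath` says that `y ∈ L²(0,T; V)` has the derivative `z ∈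
L²(0,T; V*)` and the continuous representative `Y` with values in `H`, the derivative being
encoded by the integrated identity `Y(t) - Y(0) = ∫₀ᵗ z` in `V*`. The basic tool is the inequality
`IsPath.chain_rule_le` for `d/dt Ψ(y)` with `Ψ` convex, obtained by testing backward difference
quotients with a subgradient; `Ψ = ‖·‖² / 2` gives energy estimates, combined with Gronwall's
inequality in `IsPath.energy_gronwall`. Linear equations are solved by Lions' projection lemma
(`exists_path_linear`), and a Lipschitz nonlinearity is added by iterating a contraction
(`exists_path_lipschitz`).

*Existence and the estimate.* With `g(s) = f(s) + Λ s`, which is nondecreasing, the equation reads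
`y' + A y + g(y) - Λ y = u`. Replace `g` by its Yosida approximations `g_μ`, which are Lipschitz.
Testing with `g_μ(y)`, which lies in `H₀¹(Ω)` by the chain rule `IsChainFun.compH10`, makes the
elliptic term nonnegative and bounds `g_μ(y)` in `L²(Q)`. No growth condition on `f` enters: the
only other term is `∫_Ω G_μ(y₀)`, where `G_μ` is the primitive of `g_μ`, and it is controlled
because `|g(y₀)| ≤ L |y₀|`, with `L` depending only on `‖y₀‖_∞` (`exists_abs_le_mul_abs`).
Monotonicity makes the approximate solutions a Cauchy sequence, and the limit of the nonlinear
terms is identified by almost everywhere convergence (`exists_weak_limit_superposition`). This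
yields `exists_isPathSolution` and `exists_norm_le`.

*Uniqueness.* For an arbitrary solution `f(y(t))` is only locally integrable, so that the
difference of two solutions cannot be used directly as a test function. The theorem of Brezis and
Browder (`nonneg_of_mul_nonneg`) settles this: if `w ∈ H₀¹(Ω)`, and `h ∈ L¹_loc(Ω)` agrees as a
distribution with an element `ξ` of `H⁻¹(Ω)`, and `h w ≥ 0`, then `⟨ξ, w⟩ ≥ 0`. It applies to the
difference of two nonlinear terms (`sub_apply_sub_le`), and Gronwall's inequality gives
`IsSolution.unique`.

*Weak continuity.* Let `u_k ⇀ u` in `L²(Q)`, and write `y_k`, `y` for the solutions. The energy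
inequality bounds `y_k - y` by `∫ ⟨u_k - u, y_k - y⟩`. By Rellich's theorem, in the form that
`H₀¹(Ω)` is embedded in `L²(Ω)` by a limit of operators of finite rank (`exists_finite_rank`),
this reduces to products of scalar functions of time; there integrating the weakly convergent
factor makes it converge strongly, at the price of one time derivative on the other factor, which
is bounded in `L²(0,T)` (`tendsto_integral_inner_path`). Therefore `y_k → y` strongly in `L²(0,T;
H₀¹(Ω))` (`tendsto_path_of_weaklyTendsto`), the bounded sequence `f(y_k)` converges weakly to
`f(y)`, and the equation gives the weak convergence of the derivatives (`weaklyTendsto_toW`).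

Functions on `Q` are regarded as `L²(Ω)`-valued functions of time through the isometry
`sliceEquiv`.
-/

namespace SemilinearParabolic

/-! ### Averages in time, Gronwall's inequality and Lions' projection lemma -/

/-- Translations act continuously on `L²(ℝ; E)`. -/
theorem eLpNorm_translate_sub_tendsto {E : Type*} [NormedAddCommGroup E] {g : ℝ → E}
    (hg : MemLp g 2 volume) :
    Tendsto (fun s : ℝ => eLpNorm (fun t => g (t - s) - g t) 2 volume) (𝓝 0) (𝓝 0) := by
  have hmp : ∀ s : ℝ, MeasurePreserving (fun t : ℝ => t - s) volume volume :=
    fun s => measurePreserving_sub_right volume s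
  let k : C(ℝ, C(ℝ, ℝ)) := (ContinuousMap.mk (fun p : ℝ × ℝ => p.2 - p.1) (by fun_prop)).curry
  have hc : Continuous fun s : ℝ =>
      Lp.compMeasurePreserving (k s) (hmp s) (hg.toLp g) :=
    continuous_const.compMeasurePreservingLp k.continuous hmp (by norm_num)
  have h0 : Tendsto (fun s : ℝ => ‖Lp.compMeasurePreserving (k s) (hmp s) (hg.toLp g) -
      hg.toLp g‖ₑ) (𝓝 0) (𝓝 0) := by
    have := ((hc.tendsto 0).sub_const (hg.toLp g)).enorm
    convert this using 2
    have : Lp.compMeasurePreserving (k 0) (hmp 0) (hg.toLp g) = hg.toLp g := by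
      refine Lp.ext ?_
      refine (Lp.coeFn_compMeasurePreserving _ _).trans (Eventually.of_forall fun t => ?_)
      simp [k]
    rw [this, sub_self, enorm_zero]
  refine h0.congr fun s => ?_
  rw [Lp.enorm_def]
  refine eLpNorm_congr_ae ?_
  filter_upwards [Lp.coeFn_sub (Lp.compMeasurePreserving (k s) (hmp s) (hg.toLp g)) (hg.toLp g),
    Lp.coeFn_compMeasurePreserving (hg.toLp g) (hmp s), hg.coeFn_toLp,
    (hmp s).quasiMeasurePreserving.ae hg.coeFn_toLp] with t h1 h2 h3 h4
  rw [h1, Pi.sub_apply]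
  erw [h2]
  rw [h3, ← h4]
  rfl

section Toolbox

variable {E F G : Type*} [NormedAddCommGroup E] [NormedSpace ℝ E] [NormedAddCommGroup F]
  [NormedSpace ℝ F] [NormedAddCommGroup G] [NormedSpace ℝ G]

theorem memLp_two_bilin_integrable {α : Type*} [MeasurableSpace α] {μ : Measure α}
    (B : E →L[ℝ] F →L[ℝ] G) {f : α → E} {g : α → F} (hf : MemLp f 2 μ) (hg : MemLp g 2 μ) :
    Integrable (fun x => B (f x) (g x)) μ :=
  memLp_one_iff_integrable.1
    (B.memLp_of_bilin 1 hf hg)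

/-- Fubini's theorem on the triangle `0 < r < s < T`, for a bilinear pairing. -/
theorem integral_bilin_primitive [CompleteSpace E] [CompleteSpace F] [CompleteSpace G]
    (B : E →L[ℝ] F →L[ℝ] G) {T : ℝ} (hT : 0 ≤ T) {a : ℝ → E}
    {b : ℝ → F} (ha : IntegrableOn a (Ioo 0 T)) (hb : IntegrableOn b (Ioo 0 T)) :
    ∫ s in 0..T, B (a s) (∫ r in 0..s, b r) = ∫ r in 0..T, B (∫ s in r..T, a s) (b r) := by
  rw [← integrableOn_Ioc_iff_integrableOn_Ioo] at ha hb
  set μ : Measure ℝ := volume.restrict (Ioc 0 T) with hμ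
  have hK : Integrable (({p : ℝ × ℝ | p.2 ≤ p.1}).indicator (fun p => B (a p.1) (b p.2)))
      (μ.prod μ) := by
    refine Integrable.indicator ?_ (measurableSet_le measurable_snd measurable_fst)
    exact Integrable.op_fst_snd (op := fun x y => B x y) (by fun_prop) ⟨‖B‖, B.le_opNorm₂⟩ ha hb
  have hsw := integral_integral_swap (μ := μ) (ν := μ)
    (f := fun s r => ({p : ℝ × ℝ | p.2 ≤ p.1}).indicator (fun p => B (a p.1) (b p.2)) (s, r)) hK
  rw [intervalIntegral.integral_of_le hT, intervalIntegral.integral_of_le hT]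
  refine Eq.trans ?_ (hsw.trans ?_)
  · refine setIntegral_congr_fun measurableSet_Ioc fun s hs => ?_
    have h1 : (fun r => ({p : ℝ × ℝ | p.2 ≤ p.1}).indicator (fun p => B (a p.1) (b p.2)) (s, r)) =
        (Iic s).indicator (fun r => B (a s) (b r)) := by
      ext r; simp [indicator]
    rw [h1, integral_indicator measurableSet_Iic, Measure.restrict_restrict measurableSet_Iic,
      intervalIntegral.integral_of_le hs.1.le]
    have h2 : Iic s ∩ Ioc 0 T = Ioc 0 s := by
      ext r; simp only [mem_inter_iff, mem_Iic, mem_Ioc]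
      constructor
      · rintro ⟨h, h', -⟩; exact ⟨h', h⟩
      · rintro ⟨h, h'⟩; exact ⟨h', h, h'.trans hs.2⟩
    rw [h2]
    exact ((B (a s)).integral_comp_comm (hb.mono_set (Ioc_subset_Ioc_right hs.2))).symm
  · refine setIntegral_congr_fun measurableSet_Ioc fun r hr => ?_
    have h1 : (fun s => ({p : ℝ × ℝ | p.2 ≤ p.1}).indicator (fun p => B (a p.1) (b p.2)) (s, r)) =
        (Ici r).indicator (fun s => B (a s) (b r)) := by
      ext s; simp [indicator]
    rw [h1, integral_indicator measurableSet_Ici, Measure.restrict_restrict measurableSet_Ici,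
      intervalIntegral.integral_of_le hr.2]
    have h2 : Ici r ∩ Ioc 0 T = Icc r T := by
      ext s; simp only [mem_inter_iff, mem_Ici, mem_Ioc, mem_Icc]
      constructor
      · rintro ⟨h, -, h'⟩; exact ⟨h, h'⟩
      · rintro ⟨h, h'⟩; exact ⟨h, hr.1.trans_le h, h'⟩
    rw [h2, integral_Icc_eq_integral_Ioc]
    exact (B.flip (b r)).integral_comp_comm (ha.mono_set (Ioc_subset_Ioc_left hr.1.le))

/-- The backward average `t ↦ h⁻¹ ∫_{t-h}^t g`. -/
noncomputable def backAvg (h : ℝ) (g : ℝ → E) (t : ℝ) : E := h⁻¹ • ∫ s in (t - h)..t, g s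

theorem backAvg_congr {g g' : ℝ → E} (h : g =ᵐ[volume] g') (k : ℝ) :
    backAvg k g = backAvg k g' := by
  funext t
  rw [backAvg, backAvg, intervalIntegral.integral_congr_ae (h.mono fun _ hx _ => hx)]

theorem continuous_backAvg {g : ℝ → E} (hg : LocallyIntegrable g volume) (h : ℝ) :
    Continuous (backAvg h g) := by
  have hi : ∀ a b, IntervalIntegrable g volume a b := fun a b =>
    (hg.integrableOn_isCompact isCompact_uIcc).intervalIntegrable
  have h1 : Continuous fun t => ∫ s in 0..t, g s := intervalIntegral.continuous_primitive hi 0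
  have h2 : backAvg h g = fun t => h⁻¹ • ((∫ s in 0..t, g s) - ∫ s in 0..(t - h), g s) := by
    funext t
    rw [backAvg, intervalIntegral.integral_interval_sub_left (hi _ _) (hi _ _)]
  rw [h2]
  exact ((h1.sub (h1.comp (continuous_id.sub continuous_const))).const_smul _)

/-- Backward averages converge in `L²`. By Jensen's inequality and Tonelli's theorem, the error is
at most the mean of the translation errors. -/
theorem eLpNorm_backAvg_sub_tendsto [CompleteSpace E] {g : ℝ → E} (hg : MemLp g 2 volume) :
    Tendsto (fun h => eLpNorm (backAvg h g - g) 2 volume) (𝓝[>] 0) (𝓝 0) := by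
  wlog hgm : StronglyMeasurable g generalizing g
  · have hae := hg.1.ae_eq_mk
    refine (this (hg.ae_eq hae) hg.1.stronglyMeasurable_mk).congr fun h => ?_
    rw [backAvg_congr hae]
    exact eLpNorm_congr_ae ((EventuallyEq.refl _ _).sub hae.symm)
  have hli : LocallyIntegrable g volume := hg.locallyIntegrable (by norm_num)
  have hom := eLpNorm_translate_sub_tendsto hg
  rw [ENNReal.tendsto_nhds_zero] at hom ⊢
  intro ε hε
  obtain ⟨δ, hδ, hδε⟩ := Metric.eventually_nhds_iff.1 (hom ε hε)
  filter_upwards [Ioo_mem_nhdsGT hδ] with h hh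
  have hh0 : 0 < h := hh.1
  -- the backward average is the mean of the translates of `g` for the uniform distribution on `(0, h]`
  set ν : Measure ℝ := ENNReal.ofReal h⁻¹ • volume.restrict (Ioc 0 h) with hν
  have hprob : IsProbabilityMeasure ν := by
    constructor
    rw [hν, Measure.smul_apply, Measure.restrict_apply_univ, Real.volume_Ioc, smul_eq_mul,
      sub_zero, ← ENNReal.ofReal_mul (by positivity), inv_mul_cancel₀ hh0.ne', ENNReal.ofReal_one]
  have hmeas : Measurable fun p : ℝ × ℝ => ‖g (p.1 - p.2) - g p.1‖ₑ ^ (2 : ℝ) :=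
    (((hgm.comp_measurable (measurable_fst.sub measurable_snd)).sub
      (hgm.comp_measurable measurable_fst)).enorm).pow_const _
  have hpt : ∀ t, ‖(backAvg h g - g) t‖ₑ ^ (2 : ℝ) ≤ ∫⁻ s, ‖g (t - s) - g t‖ₑ ^ (2 : ℝ) ∂ν := by
    intro t
    have hi : IntervalIntegrable g volume (t - h) t :=
      (hli.integrableOn_isCompact isCompact_uIcc).intervalIntegrable
    have e1 : (backAvg h g - g) t = ∫ s, (g (t - s) - g t) ∂ν := by
      rw [hν, integral_smul_measure, ENNReal.toReal_ofReal (by positivity),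
        ← intervalIntegral.integral_of_le hh0.le]
      rw [intervalIntegral.integral_sub]
      · rw [intervalIntegral.integral_comp_sub_left g t, intervalIntegral.integral_const]
        simp only [sub_zero, smul_sub, smul_smul, inv_mul_cancel₀ hh0.ne', one_smul]
        rfl
      · have := hi.comp_sub_left t
        simpa using this.symm
      · exact intervalIntegrable_const
    have hF : AEStronglyMeasurable (fun s => g (t - s) - g t) ν :=
      ((hgm.comp_measurable (measurable_const.sub measurable_id)).sub
        stronglyMeasurable_const).aestronglyMeasurable
    -- Jensen's inequality
    have h1 := eLpNorm'_le_eLpNorm'_of_exponent_le (p := 1) (q := 2) one_pos (by norm_num) ν hF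
    rw [eLpNorm'_eq_lintegral_enorm, eLpNorm'_eq_lintegral_enorm] at h1
    simp only [ENNReal.rpow_one, div_one] at h1
    rw [e1]
    calc ‖∫ s, (g (t - s) - g t) ∂ν‖ₑ ^ (2 : ℝ)
        ≤ (∫⁻ s, ‖g (t - s) - g t‖ₑ ∂ν) ^ (2 : ℝ) := by
          gcongr; exact enorm_integral_le_lintegral_enorm _
      _ ≤ ((∫⁻ s, ‖g (t - s) - g t‖ₑ ^ (2 : ℝ) ∂ν) ^ (1 / (2 : ℝ))) ^ (2 : ℝ) := by gcongr
      _ = _ := by rw [← ENNReal.rpow_mul]; norm_num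
  have hle : ∫⁻ t, ‖(backAvg h g - g) t‖ₑ ^ (2 : ℝ) ≤ ε ^ (2 : ℝ) := by
    calc ∫⁻ t, ‖(backAvg h g - g) t‖ₑ ^ (2 : ℝ)
        ≤ ∫⁻ t, ∫⁻ s, ‖g (t - s) - g t‖ₑ ^ (2 : ℝ) ∂ν := lintegral_mono hpt
      -- Tonelli's theorem; each translation error is at most `ε` since `s ≤ h < δ`
      _ = ∫⁻ s, (∫⁻ t, ‖g (t - s) - g t‖ₑ ^ (2 : ℝ)) ∂ν :=
          lintegral_lintegral_swap hmeas.aemeasurable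
      _ ≤ ∫⁻ _, ε ^ (2 : ℝ) ∂ν := by
          refine lintegral_mono_ae ?_
          have hs : ∀ᵐ s ∂ν, s ∈ Ioc 0 h :=
            Measure.ae_smul_measure (ae_restrict_mem measurableSet_Ioc) _
          filter_upwards [hs] with s hs
          have := hδε (y := s) (by
            rw [Real.dist_eq, sub_zero, abs_of_pos hs.1]; exact hs.2.trans_lt hh.2)
          rw [eLpNorm_eq_lintegral_rpow_enorm_toReal (by norm_num) (by norm_num)] at this
          have := ENNReal.rpow_le_rpow this (z := 2) (by norm_num)
          rw [← ENNReal.rpow_mul] at this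
          simpa using this
      _ = ε ^ (2 : ℝ) := by simp
  rw [eLpNorm_eq_lintegral_rpow_enorm_toReal (by norm_num) (by norm_num)]
  have := ENNReal.rpow_le_rpow hle (z := 1 / 2) (by norm_num)
  rw [← ENNReal.rpow_mul] at this
  simpa using this

/-- An integral form of Gronwall's inequality. -/
theorem integral_le_of_le_add_integral {T b : ℝ} (hT : 0 ≤ T) (hb : 0 ≤ b) {φ ρ : ℝ → ℝ}
    (hφ : ContinuousOn φ (Icc 0 T)) (hρ : ContinuousOn ρ (Icc 0 T))
    (hρ0 : ∀ t ∈ Icc 0 T, 0 ≤ ρ t)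
    (h : ∀ t ∈ Icc 0 T, φ t ≤ ρ t + b * ∫ s in 0..t, φ s) :
    ∫ s in 0..T, φ s ≤ Real.exp (b * T) * ∫ s in 0..T, ρ s := by
  have hint : ∀ ψ : ℝ → ℝ, ContinuousOn ψ (Icc 0 T) → ContinuousOn (fun t => ∫ s in 0..t, ψ s)
      (Icc 0 T) := fun ψ hψ => by
    rw [← uIcc_of_le hT] at hψ ⊢
    exact intervalIntegral.continuousOn_primitive_interval hψ.integrableOn_uIcc
  have hder : ∀ ψ : ℝ → ℝ, ContinuousOn ψ (Icc 0 T) → ∀ t ∈ Ioo 0 T,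
      HasDerivAt (fun t => ∫ s in 0..t, ψ s) (ψ t) t := fun ψ hψ t ht => by
    have hnh : Icc 0 T ∈ 𝓝 t := Icc_mem_nhds ht.1 ht.2
    refine intervalIntegral.integral_hasDerivAt_right ?_ ?_ (hψ.continuousAt hnh)
    · exact ((hψ.mono (Icc_subset_Icc_right ht.2.le)).mono (by
        rw [uIcc_of_le ht.1.le])).intervalIntegrable
    · exact (hψ.mono Ioo_subset_Icc_self).stronglyMeasurableAtFilter isOpen_Ioo t ht
  -- the hypothesis says exactly that `e^{-bt} ∫₀ᵗ φ` grows at a rate of at most `e^{-bt} ρ(t) ≤ ρ(t)`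
  let K : ℝ → ℝ := fun t => Real.exp (-(b * t)) * (∫ s in 0..t, φ s) - ∫ s in 0..t, ρ s
  have hK : AntitoneOn K (Icc 0 T) := by
    refine antitoneOn_of_hasDerivWithinAt_nonpos (convex_Icc 0 T)
      (f' := fun t => Real.exp (-(b * t)) * -b * (∫ s in 0..t, φ s) +
        Real.exp (-(b * t)) * φ t - ρ t) ?_ ?_ ?_
    · exact (ContinuousOn.mul (by fun_prop) (hint φ hφ)).sub (hint ρ hρ)
    · intro t ht
      rw [interior_Icc] at ht
      have he : HasDerivAt (fun t => Real.exp (-(b * t))) (Real.exp (-(b * t)) * -b) t := by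
        have := ((hasDerivAt_id t).const_mul b).neg.exp
        simpa using this
      exact ((he.mul (hder φ hφ t ht)).sub (hder ρ hρ t ht)).hasDerivWithinAt
    · intro t ht
      rw [interior_Icc] at ht
      have ht' := Ioo_subset_Icc_self ht
      have h1 := h t ht'
      have h2 : Real.exp (-(b * t)) ≤ 1 := Real.exp_le_one_iff.2 (by
        have := mul_nonneg hb ht.1.le; linarith)
      have h3 := Real.exp_pos (-(b * t))
      nlinarith [hρ0 t ht', mul_le_mul_of_nonneg_left h1 h3.le,
        mul_le_mul_of_nonneg_right h2 (hρ0 t ht')]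
  have := hK (left_mem_Icc.2 hT) (right_mem_Icc.2 hT) hT
  simp only [K, intervalIntegral.integral_same, mul_zero, sub_zero, sub_nonpos] at this
  calc ∫ s in 0..T, φ s = Real.exp (b * T) * (Real.exp (-(b * T)) * ∫ s in 0..T, φ s) := by
        rw [← mul_assoc, ← Real.exp_add, add_neg_cancel, Real.exp_zero, one_mul]
    _ ≤ _ := by gcongr

/-- Lions' projection lemma: a functional which is bounded by `‖M φ‖` is represented on the range
of `M` by a vector of the Hilbert space. -/
theorem exists_inner_eq_of_abs_le {X Φ : Type*} [NormedAddCommGroup X] [InnerProductSpace ℝ X]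
    [CompleteSpace X] [AddCommGroup Φ] [Module ℝ Φ] (M : Φ →ₗ[ℝ] X) (l : Φ →ₗ[ℝ] ℝ) (C : ℝ)
    (h : ∀ φ, |l φ| ≤ C * ‖M φ‖) : ∃ y : X, ∀ φ, inner ℝ y (M φ) = l φ := by
  have hker : LinearMap.ker M ≤ LinearMap.ker l := fun φ hφ => by
    rw [LinearMap.mem_ker] at hφ ⊢
    have := h φ
    rw [hφ, norm_zero, mul_zero] at this
    exact abs_nonpos_iff.1 this
  -- the functional factors through the range of `M`, where it is bounded
  obtain ⟨m, hm⟩ : ∃ m : LinearMap.range M →ₗ[ℝ] ℝ, ∀ φ, m (M.rangeRestrict φ) = l φ := by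
    refine ⟨(LinearMap.ker M).liftQ l hker ∘ₗ M.quotKerEquivRange.symm.toLinearMap, fun φ => ?_⟩
    have : M.rangeRestrict φ = M.quotKerEquivRange (Submodule.Quotient.mk φ) := rfl
    rw [this]
    simp
  let m' : StrongDual ℝ (LinearMap.range M) := m.mkContinuous C fun x => by
    obtain ⟨_, φ, rfl⟩ := x
    have := hm φ
    exact (congrArg abs this).le.trans (h φ)
  obtain ⟨g, hg, -⟩ := exists_extension_norm_eq _ m'
  refine ⟨(toDual ℝ X).symm g, fun φ => ?_⟩
  rw [toDual_symm_apply]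
  exact (hg (M.rangeRestrict φ)).trans (hm φ)

end Toolbox

end SemilinearParabolic

namespace SemilinearParabolic

/-! ### Paths in a Hilbert triple -/

section TimeVol

variable {E : Type*} [NormedAddCommGroup E]

theorem memLp_timeVol_of_continuousOn {T : ℝ} {f : ℝ → E} (hf : ContinuousOn f (Icc 0 T))
    (p : ℝ≥0∞) : MemLp f p (timeVol T) := by
  obtain ⟨C, hC⟩ := isCompact_Icc.exists_bound_of_continuousOn hf
  refine MemLp.of_bound ((hf.mono Ioo_subset_Icc_self).aestronglyMeasurable measurableSet_Ioo) C ?_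
  filter_upwards [ae_restrict_mem measurableSet_Ioo] with t ht using hC t (Ioo_subset_Icc_self ht)

theorem memLp_timeVol_integrableOn {T : ℝ} {f : ℝ → E} (hf : MemLp f 2 (timeVol T)) :
    IntegrableOn f (Ioo 0 T) := hf.integrable (by norm_num)

theorem integrableOn_intervalIntegrable {T : ℝ} {f : ℝ → E} (hf : IntegrableOn f (Ioo 0 T))
    {s t : ℝ} (hs : s ∈ Icc 0 T) (ht : t ∈ Icc 0 T) : IntervalIntegrable f volume s t := by
  rw [← integrableOn_Icc_iff_integrableOn_Ioo] at hf
  exact (hf.mono_set (uIcc_subset_Icc hs ht)).intervalIntegrable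

theorem memLp_indicator_timeVol {T : ℝ} {f : ℝ → E} (hf : MemLp f 2 (timeVol T)) :
    MemLp ((Ioo 0 T).indicator f) 2 volume :=
  (memLp_indicator_iff_restrict measurableSet_Ioo).2 hf

theorem memLp_two_locallyIntegrable {f : ℝ → E} (hf : MemLp f 2 volume) :
    LocallyIntegrable f volume := hf.locallyIntegrable (by norm_num)

theorem locallyIntegrable_intervalIntegrable {f : ℝ → E} (hf : LocallyIntegrable f volume)
    (a b : ℝ) : IntervalIntegrable f volume a b :=
  (hf.integrableOn_isCompact isCompact_uIcc).intervalIntegrable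

end TimeVol

section Pairing

variable {E F G : Type*} [NormedAddCommGroup E] [NormedSpace ℝ E] [NormedAddCommGroup F]
  [NormedSpace ℝ F] [NormedAddCommGroup G] [NormedSpace ℝ G] [CompleteSpace G]

theorem tendsto_integral_bilin {α ι : Type*} [MeasurableSpace α] {μ : Measure α} {l : Filter ι}
    (B : E →L[ℝ] F →L[ℝ] G) {f : ι → α → E} {f₀ : α → E} {g : α → F}
    (hf : ∀ i, MemLp (f i) 2 μ) (hf₀ : MemLp f₀ 2 μ) (hg : MemLp g 2 μ)
    (h : Tendsto (fun i => eLpNorm (f i - f₀) 2 μ) l (𝓝 0)) :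
    Tendsto (fun i => ∫ x, B (f i x) (g x) ∂μ) l (𝓝 (∫ x, B (f₀ x) (g x) ∂μ)) := by
  have h1 := (Lp.tendsto_Lp_iff_tendsto_eLpNorm'' f hf f₀ hf₀).2 h
  have h2 := (((B.lpPairing μ 2 2).flip (hg.toLp g)).continuous.tendsto _).comp h1
  have key : ∀ (k : α → E) (hk : MemLp k 2 μ),
      (B.lpPairing μ 2 2).flip (hg.toLp g) (hk.toLp k) = ∫ x, B (k x) (g x) ∂μ := fun k hk => by
    rw [ContinuousLinearMap.flip_apply, ContinuousLinearMap.lpPairing_eq_integral]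
    refine integral_congr_ae ?_
    filter_upwards [hk.coeFn_toLp, hg.coeFn_toLp] with x h1 h2
    rw [h1, h2]
  rw [key] at h2
  exact h2.congr fun i => key _ (hf i)

theorem ae_timeVol_imp {T : ℝ} {p : ℝ → Prop} (h : ∀ᵐ t ∂timeVol T, p t) {t : ℝ}
    (ht : t ∈ Icc 0 T) : ∀ᵐ s ∂(volume : Measure ℝ), s ∈ Ioc 0 t → p s := by
  have h1 := (ae_restrict_iff' measurableSet_Ioo).1 h
  have h2 : ∀ᵐ s ∂(volume : Measure ℝ), s ≠ T := by
    simp [ae_iff, measure_singleton]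
  filter_upwards [h1, h2] with s hs hsT hst
  exact hs ⟨hst.1, lt_of_le_of_ne (hst.2.trans ht.2) hsT⟩

theorem setIntegral_timeVol_eq {T : ℝ} (hT : 0 ≤ T) (f : ℝ → E) :
    ∫ t in Ioo 0 T, f t = ∫ t in 0..T, f t := by
  rw [intervalIntegral.integral_of_le hT, integral_Ioc_eq_integral_Ioo]

end Pairing

section Path

variable {V H : Type*} [NormedAddCommGroup V] [NormedSpace ℝ V]
  [NormedAddCommGroup H] [InnerProductSpace ℝ H]

/-- The map `H → V'`, `h ↦ (v ↦ ⟨h, j v⟩)`, for a continuous linear map `j : V → H`. -/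
noncomputable def dualEmb (j : V →L[ℝ] H) : H →L[ℝ] StrongDual ℝ V :=
  ((ContinuousLinearMap.compL ℝ V H ℝ).flip j).comp (innerSL ℝ)

@[simp] theorem dualEmb_apply (j : V →L[ℝ] H) (h : H) (v : V) :
    dualEmb j h v = inner ℝ h (j v) := rfl

/-- `y ∈ L²(0,T;V)` has the derivative `z ∈ L²(0,T;V')` and the continuous representative
`Y : [0,T] → H`. The derivative is expressed by the integrated identity
`Y(t) = Y(0) + ∫₀ᵗ z` in `V'`. -/
structure IsPath (j : V →L[ℝ] H) (T : ℝ) (y : ℝ → V) (z : ℝ → StrongDual ℝ V) (Y : ℝ → H) :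
    Prop where
  memLp : MemLp y 2 (timeVol T)
  memLp_deriv : MemLp z 2 (timeVol T)
  continuousOn : ContinuousOn Y (Icc 0 T)
  ae_eq : ∀ᵐ t ∂timeVol T, Y t = j (y t)
  primitive : ∀ t ∈ Icc 0 T, dualEmb j (Y t) = dualEmb j (Y 0) + ∫ s in 0..t, z s

variable {j : V →L[ℝ] H} {T : ℝ} {y y' : ℝ → V} {z z' : ℝ → StrongDual ℝ V} {Y Y' : ℝ → H}

theorem IsPath.congr_deriv (h : IsPath j T y z Y) (hz : z =ᵐ[timeVol T] z') :
    IsPath j T y z' Y where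
  memLp := h.memLp
  memLp_deriv := h.memLp_deriv.ae_eq hz
  continuousOn := h.continuousOn
  ae_eq := h.ae_eq
  primitive t ht := by
    rw [h.primitive t ht, intervalIntegral.integral_congr_ae]
    rw [uIoc_of_le ht.1]
    exact ae_timeVol_imp hz ht

theorem IsPath.sub (h : IsPath j T y z Y) (h' : IsPath j T y' z' Y') :
    IsPath j T (y - y') (z - z') (Y - Y') where
  memLp := h.memLp.sub h'.memLp
  memLp_deriv := h.memLp_deriv.sub h'.memLp_deriv
  continuousOn := h.continuousOn.sub h'.continuousOn
  ae_eq := by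
    filter_upwards [h.ae_eq, h'.ae_eq] with t h1 h2
    simp [h1, h2]
  primitive t ht := by
    have h0 : (0 : ℝ) ∈ Icc 0 T := ⟨le_rfl, ht.1.trans ht.2⟩
    simp only [Pi.sub_apply, map_sub]
    rw [h.primitive t ht, h'.primitive t ht, intervalIntegral.integral_sub
      (integrableOn_intervalIntegrable (memLp_timeVol_integrableOn h.memLp_deriv) h0 ht)
      (integrableOn_intervalIntegrable (memLp_timeVol_integrableOn h'.memLp_deriv) h0 ht)]
    abel

/-- Chain rule (as an inequality) for a functional `Ψ` on `H` with subgradient `β`: backward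
difference quotients of `Y` tested with `β(Y)` dominate those of `Ψ(Y)`, and they converge to the
pairing of the derivative with `β(Y)`, provided the latter is in `L²(0,T;V)`. -/
theorem IsPath.chain_rule_le [CompleteSpace V] (h : IsPath j T y z Y) {Ψ : H → ℝ} {β : H → H}
    (hΨ : Continuous Ψ)
    (hβ : ∀ h₁ h₂, Ψ h₁ - Ψ h₂ ≤ inner ℝ (β h₁) (h₁ - h₂)) {b : ℝ → V}
    (hb : MemLp b 2 (timeVol T)) (hjb : ∀ᵐ t ∂timeVol T, j (b t) = β (Y t)) {t : ℝ}
    (ht : t ∈ Icc 0 T) : Ψ (Y t) - Ψ (Y 0) ≤ ∫ s in 0..t, z s (b s) := by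
  have hT : 0 ≤ T := ht.1.trans ht.2
  -- `Y` is extended by its end values, and its derivative by zero; the primitive identity then holds
  -- for all times up to `T`, the negative ones included
  obtain ⟨Z, hZd⟩ : ∃ Z : ℝ → H, Z = fun s => Y (max 0 (min T s)) := ⟨_, rfl⟩
  have hZc : Continuous Z := hZd ▸ h.continuousOn.comp_continuous (by fun_prop)
    fun s => ⟨le_max_left _ _, max_le hT (min_le_left _ _)⟩
  have hZ : ∀ s ∈ Icc 0 T, Z s = Y s := fun s hs => by
    simp only [hZd]; rw [min_eq_right hs.2, max_eq_right hs.1]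
  have hZneg : ∀ s ≤ 0, Z s = Y 0 := fun s hs => by
    simp only [hZd]; rw [min_eq_right (hs.trans hT), max_eq_left hs]
  obtain ⟨ζ, hζd⟩ : ∃ ζ : ℝ → StrongDual ℝ V, ζ = (Ioo 0 T).indicator z := ⟨_, rfl⟩
  have hζ : MemLp ζ 2 volume := by
    rw [hζd]; exact memLp_indicator_timeVol h.memLp_deriv
  have hζl : LocallyIntegrable ζ volume := memLp_two_locallyIntegrable hζ
  have hζi : ∀ a b, IntervalIntegrable ζ volume a b :=
    locallyIntegrable_intervalIntegrable hζl
  have hζz : ∀ s ∈ Icc 0 T, ∫ r in 0..s, ζ r = ∫ r in 0..s, z r := fun s hs => by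
    refine intervalIntegral.integral_congr_ae ?_
    rw [uIoc_of_le hs.1]
    refine ae_timeVol_imp ?_ hs
    filter_upwards [ae_restrict_mem measurableSet_Ioo] with r hr
    rw [hζd, indicator_of_mem hr]
  have hprim : ∀ s ≤ T, dualEmb j (Z s) = dualEmb j (Y 0) + ∫ r in 0..s, ζ r := fun s hs => by
    rcases le_total 0 s with h0 | h0
    · rw [hZ s ⟨h0, hs⟩, hζz s ⟨h0, hs⟩, h.primitive s ⟨h0, hs⟩]
    · rw [hZneg s h0, intervalIntegral.integral_zero_ae, add_zero]
      refine Eventually.of_forall fun r hr => hζd ▸ indicator_of_notMem (fun h' => ?_) _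
      rw [uIoc_of_ge h0] at hr
      exact absurd h'.1 (not_lt.2 hr.2)
  have hdiff : ∀ k, 0 < k → ∀ s ≤ T, dualEmb j (k⁻¹ • (Z s - Z (s - k))) = backAvg k ζ s := by
    intro k hk s hs
    rw [map_smul, map_sub, hprim s hs, hprim (s - k) (by linarith), backAvg,
      add_sub_add_left_eq_sub, intervalIntegral.integral_interval_sub_left (hζi _ _) (hζi _ _)]
  -- `k⁻¹ (p(s) - p(s - k))` is the mean of `Ψ(Z)` over `[s - k, s]`
  obtain ⟨p, hp⟩ : ∃ p : ℝ → ℝ, p = fun s => ∫ r in 0..s, Ψ (Z r) := ⟨_, rfl⟩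
  have hΨZ : Continuous fun r => Ψ (Z r) := hΨ.comp hZc
  have hΨZs : ∀ k, Continuous fun s => Ψ (Z (s - k)) := fun k => by fun_prop
  have hpi : ∀ a b, IntervalIntegrable (fun r => Ψ (Z r)) volume a b := fun a b =>
    hΨZ.intervalIntegrable a b
  have hlim : ∀ s, Tendsto (fun k => k⁻¹ * (p s - p (s - k))) (𝓝[>] 0) (𝓝 (Ψ (Z s))) := by
    intro s
    have hd : HasDerivAt p (Ψ (Z s)) s := hp ▸ hΨZ.integral_hasStrictDerivAt 0 s |>.hasDerivAt
    have h1 : HasDerivAt (fun k => p (s - k)) (Ψ (Z s) * (-1)) 0 := by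
      have h2 : HasDerivAt (fun k : ℝ => s - k) (-1) 0 := (hasDerivAt_id (0 : ℝ)).const_sub s
      exact HasDerivAt.comp (h₂ := p) 0 (by simpa using hd) h2
    have h3 := h1.tendsto_slope_zero_right
    have h4 := h3.neg
    simp only [mul_neg, mul_one, neg_neg] at h4
    refine h4.congr fun k => ?_
    simp only [zero_add, sub_zero, smul_eq_mul]
    ring
  have hL : ∀ k, k⁻¹ * (p t - p (t - k)) - k⁻¹ * (p 0 - p (0 - k)) =
      ∫ s in 0..t, k⁻¹ * (Ψ (Z s) - Ψ (Z (s - k))) := by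
    intro k
    have e1 : ∫ s in 0..t, Ψ (Z (s - k)) = p (t - k) - p (0 - k) := by
      rw [intervalIntegral.integral_comp_sub_right (fun s => Ψ (Z s)) k]
      rw [hp]
      exact (intervalIntegral.integral_interval_sub_left (hpi _ _) (hpi _ _)).symm
    rw [intervalIntegral.integral_const_mul, intervalIntegral.integral_sub (hpi _ _)
      ((hΨZs k).intervalIntegrable _ _), e1]
    simp only [hp, intervalIntegral.integral_same]
    ring
  have hbt : MemLp b 2 (timeVol t) := hb.mono_measure
    (Measure.restrict_mono (Ioo_subset_Ioo_right ht.2) le_rfl)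
  have hζt : MemLp ζ 2 (timeVol t) := hζ.restrict _
  have hav : ∀ k, MemLp (backAvg k ζ) 2 (timeVol t) := fun k =>
    memLp_timeVol_of_continuousOn (continuous_backAvg hζl k).continuousOn 2
  -- the averages of `ζ` converge in `L²`, and `b` is in `L²`
  have hR : Tendsto (fun k => ∫ s in 0..t, backAvg k ζ s (b s)) (𝓝[>] 0)
      (𝓝 (∫ s in 0..t, ζ s (b s))) := by
    have h1 : Tendsto (fun k => eLpNorm (backAvg k ζ - ζ) 2 (timeVol t)) (𝓝[>] 0) (𝓝 0) :=
      tendsto_of_tendsto_of_tendsto_of_le_of_le tendsto_const_nhds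
        (eLpNorm_backAvg_sub_tendsto hζ) (fun _ => zero_le) fun k =>
          eLpNorm_mono_measure _ Measure.restrict_le_self
    have h2 := tendsto_integral_bilin (ContinuousLinearMap.id ℝ (StrongDual ℝ V)) hav hζt hbt h1
    simp only [ContinuousLinearMap.id_apply, setIntegral_timeVol_eq ht.1] at h2
    exact h2
  have hfin : ∫ s in 0..t, ζ s (b s) = ∫ s in 0..t, z s (b s) := by
    refine intervalIntegral.integral_congr_ae ?_
    rw [uIoc_of_le ht.1]
    refine ae_timeVol_imp ?_ ht
    filter_upwards [ae_restrict_mem measurableSet_Ioo] with r hr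
    simp only [hζd, indicator_of_mem hr]
  rw [← hfin, ← hZ t ht, ← hZneg 0 le_rfl]
  refine le_of_tendsto_of_tendsto ((hlim t).sub (hlim 0)) hR ?_
  filter_upwards [self_mem_nhdsWithin] with k hk
  have hk : 0 < k := hk
  rw [hL k]
  refine intervalIntegral.integral_mono_ae_restrict ht.1 ?_ ?_ ?_
  · exact (continuous_const.mul (hΨZ.sub (hΨZs k))).intervalIntegrable _ _
  · exact integrableOn_intervalIntegrable (memLp_two_bilin_integrable
      (ContinuousLinearMap.id ℝ (StrongDual ℝ V)) (hav k) hbt) ⟨le_rfl, ht.1⟩ ⟨ht.1, le_rfl⟩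
  · rw [EventuallyLE, ← restrict_Ioo_eq_restrict_Icc, ae_restrict_iff' measurableSet_Ioo]
    filter_upwards [(ae_restrict_iff' measurableSet_Ioo).1 hjb] with s hs hst
    have hsT : s ∈ Ioo 0 T := ⟨hst.1, hst.2.trans_le ht.2⟩
    have h1 := hs hsT
    rw [← hZ s (Ioo_subset_Icc_self hsT)] at h1
    -- the subgradient inequality, divided by `k`
    rw [← hdiff k hk s hsT.2.le, dualEmb_apply, h1, real_inner_comm, real_inner_smul_right]
    exact mul_le_mul_of_nonneg_left (hβ _ _) (by positivity)

/-- The energy inequality: the chain rule for `Ψ = ‖·‖² / 2`. -/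
theorem IsPath.energy_le [CompleteSpace V] (h : IsPath j T y z Y) {t : ℝ} (ht : t ∈ Icc 0 T) :
    ‖Y t‖ ^ 2 - ‖Y 0‖ ^ 2 ≤ 2 * ∫ s in 0..t, z s (y s) := by
  have := h.chain_rule_le (Ψ := fun v => ‖v‖ ^ 2 / 2) (β := id) (by fun_prop)
    (fun h₁ h₂ => by
      have e := norm_sub_sq_real h₁ h₂
      have e2 := sq_nonneg ‖h₁ - h₂‖
      simp only [id, inner_sub_right, real_inner_self_eq_norm_sq]
      linarith) h.memLp
    (by filter_upwards [h.ae_eq] with s hs using hs.symm) ht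
  linarith

end Path

end SemilinearParabolic

namespace SemilinearParabolic

/-! ### Distributional derivatives in time -/

section DuBoisReymond

variable {E : Type*} [NormedAddCommGroup E] [NormedSpace ℝ E] [CompleteSpace E]

/-- Integration by parts of a primitive against a `C¹` function vanishing at the right end point. -/
theorem integral_deriv_smul_primitive {T : ℝ} (hT : 0 ≤ T) {ψ : ℝ → ℝ} (hψ : ContDiff ℝ 1 ψ)
    (hψT : ψ T = 0) {z : ℝ → E} (hz : IntegrableOn z (Ioo 0 T)) :
    ∫ s in 0..T, deriv ψ s • ∫ r in 0..s, z r = -∫ s in 0..T, ψ s • z s := by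
  have hc : Continuous (deriv ψ) := hψ.continuous_deriv le_rfl
  have h := integral_bilin_primitive (ContinuousLinearMap.lsmul ℝ ℝ : ℝ →L[ℝ] E →L[ℝ] E) hT
    (a := deriv ψ) (b := z) (hc.integrableOn_Icc.mono_set Ioo_subset_Icc_self) hz
  simp only [ContinuousLinearMap.lsmul_apply] at h
  rw [h, ← intervalIntegral.integral_neg]
  refine intervalIntegral.integral_congr fun r _ => ?_
  rw [intervalIntegral.integral_deriv_eq_sub (fun x _ => hψ.differentiable (by simp) x)
    (hc.intervalIntegrable _ _), hψT, zero_sub, neg_smul]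

/-- A primitive `∫_a^t θ` of a smooth function is smooth. -/
theorem contDiff_primitive {θ : ℝ → ℝ} (hθ : ContDiff ℝ ∞ θ) (a : ℝ) :
    ContDiff ℝ ∞ (fun t => ∫ s in a..t, θ s) ∧ deriv (fun t => ∫ s in a..t, θ s) = θ := by
  have hd : deriv (fun t => ∫ s in a..t, θ s) = θ := by
    funext t
    exact (hθ.continuous.integral_hasStrictDerivAt a t).hasDerivAt.deriv
  refine ⟨contDiff_infty_iff_deriv.2 ⟨fun t => ?_, by rwa [hd]⟩, hd⟩
  exact (hθ.continuous.integral_hasStrictDerivAt a t).hasDerivAt.differentiableAt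

/-- Du Bois-Reymond: a continuous function with vanishing distributional derivative is constant. -/
theorem eq_of_integral_deriv_smul_eq_zero {T : ℝ} (hT : 0 < T) {D : ℝ → E}
    (hD : ContinuousOn D (Icc 0 T))
    (h : ∀ ψ : TimeTest T, ∫ t in Ioo 0 T, deriv ψ t • D t = 0) {t : ℝ} (ht : t ∈ Icc 0 T) :
    D t = D 0 := by
  -- a test function of integral one
  let β : ContDiffBump (T / 2) := ⟨T / 8, T / 4, by positivity, by linarith⟩
  let θ₀ : ℝ → ℝ := β.normed volume
  have hθ₀ : ContDiff ℝ ∞ θ₀ := β.contDiff_normed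
  have hθ₀c : HasCompactSupport θ₀ := β.hasCompactSupport_normed
  have hθ₀s : tsupport θ₀ ⊆ Ioo 0 T := by
    rw [β.tsupport_normed_eq, Real.closedBall_eq_Icc]
    intro s hs
    have h1 : β.rOut = T / 4 := rfl
    rw [h1] at hs
    exact ⟨by linarith [hs.1], by linarith [hs.2]⟩
  have hθ₀i : ∫ s, θ₀ s = 1 := β.integral_normed
  have hDi : IntegrableOn D (Ioo 0 T) := hD.integrableOn_Icc.mono_set Ioo_subset_Icc_self
  have hprod : ∀ θ : ℝ → ℝ, Continuous θ → HasCompactSupport θ →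
      Integrable (fun s => θ s • D s) (timeVol T) := fun θ hc hs =>
    timeTest_integrable hc hs (memLp_timeVol_of_continuousOn hD 2)
  set c : E := ∫ s in Ioo 0 T, θ₀ s • D s with hc
  have key : ∀ θ : ℝ → ℝ, ContDiff ℝ ∞ θ → HasCompactSupport θ → tsupport θ ⊆ Ioo 0 T →
      ∫ s, θ s • (Ioo 0 T).indicator (fun s => D s - c) s = 0 := by
    intro θ hθ hθc hθs
    set m : ℝ := ∫ s, θ s with hm
    -- `η` has mean value zero, so its primitive is again a test function
    let η : ℝ → ℝ := fun s => θ s - m * θ₀ s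
    have hη : ContDiff ℝ ∞ η := hθ.sub (contDiff_const.mul hθ₀)
    have hηi : ∫ s, η s = 0 := by
      simp only [η]
      rw [integral_sub (hθ.continuous.integrable_of_hasCompactSupport hθc)
        ((hθ₀.continuous.integrable_of_hasCompactSupport hθ₀c).const_mul _),
        integral_const_mul, hθ₀i, mul_one, sub_self]
    -- an interval `[a, b] ⊆ (0, T)` outside which `η` vanishes; adjoining `T / 2` makes `K` nonempty
    let K : Set ℝ := insert (T / 2) (tsupport θ ∪ tsupport θ₀)
    have hK : IsCompact K := (hθc.isCompact.union hθ₀c.isCompact).insert _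
    have hKs : K ⊆ Ioo 0 T :=
      insert_subset ⟨by positivity, by linarith⟩ (union_subset hθs hθ₀s)
    obtain ⟨a, haK, ha⟩ := hK.exists_isLeast ⟨_, mem_insert _ _⟩
    obtain ⟨b, hbK, hb⟩ := hK.exists_isGreatest ⟨_, mem_insert _ _⟩
    have hη0 : ∀ s, s ∉ Icc a b → η s = 0 := fun s hs => by
      have hsK : s ∉ K := fun h' => hs ⟨ha h', hb h'⟩
      have h1 : θ s = 0 := image_eq_zero_of_notMem_tsupport fun h' =>
        hsK (mem_insert_of_mem _ (Or.inl h'))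
      have h2 : θ₀ s = 0 := image_eq_zero_of_notMem_tsupport fun h' =>
        hsK (mem_insert_of_mem _ (Or.inr h'))
      simp [η, h1, h2]
    have hab : a ≤ b := ha hbK
    have hηab : ∫ s in a..b, η s = 0 := by
      rw [intervalIntegral.integral_of_le hab, ← integral_Icc_eq_integral_Ioc,
        setIntegral_eq_integral_of_forall_compl_eq_zero hη0, hηi]
    obtain ⟨hψs, hψd⟩ := contDiff_primitive hη a
    have hψ0 : ∀ t, t ∉ Icc a b → ∫ s in a..t, η s = 0 := fun t ht => by
      rcases lt_or_ge t a with h1 | h1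
      · refine intervalIntegral.integral_zero_ae ?_
        have : ∀ᵐ s ∂(volume : Measure ℝ), s ≠ a := by simp [ae_iff, measure_singleton]
        filter_upwards [this] with s hsa hs
        rw [uIoc_of_ge h1.le] at hs
        exact hη0 s fun h' => hsa (le_antisymm hs.2 h'.1)
      · have h2 : b < t := lt_of_not_ge fun h' => ht ⟨h1, h'⟩
        rw [← intervalIntegral.integral_add_adjacent_intervals
          (hη.continuous.intervalIntegrable a b) (hη.continuous.intervalIntegrable b t), hηab,
          zero_add]
        refine intervalIntegral.integral_zero_ae (Eventually.of_forall fun s hs => ?_)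
        rw [uIoc_of_le h2.le] at hs
        exact hη0 s fun h' => absurd h'.2 (not_le.2 hs.1)
    have hsupp : Function.support (fun t => ∫ s in a..t, η s) ⊆ Icc a b := fun t ht => by
      by_contra h'
      exact ht (hψ0 t h')
    let ψ : TimeTest T := ⟨fun t => ∫ s in a..t, η s, hψs,
      HasCompactSupport.of_support_subset_isCompact isCompact_Icc hsupp,
      (closure_minimal hsupp isClosed_Icc).trans fun t ht =>
        ⟨(hKs haK).1.trans_le ht.1, ht.2.trans_lt (hKs hbK).2⟩⟩
    have hψ := h ψ
    have hψd' : deriv ψ = η := hψd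
    rw [hψd'] at hψ
    have i₀ : Integrable (fun s => m • θ₀ s • D s) (timeVol T) :=
      (hprod θ₀ hθ₀.continuous hθ₀c).smul m
    have e1 : ∫ s in Ioo 0 T, η s • D s = (∫ s in Ioo 0 T, θ s • D s) - m • c := by
      rw [hc, ← integral_smul, ← integral_sub (hprod θ hθ.continuous hθc) i₀]
      refine integral_congr_ae (Eventually.of_forall fun s => ?_)
      simp [η, sub_smul, mul_smul]
    have e2 : ∫ s in Ioo 0 T, θ s • c = m • c := by
      rw [integral_smul_const, setIntegral_eq_integral_of_forall_compl_eq_zero]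
      exact fun s hs => image_eq_zero_of_notMem_tsupport fun h' => hs (hθs h')
    have e3 : ∀ s, θ s • (Ioo 0 T).indicator (fun s => D s - c) s =
        (Ioo 0 T).indicator (fun s => θ s • D s - θ s • c) s := fun s => by
      by_cases hs : s ∈ Ioo 0 T
      · simp [indicator_of_mem hs, smul_sub]
      · simp [indicator_of_notMem hs]
    simp only [e3]
    rw [integral_indicator measurableSet_Ioo, integral_sub (hprod θ hθ.continuous hθc), e2,
      ← e1, hψ]
    exact (hθ.continuous.integrable_of_hasCompactSupport hθc).restrict.smul_const c
  have hli : LocallyIntegrableOn ((Ioo 0 T).indicator fun s => D s - c) (Ioo 0 T) volume := by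
    refine Integrable.locallyIntegrable ?_ |>.locallyIntegrableOn _
    exact (integrable_indicator_iff measurableSet_Ioo).2
      (hDi.sub (integrableOn_const (by simp)))
  have hae := isOpen_Ioo.ae_eq_zero_of_integral_contDiff_smul_eq_zero hli key
  have hcont : ∀ t ∈ Ioo 0 T, D t = c := by
    have h1 : (fun s => D s) =ᵐ[volume.restrict (Ioo 0 T)] fun _ => c := by
      rw [EventuallyEq, ae_restrict_iff' measurableSet_Ioo]
      filter_upwards [hae] with s hs hsT
      have := hs hsT
      rw [indicator_of_mem hsT] at this
      exact sub_eq_zero.1 this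
    exact fun t ht => Measure.eqOn_open_of_ae_eq h1 isOpen_Ioo
      (hD.mono Ioo_subset_Icc_self) continuousOn_const ht
  have hcl : ∀ t ∈ Icc 0 T, D t = c := by
    have h2 : closure (Ioo 0 T) = Icc 0 T := closure_Ioo hT.ne
    intro t ht
    have h3 : EqOn D (fun _ => c) (Icc 0 T) :=
      Set.EqOn.of_subset_closure (s := Ioo 0 T) hcont hD continuousOn_const Ioo_subset_Icc_self
        h2.ge
    exact h3 ht
  rw [hcl t ht, hcl 0 ⟨le_rfl, hT.le⟩]

end DuBoisReymond

section PathDeriv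

variable {V H : Type*} [NormedAddCommGroup V] [NormedSpace ℝ V]
  [NormedAddCommGroup H] [InnerProductSpace ℝ H]
  {j : V →L[ℝ] H} {T : ℝ} {y : ℝ → V} {z : ℝ → StrongDual ℝ V} {Y : ℝ → H}

theorem integral_deriv_smul_const {E : Type*} [NormedAddCommGroup E] [NormedSpace ℝ E]
    [CompleteSpace E] (ψ : TimeTest T) (c : E) :
    ∫ s in 0..T, deriv ψ s • c = 0 := by
  have hψ1 : ContDiff ℝ 1 ψ := ψ.contDiff.of_le (by simp)
  have h0 : ∀ s, s ∉ Ioo 0 T → ψ s = 0 := fun s hs =>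
    image_eq_zero_of_notMem_tsupport fun h' => hs (ψ.tsupport_subset h')
  rw [intervalIntegral.integral_smul_const, intervalIntegral.integral_deriv_eq_sub
    (fun x _ => hψ1.differentiable (by simp) x)
    ((hψ1.continuous_deriv le_rfl).intervalIntegrable _ _), h0 T (by simp), h0 0 (by simp)]
  simp

/-- The derivative of a path is its derivative in the sense of distributions. -/
theorem IsPath.integral_deriv_smul (h : IsPath j T y z Y) (hT : 0 ≤ T) (ψ : TimeTest T) :
    ∫ t in Ioo 0 T, deriv ψ t • dualEmb j (j (y t)) = -∫ t in Ioo 0 T, ψ t • z t := by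
  have hψ1 : ContDiff ℝ 1 ψ := ψ.contDiff.of_le (by simp)
  have hc : Continuous (deriv ψ) := hψ1.continuous_deriv le_rfl
  have hψT : ψ T = 0 :=
    image_eq_zero_of_notMem_tsupport fun h' => lt_irrefl T (ψ.tsupport_subset h').2
  have hzi := memLp_timeVol_integrableOn h.memLp_deriv
  have hpc : ContinuousOn (fun t => ∫ s in 0..t, z s) (Icc 0 T) := by
    have := intervalIntegral.continuousOn_primitive_interval (a := 0) (b := T) (f := z)
      (μ := volume) (by rwa [uIcc_of_le hT, integrableOn_Icc_iff_integrableOn_Ioo])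
    rwa [uIcc_of_le hT] at this
  rw [setIntegral_timeVol_eq hT, setIntegral_timeVol_eq hT,
    ← integral_deriv_smul_primitive hT hψ1 hψT hzi]
  have e : ∫ s in 0..T, deriv ψ s • dualEmb j (j (y s)) =
      ∫ s in 0..T, (deriv ψ s • dualEmb j (Y 0) + deriv ψ s • ∫ r in 0..s, z r) := by
    rw [← setIntegral_timeVol_eq hT, ← setIntegral_timeVol_eq hT]
    refine integral_congr_ae ?_
    filter_upwards [h.ae_eq, ae_restrict_mem measurableSet_Ioo] with t ht htT
    rw [← ht, h.primitive t (Ioo_subset_Icc_self htT), smul_add]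
  rw [e, intervalIntegral.integral_add, integral_deriv_smul_const, zero_add]
  · exact (hc.smul continuous_const).intervalIntegrable _ _
  · refine ContinuousOn.intervalIntegrable ?_
    rw [uIcc_of_le hT]
    exact hc.continuousOn.smul hpc

/-- A weak derivative in the sense of distributions, together with a continuous representative,
gives a path. -/
theorem isPath_of_integral_deriv_smul (hT : 0 < T) (hy : MemLp y 2 (timeVol T))
    (hz : MemLp z 2 (timeVol T)) (hY : ContinuousOn Y (Icc 0 T))
    (hae : ∀ᵐ t ∂timeVol T, Y t = j (y t))
    (h : ∀ ψ : TimeTest T, ∫ t in Ioo 0 T, deriv ψ t • dualEmb j (j (y t)) =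
      -∫ t in Ioo 0 T, ψ t • z t) : IsPath j T y z Y := by
  refine ⟨hy, hz, hY, hae, fun t ht => ?_⟩
  have hzi := memLp_timeVol_integrableOn hz
  have hpc : ContinuousOn (fun t => ∫ s in 0..t, z s) (Icc 0 T) := by
    have := intervalIntegral.continuousOn_primitive_interval (a := 0) (b := T) (f := z)
      (μ := volume) (by rwa [uIcc_of_le hT.le, integrableOn_Icc_iff_integrableOn_Ioo])
    rwa [uIcc_of_le hT.le] at this
  have hYc : ContinuousOn (fun t => dualEmb j (Y t)) (Icc 0 T) :=
    (dualEmb j).continuous.comp_continuousOn hY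
  have := eq_of_integral_deriv_smul_eq_zero hT (D := fun t => dualEmb j (Y t) - ∫ s in 0..t, z s)
    (hYc.sub hpc) (fun ψ => ?_) ht
  · simp only [intervalIntegral.integral_same, sub_zero] at this
    rw [← this, sub_add_cancel]
  · have hψ1 : ContDiff ℝ 1 ψ := ψ.contDiff.of_le (by simp)
    have hc : Continuous (deriv ψ) := hψ1.continuous_deriv le_rfl
    have hψT : ψ T = 0 :=
      image_eq_zero_of_notMem_tsupport fun h' => lt_irrefl T (ψ.tsupport_subset h').2
    have h1 := h ψ
    rw [setIntegral_timeVol_eq hT.le (fun t => ψ t • z t),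
      ← integral_deriv_smul_primitive hT.le hψ1 hψT hzi] at h1
    have e : ∫ t in Ioo 0 T, deriv ψ t • dualEmb j (j (y t)) =
        ∫ t in Ioo 0 T, deriv ψ t • dualEmb j (Y t) := by
      refine integral_congr_ae ?_
      filter_upwards [hae] with t ht
      rw [ht]
    rw [e, setIntegral_timeVol_eq hT.le] at h1
    rw [setIntegral_timeVol_eq hT.le]
    simp only [smul_sub]
    rw [intervalIntegral.integral_sub, h1, sub_self]
    · refine ContinuousOn.intervalIntegrable ?_
      rw [uIcc_of_le hT.le]
      exact hc.continuousOn.smul hYc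
    · refine ContinuousOn.intervalIntegrable ?_
      rw [uIcc_of_le hT.le]
      exact hc.continuousOn.smul hpc

end PathDeriv

end SemilinearParabolic

namespace SemilinearParabolic

/-! ### Weak solutions of linear equations -/

section Norms

variable {E : Type*} [NormedAddCommGroup E]

theorem memLp_two_norm_sq_integrable {α : Type*} [MeasurableSpace α] {μ : Measure α} {f : α → E}
    (hf : MemLp f 2 μ) : Integrable (fun x => ‖f x‖ ^ 2) μ := hf.integrable_norm_pow (by norm_num)

theorem eLpNorm_two_toReal_sq {α : Type*} [MeasurableSpace α] {μ : Measure α} {f : α → E}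
    (hf : MemLp f 2 μ) : (eLpNorm f 2 μ).toReal ^ 2 = ∫ x, ‖f x‖ ^ 2 ∂μ := by
  rw [hf.eLpNorm_eq_integral_rpow_norm (by norm_num) (by norm_num),
    ENNReal.toReal_ofReal (by positivity)]
  have h0 : 0 ≤ ∫ x, ‖f x‖ ^ 2 ∂μ := integral_nonneg fun _ => by positivity
  simp only [ENNReal.toReal_ofNat, Real.rpow_two]
  rw [← Real.rpow_natCast, ← Real.rpow_mul h0]
  norm_num

theorem norm_toLp_two_sq {α : Type*} [MeasurableSpace α] {μ : Measure α} {f : α → E}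
    (hf : MemLp f 2 μ) : ‖hf.toLp f‖ ^ 2 = ∫ x, ‖f x‖ ^ 2 ∂μ := by
  rw [Lp.norm_toLp, eLpNorm_two_toReal_sq hf]

theorem norm_Lp_two_sq {α : Type*} [MeasurableSpace α] {μ : Measure α} (f : Lp E 2 μ) :
    ‖f‖ ^ 2 = ∫ x, ‖f x‖ ^ 2 ∂μ := by
  rw [Lp.norm_def, eLpNorm_two_toReal_sq (Lp.memLp f)]

end Norms

section Lions

variable {V H : Type*} [NormedAddCommGroup V] [InnerProductSpace ℝ V]
  [NormedAddCommGroup H] [InnerProductSpace ℝ H]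

variable (V) in
/-- The `C¹` functions `ℝ → V` which vanish at time `T`. -/
def terminalTest (T : ℝ) : Submodule ℝ (ℝ → V) where
  carrier := {φ | ContDiff ℝ 1 φ ∧ φ T = 0}
  zero_mem' := ⟨contDiff_const, rfl⟩
  add_mem' := fun ha hb => ⟨ha.1.add hb.1, by simp [ha.2, hb.2]⟩
  smul_mem' := fun c _ ha => ⟨contDiff_const.smul ha.1, by simp [ha.2]⟩

theorem terminalTest_memLp {T : ℝ} (φ : terminalTest V T) : MemLp φ.1 2 (timeVol T) :=
  memLp_timeVol_of_continuousOn φ.2.1.continuous.continuousOn 2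

theorem terminalTest_memLp_deriv {T : ℝ} (φ : terminalTest V T) :
    MemLp (deriv φ.1) 2 (timeVol T) :=
  memLp_timeVol_of_continuousOn (φ.2.1.continuous_deriv le_rfl).continuousOn 2

variable (V) in
/-- The class in `L²(0,T;V)` of a test function. -/
noncomputable def terminalTestToLp (T : ℝ) : terminalTest V T →ₗ[ℝ] Lp V 2 (timeVol T) where
  toFun φ := (terminalTest_memLp φ).toLp φ.1
  map_add' φ ψ := MemLp.toLp_add (terminalTest_memLp φ) (terminalTest_memLp ψ)
  map_smul' c φ := MemLp.toLp_const_smul c (terminalTest_memLp φ)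

variable (V) in
/-- The class in `L²(0,T;V)` of the derivative of a test function. -/
noncomputable def terminalTestDeriv (T : ℝ) : terminalTest V T →ₗ[ℝ] Lp V 2 (timeVol T) where
  toFun φ := (terminalTest_memLp_deriv φ).toLp (deriv φ.1)
  map_add' φ ψ := by
    rw [← MemLp.toLp_add]
    refine MemLp.toLp_congr _ _ (Eventually.of_forall fun t => ?_)
    exact deriv_add (φ.2.1.differentiable (by simp) t) (ψ.2.1.differentiable (by simp) t)
  map_smul' c φ := by
    rw [RingHom.id_apply, ← MemLp.toLp_const_smul]
    refine MemLp.toLp_congr _ _ (Eventually.of_forall fun t => ?_)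
    exact deriv_const_smul c (φ.2.1.differentiable (by simp) t)

theorem lpPairing_toLp {α E F G : Type*} [MeasurableSpace α] {μ : Measure α}
    [NormedAddCommGroup E] [NormedSpace ℝ E] [NormedAddCommGroup F]
    [NormedSpace ℝ F] [NormedAddCommGroup G] [NormedSpace ℝ G] [CompleteSpace G]
    (B : E →L[ℝ] F →L[ℝ] G) {f : α → E} {g : α → F} (hf : MemLp f 2 μ) (hg : MemLp g 2 μ) :
    B.lpPairing μ 2 2 (hf.toLp f) (hg.toLp g) = ∫ x, B (f x) (g x) ∂μ := by
  rw [ContinuousLinearMap.lpPairing_eq_integral]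
  refine integral_congr_ae ?_
  filter_upwards [hf.coeFn_toLp, hg.coeFn_toLp] with x h1 h2
  rw [h1, h2]

variable {j : V →L[ℝ] H} {T α : ℝ} {A : V →L[ℝ] StrongDual ℝ V}

/-- Weak solvability of `w' + A w = G`, `w(0) = 0`, for coercive `A`, by Lions' projection lemma.
The initial condition is contained in the weak formulation, since test functions need not vanish at
time `0`. -/
theorem exists_weak_solution [CompleteSpace V] (hT : 0 < T) (hα : 0 < α)
    (hA : ∀ v, α * ‖v‖ ^ 2 ≤ A v v) {G : ℝ → StrongDual ℝ V} (hG : MemLp G 2 (timeVol T)) :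
    ∃ w : ℝ → V, MemLp w 2 (timeVol T) ∧ ∀ φ : terminalTest V T,
      ∫ t in 0..T, inner ℝ (j (w t)) (j (deriv φ.1 t)) = ∫ t in 0..T, (A (w t) - G t) (φ.1 t) := by
  let μ := timeVol T
  let B₁ : V →L[ℝ] StrongDual ℝ V := (dualEmb j).comp j
  let P := A.lpPairing μ 2 2
  let P₁ := B₁.lpPairing μ 2 2
  let P₂ := (ContinuousLinearMap.id ℝ (StrongDual ℝ V)).lpPairing μ 2 2
  -- `M φ` represents the functional `y ↦ ∫ (⟨A y, φ⟩ - ⟨j y, j φ'⟩)` on `L²(0,T;V)`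
  let M : terminalTest V T →ₗ[ℝ] Lp V 2 μ :=
    (toDual ℝ (Lp V 2 μ)).symm.toLinearEquiv.toLinearMap ∘ₗ
      (P.flip.toLinearMap ∘ₗ terminalTestToLp V T - P₁.flip.toLinearMap ∘ₗ terminalTestDeriv V T)
  have hM : ∀ (y : Lp V 2 μ) φ, inner ℝ y (M φ) =
      P y (terminalTestToLp V T φ) - P₁ y (terminalTestDeriv V T φ) := fun y φ => by
    rw [real_inner_comm]
    exact toDual_symm_apply
  let l : terminalTest V T →ₗ[ℝ] ℝ := (P₂ (hG.toLp G)).toLinearMap ∘ₗ terminalTestToLp V T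
  have hcoer : ∀ φ, α * ‖terminalTestToLp V T φ‖ ≤ ‖M φ‖ := by
    intro φ
    have hd : Continuous (deriv φ.1) := φ.2.1.continuous_deriv le_rfl
    have hφ := φ.2.1.continuous
    -- `∫ ⟨j φ, j φ'⟩ = -‖j φ(0)‖² / 2`, because `φ(T) = 0`: the boundary term has the good sign
    have e1 : P₁ (terminalTestToLp V T φ) (terminalTestDeriv V T φ) =
        -(‖j (φ.1 0)‖ ^ 2 / 2) := by
      refine (lpPairing_toLp B₁ (terminalTest_memLp φ) (terminalTest_memLp_deriv φ)).trans ?_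
      rw [setIntegral_timeVol_eq hT.le]
      have hder : ∀ t ∈ uIcc 0 T, HasDerivAt (fun t => ‖j (φ.1 t)‖ ^ 2 / 2)
          (B₁ (φ.1 t) (deriv φ.1 t)) t := fun t _ => by
        have h1 : HasDerivAt (fun t => j (φ.1 t)) (j (deriv φ.1 t)) t :=
          j.hasFDerivAt.comp_hasDerivAt t (φ.2.1.differentiable (by simp) t).hasDerivAt
        have := h1.norm_sq.div_const 2
        simpa [B₁] using this
      rw [intervalIntegral.integral_eq_sub_of_hasDerivAt hder
        ((B₁.continuous.comp hφ).clm_apply hd |>.intervalIntegrable _ _), φ.2.2]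
      simp
    have e2 : α * ‖terminalTestToLp V T φ‖ ^ 2 ≤
        P (terminalTestToLp V T φ) (terminalTestToLp V T φ) := by
      refine le_trans ?_ (lpPairing_toLp A (terminalTest_memLp φ) (terminalTest_memLp φ)).ge
      have : ‖terminalTestToLp V T φ‖ ^ 2 = ∫ t in Ioo 0 T, ‖φ.1 t‖ ^ 2 :=
        norm_toLp_two_sq (terminalTest_memLp φ)
      rw [this, ← integral_const_mul]
      refine integral_mono ((memLp_two_norm_sq_integrable (terminalTest_memLp φ)).const_mul _)
        (memLp_two_bilin_integrable A (terminalTest_memLp φ) (terminalTest_memLp φ))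
        fun t => hA _
    have e3 := real_inner_le_norm (terminalTestToLp V T φ) (M φ)
    rw [hM, e1] at e3
    have e4 : α * ‖terminalTestToLp V T φ‖ * ‖terminalTestToLp V T φ‖ ≤
        ‖M φ‖ * ‖terminalTestToLp V T φ‖ := by nlinarith [sq_nonneg ‖j (φ.1 0)‖]
    rcases (norm_nonneg (terminalTestToLp V T φ)).eq_or_lt with h0 | h0
    · rw [← h0, mul_zero]; exact norm_nonneg _
    · exact le_of_mul_le_mul_right e4 h0
  obtain ⟨y, hy⟩ := exists_inner_eq_of_abs_le M l (‖P₂ (hG.toLp G)‖ / α) fun φ => by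
    have h1 : |l φ| ≤ ‖P₂ (hG.toLp G)‖ * ‖terminalTestToLp V T φ‖ :=
      (P₂ (hG.toLp G)).le_opNorm _
    refine h1.trans ?_
    rw [div_mul_eq_mul_div, le_div_iff₀ hα]
    have := mul_le_mul_of_nonneg_left (hcoer φ) (norm_nonneg (P₂ (hG.toLp G)))
    linarith
  have hym := Lp.memLp y
  refine ⟨y, hym, fun φ => ?_⟩
  have h1 := hy φ
  have f1 : P y (terminalTestToLp V T φ) = ∫ t in 0..T, A (y t) (φ.1 t) := by
    rw [← setIntegral_timeVol_eq hT.le]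
    refine Eq.trans ?_ (lpPairing_toLp A hym (terminalTest_memLp φ))
    rw [Lp.toLp_coeFn]; rfl
  have f2 : P₁ y (terminalTestDeriv V T φ) =
      ∫ t in 0..T, inner ℝ (j (y t)) (j (deriv φ.1 t)) := by
    rw [← setIntegral_timeVol_eq hT.le]
    refine Eq.trans ?_ (lpPairing_toLp B₁ hym (terminalTest_memLp_deriv φ))
    rw [Lp.toLp_coeFn]; rfl
  have f3 : l φ = ∫ t in 0..T, G t (φ.1 t) := by
    rw [← setIntegral_timeVol_eq hT.le]
    exact lpPairing_toLp (ContinuousLinearMap.id ℝ (StrongDual ℝ V)) hG (terminalTest_memLp φ)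
  rw [hM, f1, f2, f3] at h1
  simp only [sub_apply]
  have h00 : (0 : ℝ) ∈ Icc 0 T := ⟨le_rfl, hT.le⟩
  have hTT : T ∈ Icc 0 T := ⟨hT.le, le_rfl⟩
  rw [intervalIntegral.integral_sub, ← h1, sub_sub_cancel]
  · exact integrableOn_intervalIntegrable
      (memLp_two_bilin_integrable A hym (terminalTest_memLp φ)) h00 hTT
  · exact integrableOn_intervalIntegrable
      (memLp_two_bilin_integrable (ContinuousLinearMap.id ℝ (StrongDual ℝ V)) hG
        (terminalTest_memLp φ)) h00 hTT

/-- The weak solution satisfies the integrated equation in `V'`. -/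
theorem exists_integrated_solution [CompleteSpace V] (j : V →L[ℝ] H) (hT : 0 < T) (hα : 0 < α)
    (hA : ∀ v, α * ‖v‖ ^ 2 ≤ A v v) {G : ℝ → StrongDual ℝ V} (hG : MemLp G 2 (timeVol T)) :
    ∃ w : ℝ → V, MemLp w 2 (timeVol T) ∧
      ∀ᵐ t ∂timeVol T, dualEmb j (j (w t)) = ∫ s in 0..t, (G s - A (w s)) := by
  obtain ⟨w, hw, hweak⟩ := exists_weak_solution (j := j) hT hα hA hG
  refine ⟨w, hw, ?_⟩
  have hz : MemLp (fun s => G s - A (w s)) 2 (timeVol T) := hG.sub (A.comp_memLp' hw)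
  have hzi := memLp_timeVol_integrableOn hz
  have hJ : MemLp (fun s => dualEmb j (j (w s))) 2 (timeVol T) :=
    ((dualEmb j).comp j).comp_memLp' hw
  have hpc : ContinuousOn (fun t => ∫ s in 0..t, (G s - A (w s))) (Icc 0 T) := by
    have := intervalIntegral.continuousOn_primitive_interval (a := 0) (b := T)
      (f := fun s => G s - A (w s))
      (μ := volume) (by rwa [uIcc_of_le hT.le, integrableOn_Icc_iff_integrableOn_Ioo])
    rwa [uIcc_of_le hT.le] at this
  have hPm := memLp_timeVol_of_continuousOn hpc 2
  have hD := hJ.sub hPm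
  have hli : LocallyIntegrableOn (fun t => dualEmb j (j (w t)) - ∫ s in 0..t, (G s - A (w s)))
      (Ioo 0 T) volume := (memLp_timeVol_integrableOn hD).locallyIntegrableOn
  have hae := isOpen_Ioo.ae_eq_zero_of_integral_contDiff_smul_eq_zero hli ?_
  · rw [ae_restrict_iff' measurableSet_Ioo]
    filter_upwards [hae] with t ht htT using sub_eq_zero.1 (ht htT)
  intro θ hθ hθc hθs
  -- the test function is `v` times the primitive of `θ` that vanishes at time `T`
  obtain ⟨hψ, hψd⟩ := contDiff_primitive hθ T
  have hψ1 : ContDiff ℝ 1 (fun t => ∫ s in T..t, θ s) := hψ.of_le (by simp)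
  have h0 : ∀ s, s ∉ Ioo 0 T →
      θ s • (dualEmb j (j (w s)) - ∫ r in 0..s, (G r - A (w r))) = 0 := fun s hs => by
    rw [image_eq_zero_of_notMem_tsupport fun h' => hs (hθs h'), zero_smul]
  rw [← setIntegral_eq_integral_of_forall_compl_eq_zero h0]
  simp only [smul_sub]
  rw [integral_sub (timeTest_integrable hθ.continuous hθc hJ)
    (timeTest_integrable hθ.continuous hθc hPm), sub_eq_zero]
  have hparts := integral_deriv_smul_primitive hT.le hψ1 (by simp) hzi
  rw [hψd] at hparts
  rw [setIntegral_timeVol_eq hT.le, setIntegral_timeVol_eq hT.le, hparts]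
  ext v
  let φ : terminalTest V T := ⟨fun t => (∫ s in T..t, θ s) • v, hψ1.smul contDiff_const, by simp⟩
  have hφd : deriv φ.1 = fun t => θ t • v := by
    funext t
    have : HasDerivAt φ.1 (θ t • v) t :=
      ((hθ.continuous.integral_hasStrictDerivAt T t).hasDerivAt).smul_const v
    exact this.deriv
  have h1 := hweak φ
  rw [hφd] at h1
  have h00 : (0 : ℝ) ∈ Icc 0 T := ⟨le_rfl, hT.le⟩
  have hTT : T ∈ Icc 0 T := ⟨hT.le, le_rfl⟩
  let ev : StrongDual ℝ V →L[ℝ] ℝ := ContinuousLinearMap.apply ℝ ℝ v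
  have i1 : IntervalIntegrable (fun s => θ s • dualEmb j (j (w s))) volume 0 T :=
    integrableOn_intervalIntegrable (timeTest_integrable hθ.continuous hθc hJ) h00 hTT
  have i2 : IntervalIntegrable (fun s => (∫ r in T..s, θ r) • (G s - A (w s))) volume 0 T := by
    have := integrableOn_intervalIntegrable hzi h00 hTT
    exact this.continuousOn_smul hψ1.continuous.continuousOn
  rw [neg_apply]
  have hev : ∀ g : StrongDual ℝ V, g v = ev g := fun _ => rfl
  rw [hev, hev, ← ev.intervalIntegral_comp_comm i1, ← ev.intervalIntegral_comp_comm i2,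
    ← intervalIntegral.integral_neg]
  refine Eq.trans ?_ (h1.trans ?_)
  · refine intervalIntegral.integral_congr fun s _ => ?_
    simp [ev, real_inner_smul_right]
  · refine intervalIntegral.integral_congr fun s _ => ?_
    simp [ev, φ]
    ring

end Lions

end SemilinearParabolic

namespace SemilinearParabolic

/-! ### Solutions of linear equations as paths -/

section Limits

variable {V H : Type*} [NormedAddCommGroup V] [NormedSpace ℝ V]
  [NormedAddCommGroup H] [InnerProductSpace ℝ H]
  {j : V →L[ℝ] H} {T : ℝ}

theorem intervalIntegrable_zero_of_mem {E : Type*} [NormedAddCommGroup E] {f : ℝ → E}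
    (hf : IntegrableOn f (Ioo 0 T)) {t : ℝ} (ht : t ∈ Icc 0 T) :
    IntervalIntegrable f volume 0 t :=
  integrableOn_intervalIntegrable hf ⟨le_rfl, ht.1.trans ht.2⟩ ht

theorem intervalIntegral_mono_timeVol {f g : ℝ → ℝ} (hf : IntegrableOn f (Ioo 0 T))
    (hg : IntegrableOn g (Ioo 0 T)) (h : ∀ᵐ t ∂timeVol T, f t ≤ g t) {t : ℝ} (ht : t ∈ Icc 0 T) :
    ∫ s in 0..t, f s ≤ ∫ s in 0..t, g s := by
  rw [intervalIntegral.integral_of_le ht.1, intervalIntegral.integral_of_le ht.1]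
  refine setIntegral_mono_ae_restrict ?_ ?_ ?_
  · exact (intervalIntegrable_iff_integrableOn_Ioc_of_le ht.1).1
      (intervalIntegrable_zero_of_mem hf ht)
  · exact (intervalIntegrable_iff_integrableOn_Ioc_of_le ht.1).1
      (intervalIntegrable_zero_of_mem hg ht)
  · exact (ae_restrict_iff' measurableSet_Ioc).2 (ae_timeVol_imp h ht)

theorem intervalIntegral_le_of_nonneg {f : ℝ → ℝ} (hf : IntegrableOn f (Ioo 0 T))
    (h : ∀ t, 0 ≤ f t) {t : ℝ} (ht : t ∈ Icc 0 T) :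
    ∫ s in 0..t, f s ≤ ∫ s in 0..T, f s := by
  have hT : T ∈ Icc 0 T := ⟨ht.1.trans ht.2, le_rfl⟩
  exact intervalIntegral.integral_mono_interval le_rfl ht.1 ht.2
    (Eventually.of_forall h) (intervalIntegrable_zero_of_mem hf hT)

/-- Energy estimate: the energy inequality combined with a coercive bound on `⟨z, y⟩`. -/
theorem IsPath.energy_le_of_le [CompleteSpace V] {y : ℝ → V} {z : ℝ → StrongDual ℝ V} {Y : ℝ → H}
    (h : IsPath j T y z Y) {α : ℝ} {p : ℝ → ℝ} (hp : IntegrableOn p (Ioo 0 T))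
    (hz : ∀ᵐ t ∂timeVol T, z t (y t) ≤ p t - α * ‖y t‖ ^ 2) {t : ℝ} (ht : t ∈ Icc 0 T) :
    ‖Y t‖ ^ 2 + 2 * α * ∫ s in 0..t, ‖y s‖ ^ 2 ≤ ‖Y 0‖ ^ 2 + 2 * ∫ s in 0..t, p s := by
  have h1 := h.energy_le ht
  have hy2 : IntegrableOn (fun t => α * ‖y t‖ ^ 2) (Ioo 0 T) :=
    (memLp_two_norm_sq_integrable h.memLp).const_mul α
  have h2 := intervalIntegral_mono_timeVol
    (memLp_two_bilin_integrable (ContinuousLinearMap.id ℝ (StrongDual ℝ V)) h.memLp_deriv h.memLp)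
    (hp.sub hy2) hz ht
  simp only [ContinuousLinearMap.id_apply, Pi.sub_apply] at h2
  rw [intervalIntegral.integral_sub (intervalIntegrable_zero_of_mem hp ht)
    (intervalIntegrable_zero_of_mem hy2 ht), intervalIntegral.integral_const_mul] at h2
  linarith

theorem tendsto_intervalIntegral_apply {ι : Type*} {l : Filter ι} {z : ι → ℝ → StrongDual ℝ V}
    {z₀ : ℝ → StrongDual ℝ V} (hz : ∀ i, MemLp (z i) 2 (timeVol T))
    (hz₀ : MemLp z₀ 2 (timeVol T))
    (h : Tendsto (fun i => eLpNorm (z i - z₀) 2 (timeVol T)) l (𝓝 0)) {t : ℝ} (ht : t ∈ Icc 0 T)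
    (v : V) : Tendsto (fun i => ∫ s in 0..t, z i s v) l (𝓝 (∫ s in 0..t, z₀ s v)) := by
  have hle : timeVol t ≤ timeVol T := Measure.restrict_mono (Ioo_subset_Ioo_right ht.2) le_rfl
  have h1 := tendsto_integral_bilin (ContinuousLinearMap.id ℝ (StrongDual ℝ V))
    (fun i => (hz i).mono_measure hle) (hz₀.mono_measure hle)
    (memLp_timeVol_of_continuousOn (T := t) (f := fun _ => v) continuousOn_const 2)
    (tendsto_of_tendsto_of_tendsto_of_le_of_le tendsto_const_nhds h (fun _ => zero_le)
      fun i => eLpNorm_mono_measure _ hle)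
  simpa only [ContinuousLinearMap.id_apply, setIntegral_timeVol_eq ht.1] using h1

/-- Limits of paths: `y` strongly, the continuous representatives pointwise, and the derivatives
weakly. -/
theorem IsPath.of_tendsto {y : ℕ → ℝ → V} {z : ℕ → ℝ → StrongDual ℝ V} {Y : ℕ → ℝ → H}
    (h : ∀ k, IsPath j T (y k) (z k) (Y k)) {y₀ : ℝ → V} {z₀ : ℝ → StrongDual ℝ V} {Y₀ : ℝ → H}
    (hy₀ : MemLp y₀ 2 (timeVol T)) (hz₀ : MemLp z₀ 2 (timeVol T))
    (hY₀ : ContinuousOn Y₀ (Icc 0 T))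
    (hae : ∀ᵐ t ∂timeVol T, Y₀ t = j (y₀ t))
    (hY : ∀ t ∈ Icc 0 T, Tendsto (fun k => Y k t) atTop (𝓝 (Y₀ t)))
    (hz : ∀ t ∈ Icc 0 T, ∀ v, Tendsto (fun k => ∫ s in 0..t, z k s v) atTop
      (𝓝 (∫ s in 0..t, z₀ s v))) : IsPath j T y₀ z₀ Y₀ := by
  refine ⟨hy₀, hz₀, hY₀, hae, fun t ht => ?_⟩
  have h0 : (0 : ℝ) ∈ Icc 0 T := ⟨le_rfl, ht.1.trans ht.2⟩
  ext v
  have happ : ∀ {ζ : ℝ → StrongDual ℝ V}, MemLp ζ 2 (timeVol T) →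
      (∫ s in 0..t, ζ s) v = ∫ s in 0..t, ζ s v := fun hζ =>
    ((ContinuousLinearMap.apply ℝ ℝ v).intervalIntegral_comp_comm
      (intervalIntegrable_zero_of_mem (memLp_timeVol_integrableOn hζ) ht)).symm
  have hE : ∀ t ∈ Icc 0 T, Tendsto (fun k => dualEmb j (Y k t) v) atTop
      (𝓝 (dualEmb j (Y₀ t) v)) := fun t ht =>
    Tendsto.inner (hY t ht) tendsto_const_nhds
  rw [add_apply, happ hz₀]
  refine tendsto_nhds_unique (hE t ht) (((hE 0 h0).add (hz t ht v)).congr fun k => ?_)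
  rw [(h k).primitive t ht, add_apply, happ (h k).memLp_deriv]

/-- A sequence of paths that is Cauchy in `L²(0,T;V) ∩ C([0,T];H)` converges there. -/
theorem exists_limit_of_cauchy [CompleteSpace V] [CompleteSpace H] (hT : 0 ≤ T)
    {y : ℕ → ℝ → V} {z : ℕ → ℝ → StrongDual ℝ V}
    {Y : ℕ → ℝ → H} (h : ∀ k, IsPath j T (y k) (z k) (Y k)) {d : ℕ → ℝ}
    (hd : Tendsto d atTop (𝓝 0))
    (hY : ∀ k m, ∀ t ∈ Icc 0 T, ‖Y k t - Y m t‖ ^ 2 ≤ d k + d m)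
    (hy : ∀ k m, ∫ t in 0..T, ‖y k t - y m t‖ ^ 2 ≤ d k + d m) :
    ∃ (y₀ : ℝ → V) (Y₀ : ℝ → H), MemLp y₀ 2 (timeVol T) ∧
      Tendsto (fun k => eLpNorm (y k - y₀) 2 (timeVol T)) atTop (𝓝 0) ∧
      ContinuousOn Y₀ (Icc 0 T) ∧ TendstoUniformlyOn Y Y₀ atTop (Icc 0 T) ∧
      ∀ᵐ t ∂timeVol T, Y₀ t = j (y₀ t) := by
  have hev : ∀ ε > 0, ∃ N, ∀ k ≥ N, ∀ m ≥ N, d k + d m < ε ^ 2 := fun ε hε => by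
    obtain ⟨N, hN⟩ := eventually_atTop.1 (hd.eventually (gt_mem_nhds
      (show (0 : ℝ) < ε ^ 2 / 2 by positivity)))
    exact ⟨N, fun k hk m hm => by linarith [hN k hk, hN m hm]⟩
  have hcs : CauchySeq fun k => (h k).memLp.toLp (y k) := by
    rw [Metric.cauchySeq_iff]
    intro ε hε
    obtain ⟨N, hN⟩ := hev ε hε
    refine ⟨N, fun k hk m hm => ?_⟩
    rw [dist_eq_norm, ← MemLp.toLp_sub]
    refine lt_of_pow_lt_pow_left₀ 2 hε.le ?_
    rw [norm_toLp_two_sq, setIntegral_timeVol_eq hT]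
    exact (hy k m).trans_lt (hN k hk m hm)
  obtain ⟨yL, hyL⟩ := cauchySeq_tendsto_of_complete hcs
  have hlim : Tendsto (fun k => eLpNorm (y k - ⇑yL) 2 (timeVol T)) atTop (𝓝 0) := by
    rw [← Lp.tendsto_Lp_iff_tendsto_eLpNorm'' y (fun k => (h k).memLp) yL (Lp.memLp yL),
      Lp.toLp_coeFn]
    exact hyL
  have hUC : UniformCauchySeqOn Y atTop (Icc 0 T) := by
    rw [Metric.uniformCauchySeqOn_iff]
    intro ε hε
    obtain ⟨N, hN⟩ := hev ε hε
    refine ⟨N, fun k hk m hm t ht => ?_⟩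
    rw [dist_eq_norm]
    exact lt_of_pow_lt_pow_left₀ 2 hε.le ((hY k m t ht).trans_lt (hN k hk m hm))
  have hpt : ∀ t, ∃ x, t ∈ Icc 0 T → Tendsto (fun k => Y k t) atTop (𝓝 x) := fun t => by
    by_cases ht : t ∈ Icc 0 T
    · obtain ⟨x, hx⟩ := cauchySeq_tendsto_of_complete (hUC.cauchySeq ht)
      exact ⟨x, fun _ => hx⟩
    · exact ⟨0, fun h' => absurd h' ht⟩
  choose Y₀ hY₀ using hpt
  have hTU : TendstoUniformlyOn Y Y₀ atTop (Icc 0 T) :=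
    hUC.tendstoUniformlyOn_of_tendsto fun t ht => hY₀ t ht
  refine ⟨yL, Y₀, Lp.memLp yL, hlim, hTU.continuousOn
    (Eventually.of_forall fun k => (h k).continuousOn).frequently, hTU, ?_⟩
  have hm := tendstoInMeasure_of_tendsto_eLpNorm (by norm_num) (fun k => (h k).memLp.1)
    (Lp.aestronglyMeasurable yL) hlim
  obtain ⟨ns, hns, hae⟩ := hm.exists_seq_tendsto_ae
  have hall : ∀ᵐ t ∂timeVol T, ∀ k, Y k t = j (y k t) := ae_all_iff.2 fun k => (h k).ae_eq
  filter_upwards [hae, hall, ae_restrict_mem measurableSet_Ioo] with t h1 h2 h3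
  refine tendsto_nhds_unique ((hY₀ t (Ioo_subset_Icc_self h3)).comp hns.tendsto_atTop) ?_
  refine ((j.continuous.tendsto _).comp h1).congr fun i => ?_
  simp only [Function.comp_apply]
  exact (h2 (ns i)).symm

end Limits

section Linear

variable {V H : Type*} [NormedAddCommGroup V] [InnerProductSpace ℝ V] [CompleteSpace V]
  [NormedAddCommGroup H] [InnerProductSpace ℝ H]
  {j : V →L[ℝ] H} {T α : ℝ} {A : V →L[ℝ] StrongDual ℝ V}

/-- The backward average of a function that vanishes for negative times is the primitive of its
difference quotient. -/
theorem backAvg_eq_integral {E : Type*} [NormedAddCommGroup E] [NormedSpace ℝ E] {ζ : ℝ → E}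
    (hζ : LocallyIntegrable ζ volume)
    (h0 : ∀ t ≤ 0, ζ t = 0) {k : ℝ} (hk : 0 < k) (s : ℝ) :
    ∫ r in 0..s, k⁻¹ • (ζ r - ζ (r - k)) = backAvg k ζ s := by
  have hi := locallyIntegrable_intervalIntegrable hζ
  have hs : IntervalIntegrable (fun r => ζ (r - k)) volume 0 s := by
    simpa using (hi (0 - k) (s - k)).comp_sub_right k
  have hz : ∫ r in (0 - k)..0, ζ r = 0 := by
    refine intervalIntegral.integral_zero_ae (Eventually.of_forall fun r hr => h0 r ?_)
    rw [uIoc_of_le (by linarith)] at hr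
    exact hr.2
  rw [intervalIntegral.integral_smul, intervalIntegral.integral_sub (hi _ _) hs,
    intervalIntegral.integral_comp_sub_right ζ k, backAvg]
  congr 1
  have e1 := intervalIntegral.integral_add_adjacent_intervals (hi 0 (s - k)) (hi (s - k) s)
  have e2 := intervalIntegral.integral_add_adjacent_intervals (hi (0 - k) 0) (hi 0 (s - k))
  rw [hz, zero_add] at e2
  rw [← e1, e2]
  abel

/-- For a right-hand side that is the primitive of an `L²(0,T;V')` function, the solution is the
primitive of an `L²(0,T;V)` function. -/
theorem exists_path_of_backAvg (hT : 0 < T) (hα : 0 < α) (hA : ∀ v, α * ‖v‖ ^ 2 ≤ A v v)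
    {ζ : ℝ → StrongDual ℝ V} (hζ : MemLp ζ 2 volume) (h0 : ∀ t ≤ 0, ζ t = 0) {k : ℝ}
    (hk : 0 < k) :
    ∃ (y : ℝ → V) (Y : ℝ → H), IsPath j T y (fun t => backAvg k ζ t - A (y t)) Y ∧ Y 0 = 0 := by
  have hζl := memLp_two_locallyIntegrable hζ
  have hG : MemLp (fun r => k⁻¹ • (ζ r - ζ (r - k))) 2 (timeVol T) := by
    have h1 : MemLp (fun r => ζ (r - k)) 2 volume :=
      hζ.comp_measurePreserving (measurePreserving_sub_right volume k)
    exact ((hζ.sub h1).const_smul (k⁻¹ : ℝ)).restrict _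
  -- `w` solves the equation with the differentiated right-hand side, and `y = ∫ w`
  obtain ⟨w, hw, hae⟩ := exists_integrated_solution j hT hα hA hG
  have hwi := memLp_timeVol_integrableOn hw
  let y : ℝ → V := fun t => ∫ s in 0..t, w s
  have hyc : ContinuousOn y (Icc 0 T) := by
    have := intervalIntegral.continuousOn_primitive_interval (a := 0) (b := T) (f := w)
      (μ := volume) (by rwa [uIcc_of_le hT.le, integrableOn_Icc_iff_integrableOn_Ioo])
    rwa [uIcc_of_le hT.le] at this
  have hzc : ContinuousOn (fun t => backAvg k ζ t - A (y t)) (Icc 0 T) :=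
    (continuous_backAvg hζl k).continuousOn.sub (A.continuous.comp_continuousOn hyc)
  refine ⟨y, fun t => j (y t), ⟨memLp_timeVol_of_continuousOn hyc 2,
    memLp_timeVol_of_continuousOn hzc 2, j.continuous.comp_continuousOn hyc,
    Eventually.of_forall fun _ => rfl, fun t ht => ?_⟩, by simp [y]⟩
  have hy0 : y 0 = 0 := by simp [y]
  rw [hy0, map_zero, map_zero, zero_add]
  have e1 : dualEmb j (j (y t)) = ∫ s in 0..t, dualEmb j (j (w s)) :=
    (((dualEmb j).comp j).intervalIntegral_comp_comm
      (intervalIntegrable_zero_of_mem hwi ht)).symm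
  rw [e1]
  refine intervalIntegral.integral_congr_ae ?_
  rw [uIoc_of_le ht.1]
  refine ae_timeVol_imp ?_ ht
  filter_upwards [hae, ae_restrict_mem measurableSet_Ioo] with s hs hsT
  have hsI := Ioo_subset_Icc_self hsT
  rw [hs, intervalIntegral.integral_sub
    (intervalIntegrable_zero_of_mem (memLp_timeVol_integrableOn hG) hsI)
    (intervalIntegrable_zero_of_mem (f := fun s => A (w s))
      (memLp_timeVol_integrableOn (A.comp_memLp' hw)) hsI),
    backAvg_eq_integral hζl h0 hk]
  congr 1
  exact A.intervalIntegral_comp_comm (intervalIntegrable_zero_of_mem hwi hsI)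

/-- The linear problem `y' + A y = G`, `y(0) = 0`, with coercive `A` and `G ∈ L²(0,T;V')`, has a
solution with a continuous representative in `H`. -/
theorem exists_path_linear [CompleteSpace H] (j : V →L[ℝ] H) (hT : 0 < T) (hα : 0 < α)
    (hA : ∀ v, α * ‖v‖ ^ 2 ≤ A v v) {G : ℝ → StrongDual ℝ V} (hG : MemLp G 2 (timeVol T)) :
    ∃ (y : ℝ → V) (Y : ℝ → H), IsPath j T y (fun t => G t - A (y t)) Y ∧ Y 0 = 0 := by
  obtain ⟨ζ, hζd⟩ : ∃ ζ : ℝ → StrongDual ℝ V, ζ = (Ioo 0 T).indicator G := ⟨_, rfl⟩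
  have hζ : MemLp ζ 2 volume := by rw [hζd]; exact memLp_indicator_timeVol hG
  have hζl := memLp_two_locallyIntegrable hζ
  have hζ0 : ∀ t ≤ 0, ζ t = 0 := fun t ht => by
    rw [hζd]; exact indicator_of_notMem (fun h' => absurd h'.1 (not_lt.2 ht)) _
  have hζG : ζ =ᵐ[timeVol T] G := by
    filter_upwards [ae_restrict_mem measurableSet_Ioo] with t ht
    rw [hζd, indicator_of_mem ht]
  -- the right-hand side is approximated by its averages over intervals of length `κ k → 0`; the
  -- corresponding solutions form a Cauchy sequence by the energy estimate
  let κ : ℕ → ℝ := fun k => 1 / ((k : ℝ) + 1)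
  have hκ : ∀ k, 0 < κ k := fun k => by positivity
  have hκ0 : Tendsto κ atTop (𝓝[>] 0) :=
    tendsto_nhdsWithin_iff.2 ⟨tendsto_one_div_add_atTop_nhds_zero_nat, Eventually.of_forall hκ⟩
  choose y Y hpath hY0 using fun k => exists_path_of_backAvg (j := j) hT hα hA hζ hζ0 (hκ k)
  let g : ℕ → ℝ → StrongDual ℝ V := fun k => backAvg (κ k) ζ
  have hg : ∀ k, MemLp (g k) 2 (timeVol T) := fun k =>
    memLp_timeVol_of_continuousOn (continuous_backAvg hζl (κ k)).continuousOn 2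
  have hge : Tendsto (fun k => eLpNorm (g k - G) 2 (timeVol T)) atTop (𝓝 0) := by
    have h1 := (eLpNorm_backAvg_sub_tendsto hζ).comp hκ0
    refine tendsto_of_tendsto_of_tendsto_of_le_of_le tendsto_const_nhds h1
      (fun _ => zero_le) fun k => ?_
    have e : eLpNorm (g k - G) 2 (timeVol T) = eLpNorm (g k - ζ) 2 (timeVol T) :=
      eLpNorm_congr_ae ((EventuallyEq.refl _ _).sub hζG.symm)
    exact e.le.trans (eLpNorm_mono_measure _ Measure.restrict_le_self)
  let d : ℕ → ℝ := fun k => (1 + 1 / α) * (2 / α * ∫ t in 0..T, ‖g k t - G t‖ ^ 2)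
  have hd : Tendsto d atTop (𝓝 0) := by
    have h1 : Tendsto (fun k => (eLpNorm (g k - G) 2 (timeVol T)).toReal ^ 2) atTop (𝓝 0) := by
      simpa using ((ENNReal.continuousAt_toReal ENNReal.zero_ne_top).tendsto.comp hge).pow 2
    have h2 : Tendsto (fun k => ∫ t in 0..T, ‖g k t - G t‖ ^ 2) atTop (𝓝 0) := by
      refine h1.congr fun k => ?_
      rw [eLpNorm_two_toReal_sq ((hg k).sub hG), setIntegral_timeVol_eq hT.le]
      rfl
    have h3 := (h2.const_mul (2 / α)).const_mul (1 + 1 / α)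
    rwa [mul_zero, mul_zero] at h3
  have henergy : ∀ k m, ∀ t ∈ Icc 0 T,
      ‖Y k t - Y m t‖ ^ 2 + α * ∫ s in 0..t, ‖y k s - y m s‖ ^ 2 ≤
        (2 / α * ∫ t in 0..T, ‖g k t - G t‖ ^ 2) + 2 / α * ∫ t in 0..T, ‖g m t - G t‖ ^ 2 := by
    intro k m t ht
    have ik : ∀ k, IntegrableOn (fun s => ‖g k s - G s‖ ^ 2) (Ioo 0 T) := fun k =>
      memLp_two_norm_sq_integrable ((hg k).sub hG)
    have hp : IntegrableOn (fun s => 1 / α * ‖g k s - G s‖ ^ 2 + 1 / α * ‖g m s - G s‖ ^ 2)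
        (Ioo 0 T) := ((ik k).const_mul _).add ((ik m).const_mul _)
    have h1 := ((hpath k).sub (hpath m)).energy_le_of_le (α := α / 2) hp ?_ ht
    · simp only [Pi.sub_apply, hY0, sub_zero, norm_zero] at h1
      have h2 := intervalIntegral_le_of_nonneg hp (fun s => by positivity) ht
      have hTT : T ∈ Icc 0 T := ⟨hT.le, le_rfl⟩
      rw [intervalIntegral.integral_add
        (intervalIntegrable_zero_of_mem ((ik k).const_mul _) hTT)
        (intervalIntegrable_zero_of_mem ((ik m).const_mul _) hTT),
        intervalIntegral.integral_const_mul, intervalIntegral.integral_const_mul] at h2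
      have e3 : ∀ x : ℝ, 2 / α * x = 2 * (1 / α * x) := fun x => by ring
      rw [e3, e3]
      linarith
    · refine Eventually.of_forall fun s => ?_
      set v := y k s - y m s with hv
      have e1 : ((fun t => backAvg (κ k) ζ t - A (y k t)) - fun t => backAvg (κ m) ζ t - A (y m t)) s
          ((y k - y m) s) = (g k s - G s) v - (g m s - G s) v - A v v := by
        simp only [Pi.sub_apply, sub_apply, ← hv, g]
        rw [hv, map_sub A]
        simp only [sub_apply]
        ring
      rw [e1]
      have b1 : ∀ k, |(g k s - G s) v| ≤ 1 / α * ‖g k s - G s‖ ^ 2 + α / 4 * ‖v‖ ^ 2 := fun k => by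
        refine ((g k s - G s).le_opNorm v).trans ?_
        -- Young's inequality, with the square completed
        have : 1 / α * ‖g k s - G s‖ ^ 2 + α / 4 * ‖v‖ ^ 2 - ‖g k s - G s‖ * ‖v‖ =
            1 / α * (‖g k s - G s‖ - α / 2 * ‖v‖) ^ 2 := by
          field_simp
          ring
        have h3 : 0 ≤ 1 / α * (‖g k s - G s‖ - α / 2 * ‖v‖) ^ 2 := by positivity
        linarith
      have b2 := (le_abs_self _).trans (b1 k)
      have b3 := (neg_le_abs _).trans (b1 m)
      have b4 := hA v
      simp only [Pi.sub_apply, ← hv]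
      linarith
  have hint0 : ∀ k, 0 ≤ 2 / α * ∫ t in 0..T, ‖g k t - G t‖ ^ 2 := fun k =>
    mul_nonneg (by positivity) (intervalIntegral.integral_nonneg hT.le fun _ _ => by positivity)
  obtain ⟨y₀, Y₀, hy₀, hyt, hYc, hYt, hYae⟩ := exists_limit_of_cauchy hT.le hpath hd
    (fun k m t ht => by
      have h1 := henergy k m t ht
      have h2 : 0 ≤ α * ∫ s in 0..t, ‖y k s - y m s‖ ^ 2 :=
        mul_nonneg hα.le (intervalIntegral.integral_nonneg ht.1 fun _ _ => by positivity)
      have h3 : 0 ≤ 1 / α := by positivity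
      simp only [d]
      nlinarith [mul_nonneg h3 (hint0 k), mul_nonneg h3 (hint0 m)])
    (fun k m => by
      have h1 := henergy k m T ⟨hT.le, le_rfl⟩
      have h2 := sq_nonneg ‖Y k T - Y m T‖
      have h3 : ∫ s in 0..T, ‖y k s - y m s‖ ^ 2 ≤ 1 / α *
          ((2 / α * ∫ t in 0..T, ‖g k t - G t‖ ^ 2) + 2 / α * ∫ t in 0..T, ‖g m t - G t‖ ^ 2) := by
        rw [one_div, inv_mul_eq_div, le_div_iff₀' hα]
        linarith
      simp only [d]
      linarith [hint0 k, hint0 m])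
  have hYpt : ∀ t ∈ Icc 0 T, Tendsto (fun k => Y k t) atTop (𝓝 (Y₀ t)) := fun t ht =>
    hYt.tendsto_at ht
  refine ⟨y₀, Y₀, IsPath.of_tendsto hpath hy₀ (hG.sub (A.comp_memLp' hy₀)) hYc hYae hYpt ?_, ?_⟩
  · have hA2 : Tendsto (fun k => eLpNorm ((fun t => A (y k t)) - fun t => A (y₀ t)) 2 (timeVol T))
        atTop (𝓝 0) := by
      have h1 : Tendsto (fun k => ENNReal.ofReal ‖A‖ * eLpNorm (y k - y₀) 2 (timeVol T)) atTop
          (𝓝 0) := by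
        simpa using ENNReal.Tendsto.const_mul hyt (Or.inr ENNReal.ofReal_ne_top)
      refine tendsto_of_tendsto_of_tendsto_of_le_of_le tendsto_const_nhds h1 (fun _ => zero_le)
        fun k => ?_
      refine eLpNorm_le_mul_eLpNorm_of_ae_le_mul (Eventually.of_forall fun t => ?_) 2
      simp only [Pi.sub_apply, ← map_sub]
      exact A.le_opNorm _
    have hzlim : Tendsto (fun k => eLpNorm ((fun t => backAvg (κ k) ζ t - A (y k t)) -
        fun t => G t - A (y₀ t)) 2 (timeVol T)) atTop (𝓝 0) := by
      have h1 := hge.add hA2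
      rw [add_zero] at h1
      refine tendsto_of_tendsto_of_tendsto_of_le_of_le tendsto_const_nhds h1 (fun _ => zero_le)
        fun k => ?_
      have e : ((fun t => backAvg (κ k) ζ t - A (y k t)) - fun t => G t - A (y₀ t)) =
          (g k - G) - ((fun t => A (y k t)) - fun t => A (y₀ t)) := by
        funext t
        simp only [Pi.sub_apply, g]
        abel
      rw [e]
      exact eLpNorm_sub_le ((hg k).sub hG).1
        ((A.comp_memLp' (hpath k).memLp).sub (A.comp_memLp' hy₀)).1 (by norm_num)
    exact fun t ht v => tendsto_intervalIntegral_apply (fun k => (hpath k).memLp_deriv)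
      (hG.sub (A.comp_memLp' hy₀)) hzlim ht v
  · refine tendsto_nhds_unique (hYpt 0 ⟨le_rfl, hT.le⟩) ?_
    simp only [hY0]
    exact tendsto_const_nhds

end Linear

end SemilinearParabolic

namespace SemilinearParabolic

/-! ### Equations with a Lipschitz nonlinearity -/

section Lipschitz

/-- A Volterra-type Lipschitz estimate on `C([0,T];H)` yields a fixed point, since some iterate of
the map is a contraction. -/
theorem exists_fixedPoint_of_volterra {H : Type*} [NormedAddCommGroup H] [CompleteSpace H]
    {T : ℝ} (hT : 0 ≤ T) {κ : ℝ} (hκ : 0 ≤ κ)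
    (N : C(Icc 0 T, H) → C(Icc 0 T, H))
    (hN : ∀ h₁ h₂ : C(Icc 0 T, H), ∀ t : Icc 0 T, ‖N h₁ t - N h₂ t‖ ^ 2 ≤
      κ * ∫ s in 0..t, ‖h₁ (projIcc 0 T hT s) - h₂ (projIcc 0 T hT s)‖ ^ 2) :
    ∃ h, N h = h := by
  have hiter : ∀ (m : ℕ) (h₁ h₂ : C(Icc 0 T, H)) (t : Icc 0 T),
      ‖N^[m] h₁ t - N^[m] h₂ t‖ ^ 2 ≤ (κ * t) ^ m / m.factorial * ‖h₁ - h₂‖ ^ 2 := by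
    intro m
    induction m with
    | zero =>
      intro h₁ h₂ t
      have h1 := (h₁ - h₂).norm_coe_le_norm t
      simp only [Function.iterate_zero, id, pow_zero, Nat.factorial_zero, Nat.cast_one, div_one,
        one_mul]
      rw [ContinuousMap.sub_apply] at h1
      gcongr
    | succ m ih =>
      intro h₁ h₂ t
      rw [Function.iterate_succ_apply', Function.iterate_succ_apply']
      refine (hN _ _ t).trans ?_
      have h1 : ∫ s in 0..(t : ℝ), ‖N^[m] h₁ (projIcc 0 T hT s) - N^[m] h₂ (projIcc 0 T hT s)‖ ^ 2 ≤
          ∫ s in 0..(t : ℝ), (κ * s) ^ m / m.factorial * ‖h₁ - h₂‖ ^ 2 := by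
        refine intervalIntegral.integral_mono_on t.2.1 ?_ ?_ fun s hs => ?_
        · exact Continuous.intervalIntegrable (by fun_prop) _ _
        · exact Continuous.intervalIntegrable (by fun_prop) _ _
        · have hsI : s ∈ Icc 0 T := ⟨hs.1, hs.2.trans t.2.2⟩
          have := ih h₁ h₂ (projIcc 0 T hT s)
          rwa [projIcc_of_mem hT hsI] at this ⊢
      refine (mul_le_mul_of_nonneg_left h1 hκ).trans_eq ?_
      have e : ∀ s : ℝ, (κ * s) ^ m / m.factorial * ‖h₁ - h₂‖ ^ 2 =
          κ ^ m / m.factorial * ‖h₁ - h₂‖ ^ 2 * s ^ m := fun s => by rw [mul_pow]; ring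
      simp only [e]
      rw [intervalIntegral.integral_const_mul, integral_pow, Nat.factorial_succ]
      push_cast
      field_simp
      ring
  have hlim : Tendsto (fun m : ℕ => (κ * T) ^ m / m.factorial) atTop (𝓝 0) :=
    FloorSemiring.tendsto_pow_div_factorial_atTop (κ * T)
  obtain ⟨m, hm⟩ := (hlim.eventually (gt_mem_nhds (show (0 : ℝ) < 1 / 4 by norm_num))).exists
  have hc : ContractingWith (1 / 2) (N^[m]) := by
    refine ⟨by
      rw [← NNReal.coe_lt_coe]; norm_num, LipschitzWith.of_dist_le_mul fun h₁ h₂ => ?_⟩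
    rw [ContinuousMap.dist_le (by positivity)]
    intro t
    rw [dist_eq_norm, dist_eq_norm]
    refine le_of_sq_le_sq ?_ (by positivity)
    refine (hiter m h₁ h₂ t).trans ?_
    have h2 : (κ * t) ^ m / m.factorial ≤ (κ * T) ^ m / m.factorial := by
      have := t.2.1
      have := t.2.2
      gcongr
    have h3 := mul_le_mul_of_nonneg_right (h2.trans hm.le) (sq_nonneg ‖h₁ - h₂‖)
    refine h3.trans_eq ?_
    push_cast
    ring
  exact ⟨_, hc.isFixedPt_fixedPoint_iterate⟩

theorem IsPath.const_add {V H : Type*} [NormedAddCommGroup V] [NormedSpace ℝ V]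
    [NormedAddCommGroup H] [InnerProductSpace ℝ H] {T : ℝ} {j : V →L[ℝ] H} {y : ℝ → V}
    {z : ℝ → StrongDual ℝ V} {Y : ℝ → H}
    (h : IsPath j T y z Y) (v : V) : IsPath j T (fun t => v + y t) z (fun t => j v + Y t) where
  memLp := (memLp_timeVol_of_continuousOn (f := fun _ => v) continuousOn_const 2).add h.memLp
  memLp_deriv := h.memLp_deriv
  continuousOn := continuousOn_const.add h.continuousOn
  ae_eq := by
    filter_upwards [h.ae_eq] with t ht
    rw [ht, map_add]
  primitive t ht := by
    rw [map_add, map_add, h.primitive t ht, add_assoc]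

variable {V H : Type*} [NormedAddCommGroup V] [InnerProductSpace ℝ V] [CompleteSpace V]
  [NormedAddCommGroup H] [InnerProductSpace ℝ H] [CompleteSpace H]
  {T α : ℝ} {A : V →L[ℝ] StrongDual ℝ V}

/-- The problem `y' + A y + B(y) = u`, `y(0) = v₀ ∈ V`, with a Lipschitz map `B` on `H`. -/
theorem exists_path_lipschitz (j : V →L[ℝ] H) (hT : 0 < T) (hα : 0 < α)
    (hA : ∀ v, α * ‖v‖ ^ 2 ≤ A v v) {B : H → H} {K : NNReal} (hB : LipschitzWith K B)
    {u : ℝ → H} (hu : MemLp u 2 (timeVol T)) (v₀ : V) :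
    ∃ (y : ℝ → V) (Y : ℝ → H),
      IsPath j T y (fun t => dualEmb j (u t) - A (y t) - dualEmb j (B (Y t))) Y ∧
        Y 0 = j v₀ := by
  -- `v₀ + y` is the solution with the nonlinear term frozen at `h`; adding the constant `v₀` is
  -- possible since the initial value lies in `V`
  have hsol : ∀ h : C(Icc 0 T, H), ∃ (y : ℝ → V) (Y : ℝ → H), IsPath j T y
      (fun t => dualEmb j (u t) - dualEmb j (B (h (projIcc 0 T hT.le t))) - A v₀ - A (y t)) Y ∧
      Y 0 = 0 := fun h => by
    refine exists_path_linear j hT hα hA (G := fun t =>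
      dualEmb j (u t) - dualEmb j (B (h (projIcc 0 T hT.le t))) - A v₀) ?_
    have h1 : Continuous fun t => dualEmb j (B (h (projIcc 0 T hT.le t))) :=
      (dualEmb j).continuous.comp (hB.continuous.comp (h.continuous.comp continuous_projIcc))
    exact (((dualEmb j).comp_memLp' hu).sub
      (memLp_timeVol_of_continuousOn h1.continuousOn 2)).sub
      (memLp_timeVol_of_continuousOn continuousOn_const 2)
  choose y Y hpath hY0 using hsol
  let N : C(Icc 0 T, H) → C(Icc 0 T, H) := fun h =>
    ⟨fun t => j v₀ + Y h t, by
      have := (hpath h).continuousOn.domRestrict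
      exact continuous_const.add this⟩
  have hκ : 0 ≤ (K * ‖j‖) ^ 2 / (2 * α) := by positivity
  -- the energy estimate for the difference of two such solutions
  obtain ⟨h, hh⟩ := exists_fixedPoint_of_volterra hT.le hκ N fun h₁ h₂ t => by
    have hc : Continuous fun s =>
        ‖h₁ (projIcc 0 T hT.le s) - h₂ (projIcc 0 T hT.le s)‖ ^ 2 := by fun_prop
    have h1 := ((hpath h₁).sub (hpath h₂)).energy_le_of_le (α := 0)
      (p := fun s => (K * ‖j‖) ^ 2 / (2 * α) / 2 *
        ‖h₁ (projIcc 0 T hT.le s) - h₂ (projIcc 0 T hT.le s)‖ ^ 2)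
      ((hc.const_smul ((K * ‖j‖) ^ 2 / (2 * α) / 2)).integrableOn_Icc.mono_set Ioo_subset_Icc_self)
      (Eventually.of_forall fun s => ?_) t.2
    · simp only [Pi.sub_apply, hY0, sub_zero, norm_zero, mul_zero, zero_mul, add_zero] at h1
      rw [intervalIntegral.integral_const_mul] at h1
      have e : N h₁ t - N h₂ t = Y h₁ t - Y h₂ t := by simp [N]
      rw [e]
      refine h1.trans_eq ?_
      ring
    · set v := y h₁ s - y h₂ s with hv
      set b := B (h₁ (projIcc 0 T hT.le s)) - B (h₂ (projIcc 0 T hT.le s)) with hb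
      have e1 : (dualEmb j (u s) - dualEmb j (B (h₁ (projIcc 0 T hT.le s))) - A v₀ - A (y h₁ s) -
          (dualEmb j (u s) - dualEmb j (B (h₂ (projIcc 0 T hT.le s))) - A v₀ - A (y h₂ s))) v =
          -(inner ℝ b (j v)) - A v v := by
        rw [hb, inner_sub_left]
        have : A v v = A (y h₁ s) v - A (y h₂ s) v := by rw [hv, map_sub A, sub_apply]
        rw [this]
        simp only [sub_apply, dualEmb_apply]
        ring
      simp only [Pi.sub_apply, ← hv, zero_mul, sub_zero]
      rw [e1]
      have b1 : ‖b‖ ≤ K * ‖h₁ (projIcc 0 T hT.le s) - h₂ (projIcc 0 T hT.le s)‖ :=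
        hB.norm_sub_le _ _
      have b2 : |inner ℝ b (j v)| ≤ K * ‖h₁ (projIcc 0 T hT.le s) - h₂ (projIcc 0 T hT.le s)‖ *
          (‖j‖ * ‖v‖) := (abs_real_inner_le_norm _ _).trans
        (mul_le_mul b1 (j.le_opNorm v) (norm_nonneg _) (by positivity))
      have b3 := hA v
      have b4 := (neg_le_abs _).trans b2
      set r := ‖h₁ (projIcc 0 T hT.le s) - h₂ (projIcc 0 T hT.le s)‖
      have b5 : (K * ‖j‖) ^ 2 / (2 * α) / 2 * r ^ 2 + α * ‖v‖ ^ 2 - K * r * (‖j‖ * ‖v‖) =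
          1 / α * (K * ‖j‖ * r / 2 - α * ‖v‖) ^ 2 := by
        field_simp
        ring
      have b6 : 0 ≤ 1 / α * (K * ‖j‖ * r / 2 - α * ‖v‖) ^ 2 := by positivity
      linarith
  refine ⟨fun t => v₀ + y h t, fun t => j v₀ + Y h t, ?_, by simp [hY0]⟩
  refine ((hpath h).const_add v₀).congr_deriv ?_
  filter_upwards [ae_restrict_mem measurableSet_Ioo] with t ht
  have e : h (projIcc 0 T hT.le t) = j v₀ + Y h t := by
    conv_lhs => rw [← hh]
    rw [projIcc_of_mem hT.le (Ioo_subset_Icc_self ht)]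
    rfl
  rw [e, map_add A]
  abel

end Lipschitz

end SemilinearParabolic

namespace SemilinearParabolic

section Sobolev

variable {n : ℕ} {Ω : BoundedDomain n}

/-! ### The Hilbert space `H₀¹(Ω)` -/

/-- The inner product `∫ ∇v · ∇w` of `H₀¹(Ω)`, which induces the norm of `H₀¹(Ω)`. -/
noncomputable instance : InnerProductSpace ℝ (H10 Ω) where
  inner v w := inner ℝ (H10.gradLin v) (H10.gradLin w)
  norm_sq_eq_re_inner v := by
    rw [H10.norm_def, ← real_inner_self_eq_norm_sq]; rfl
  conj_inner_symm v w := (conj_trivial _).trans (real_inner_comm _ _)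
  add_left u v w := by rw [map_add, inner_add_left]
  smul_left v w r := by rw [map_smul, inner_smul_left]

theorem H10.norm_eq (v : H10 Ω) : ‖v‖ = ‖H10.grad v‖ := rfl

theorem H10.isometry_grad : Isometry (H10.grad (Ω := Ω)) :=
  AddMonoidHomClass.isometry_of_norm _ fun _ => rfl

/-- An element of `H₀¹(Ω)` from a pair in the closure of the test functions. -/
def H10.mk (p : L2 Ω × L2v Ω) (hp : p ∈ h10Submodule Ω) : H10 Ω := ⟨p, hp⟩

theorem H10.mem (v : H10 Ω) : (H10.fn v, H10.grad v) ∈ h10Submodule Ω := v.2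

theorem isClosed_h10Submodule : IsClosed (h10Submodule Ω : Set (L2 Ω × L2v Ω)) :=
  Submodule.isClosed_topologicalClosure _

instance : CompleteSpace (H10 Ω) := by
  refine Metric.complete_of_cauchySeq_tendsto fun u hu => ?_
  have h1 : CauchySeq fun k => H10.fn (u k) := hu.map H10.fn.uniformContinuous
  have h2 : CauchySeq fun k => H10.grad (u k) := hu.map H10.grad.uniformContinuous
  obtain ⟨p, hp⟩ := cauchySeq_tendsto_of_complete h1
  obtain ⟨q, hq⟩ := cauchySeq_tendsto_of_complete h2
  have hmem : (p, q) ∈ h10Submodule Ω :=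
    isClosed_h10Submodule.mem_of_tendsto (hp.prodMk_nhds hq)
      (Eventually.of_forall fun k => H10.mem (u k))
  exact ⟨H10.mk (p, q) hmem, (H10.isometry_grad.isEmbedding.tendsto_nhds_iff).2 hq⟩

theorem H10.fn_ofTest (φ : Ω.Test) : H10.fn (H10.ofTest φ) =ᵐ[Ω.vol] φ :=
  (test_memLp φ).coeFn_toLp

theorem H10.grad_ofTest (φ : Ω.Test) : H10.grad (H10.ofTest φ) =ᵐ[Ω.vol] gradient φ :=
  (test_gradient_memLp φ).coeFn_toLp

theorem H10.denseRange_ofTest : DenseRange (H10.ofTest (Ω := Ω)) := by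
  intro v
  rw [mem_closure_iff_seq_limit]
  have hv : (H10.fn v, H10.grad v) ∈ closure (Set.range (testGraph Ω)) := by
    have := H10.mem v
    exact this
  obtain ⟨x, hx, hxv⟩ := mem_closure_iff_seq_limit.1 hv
  choose φ hφ using hx
  refine ⟨fun k => H10.ofTest (φ k), fun k => mem_range_self _, ?_⟩
  rw [H10.isometry_grad.isEmbedding.tendsto_nhds_iff]
  have := (continuous_snd.tendsto _).comp hxv
  refine this.congr fun k => ?_
  simp only [Function.comp_apply, ← hφ k]
  rfl

theorem test_eq_zero_of_notMem (φ : Ω.Test) {x : Sp n} (hx : x ∉ (Ω.carrier : Set (Sp n))) :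
    φ x = 0 := image_eq_zero_of_notMem_tsupport fun h => hx (φ.tsupport_subset h)

theorem isFiniteMeasure_vol (Ω : BoundedDomain n) : IsFiniteMeasure Ω.vol :=
  ⟨by simpa using Ω.bounded.measure_lt_top⟩

/-- A function in `L²(Ω)` that is orthogonal to all test functions vanishes. -/
theorem Lp_eq_zero_of_integral_test {F : Type*} [NormedAddCommGroup F] [NormedSpace ℝ F]
    [CompleteSpace F] {q : Lp F 2 Ω.vol} (h : ∀ φ : Ω.Test, ∫ x, φ x • q x ∂Ω.vol = 0) :
    q = 0 := by
  have hfin := isFiniteMeasure_vol Ω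
  have hqi : IntegrableOn q (Ω.carrier : Set (Sp n)) volume :=
    (Lp.memLp q).integrable (by norm_num)
  have := Ω.carrier.isOpen.ae_eq_zero_of_integral_contDiff_smul_eq_zero
    (f := q) (μ := volume) hqi.locallyIntegrableOn fun g hg hgc hgs => by
      let φ : Ω.Test := ⟨g, hg, hgc, hgs⟩
      rw [← h φ, setIntegral_eq_integral_of_forall_compl_eq_zero]
      · rfl
      · intro x hx
        rw [test_eq_zero_of_notMem φ hx, zero_smul]
  refine Lp.ext ?_
  refine EventuallyEq.trans ?_ (Lp.coeFn_zero F 2 Ω.vol).symm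
  rw [EventuallyEq, ae_restrict_iff' Ω.carrier.isOpen.measurableSet]
  exact this

theorem H10.denseRange_fn : DenseRange (H10.fn (Ω := Ω)) := by
  have h1 : (LinearMap.range (H10.fn (Ω := Ω)).toLinearMap).topologicalClosure = ⊤ := by
    rw [Submodule.topologicalClosure_eq_top_iff, Submodule.eq_bot_iff]
    intro h hh
    refine Lp_eq_zero_of_integral_test fun φ => ?_
    have h2 := (Submodule.mem_orthogonal _ _).1 hh (H10.fn (H10.ofTest φ)) ⟨_, rfl⟩
    rw [L2.inner_def] at h2
    rw [← h2]
    refine integral_congr_ae ?_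
    filter_upwards [H10.fn_ofTest φ] with x hx
    rw [hx]
    simp [mul_comm]
  have h2 := Submodule.dense_iff_topologicalClosure_eq_top.2 h1
  exact h2

/-- Integration by parts against test functions. In particular the weak gradient is determined by
the function. -/
theorem H10.integral_grad (v : H10 Ω) (φ : Ω.Test) (e : Sp n) :
    ∫ x, φ x * inner ℝ (H10.grad v x) e ∂Ω.vol =
      -∫ x, inner ℝ (gradient φ x) e * H10.fn v x ∂Ω.vol := by
  have ha : MemLp (fun x => φ x • e) 2 Ω.vol :=
    (ContinuousLinearMap.toSpanSingleton ℝ e).comp_memLp' (test_memLp φ)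
  let a : Lp (Sp n) 2 Ω.vol := ha.toLp _
  have hb : MemLp (fun x => inner ℝ (gradient φ x) e) 2 Ω.vol :=
    (test_gradient_memLp φ).inner_const e
  let b : Lp ℝ 2 Ω.vol := hb.toLp _
  have ea : ∀ q : L2v Ω, inner ℝ a q = ∫ x, φ x * inner ℝ (q x) e ∂Ω.vol := fun q => by
    rw [L2.inner_def]
    refine integral_congr_ae ?_
    filter_upwards [ha.coeFn_toLp] with x hx
    rw [hx, real_inner_smul_left, real_inner_comm]
  have eb : ∀ p : L2 Ω, inner ℝ b p = ∫ x, inner ℝ (gradient φ x) e * p x ∂Ω.vol := fun p => by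
    rw [L2.inner_def]
    refine integral_congr_ae ?_
    filter_upwards [hb.coeFn_toLp] with x hx
    rw [hx]
    simp [mul_comm]
  rw [← ea, ← eb]
  -- both sides are continuous in `(v, ∇v)`, so that `v` may be assumed to be a test function
  have hcl : IsClosed {p : L2 Ω × L2v Ω | inner ℝ a p.2 = -inner ℝ b p.1} :=
    isClosed_eq (by fun_prop) (by fun_prop)
  have hsub : Set.range (testGraph Ω) ⊆ {p | inner ℝ a p.2 = -inner ℝ b p.1} := by
    rintro _ ⟨ψ, rfl⟩
    rw [mem_ofPred_eq, ea, eb]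
    have c1 : ∫ x, φ x * inner ℝ ((testGraph Ω ψ).2 x) e ∂Ω.vol =
        ∫ x, φ x * fderiv ℝ ψ x e := by
      refine Eq.trans ?_ (setIntegral_eq_integral_of_forall_compl_eq_zero
        (s := (Ω.carrier : Set (Sp n)))
        (fun x hx => by rw [test_eq_zero_of_notMem φ hx, zero_mul]))
      refine integral_congr_ae ?_
      filter_upwards [(test_gradient_memLp ψ).coeFn_toLp] with x hx
      rw [testGraph]
      simp only [LinearMap.coe_mk, AddHom.coe_mk]
      rw [hx]
      simp [gradient]
    have c2 : ∫ x, inner ℝ (gradient φ x) e * (testGraph Ω ψ).1 x ∂Ω.vol =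
        ∫ x, fderiv ℝ φ x e * ψ x := by
      refine Eq.trans ?_ (setIntegral_eq_integral_of_forall_compl_eq_zero
        (s := (Ω.carrier : Set (Sp n)))
        (fun x hx => by rw [test_eq_zero_of_notMem ψ hx, mul_zero]))
      refine integral_congr_ae ?_
      filter_upwards [(test_memLp ψ).coeFn_toLp] with x hx
      rw [testGraph]
      simp only [LinearMap.coe_mk, AddHom.coe_mk]
      rw [hx]
      simp [gradient]
    rw [c1, c2]
    have hcd : ∀ χ : Ω.Test, Continuous fun x => fderiv ℝ χ x e := fun χ =>
      (χ.contDiff.continuous_fderiv (by simp)).clm_apply continuous_const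
    have hφ := φ.continuous
    have hψ := ψ.continuous
    have hd1 := hcd φ
    have hd2 := hcd ψ
    refine integral_mul_fderiv_eq_neg_fderiv_mul_of_integrable ?_ ?_ ?_
      (fun x _ => test_differentiable φ x) (fun x _ => test_differentiable ψ x)
    · refine Continuous.integrable_of_hasCompactSupport (by fun_prop) ?_
      exact ψ.hasCompactSupport.mul_left
    · refine Continuous.integrable_of_hasCompactSupport (by fun_prop) ?_
      exact φ.hasCompactSupport.mul_right
    · exact Continuous.integrable_of_hasCompactSupport (by fun_prop) φ.hasCompactSupport.mul_right
  exact closure_minimal hsub hcl (H10.mem v)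

/-- The embedding of `H₀¹(Ω)` into `L²(Ω)` is injective. -/
theorem H10.fn_injective : Function.Injective (H10.fn (Ω := Ω)) := by
  refine (injective_iff_map_eq_zero _).2 fun v hv => ?_
  refine norm_eq_zero.1 ?_
  rw [H10.norm_eq, norm_eq_zero]
  have hfin := isFiniteMeasure_vol Ω
  refine Lp_eq_zero_of_integral_test fun φ => ?_
  refine ext_inner_right ℝ fun e => ?_
  have hint : Integrable (fun x => φ x • H10.grad v x) Ω.vol :=
    memLp_two_bilin_integrable (ContinuousLinearMap.lsmul ℝ ℝ) (test_memLp φ) (Lp.memLp _)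
  have h0 : H10.fn v =ᵐ[Ω.vol] 0 := by rw [hv]; exact Lp.coeFn_zero _ _ _
  rw [inner_zero_left, real_inner_comm, ← integral_inner hint]
  refine Eq.trans ?_ ((H10.integral_grad v φ e).trans ?_)
  · refine integral_congr_ae (Eventually.of_forall fun x => ?_)
    simp only
    rw [real_inner_smul_right, real_inner_comm]
  · rw [integral_eq_zero_of_ae, neg_zero]
    filter_upwards [h0] with x hx
    rw [hx]
    simp

end Sobolev

end SemilinearParabolic

namespace SemilinearParabolic

/-! ### Superposition operators on `H₀¹(Ω)` -/

section WeakConvergence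

/-- If `j` is injective, a bounded sequence in the Hilbert space `V` whose image under `j` converges
to `j x₀` converges weakly to `x₀`: the functionals `⟨h, j ·⟩` are dense in the dual of `V`. -/
theorem tendsto_apply_of_bounded {V H : Type*} [NormedAddCommGroup V] [InnerProductSpace ℝ V]
    [CompleteSpace V] [NormedAddCommGroup H] [InnerProductSpace ℝ H] [CompleteSpace H]
    {j : V →L[ℝ] H} (hj : Function.Injective j) {x : ℕ → V} {x₀ : V} {C : ℝ}
    (hb : ∀ k, ‖x k‖ ≤ C) (h : Tendsto (fun k => j (x k)) atTop (𝓝 (j x₀)))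
    (ℓ : StrongDual ℝ V) : Tendsto (fun k => ℓ (x k)) atTop (𝓝 (ℓ x₀)) := by
  have hdense : DenseRange (dualEmb j) := by
    have h1 : (j.adjoint.range).topologicalClosure = ⊤ := by
      rw [Submodule.topologicalClosure_eq_top_iff, ContinuousLinearMap.orthogonal_range,
        ContinuousLinearMap.adjoint_adjoint]
      exact LinearMap.ker_eq_bot.2 hj
    have h2 : DenseRange j.adjoint := Submodule.dense_iff_topologicalClosure_eq_top.2 h1
    have h3 := (toDual ℝ V).surjective.denseRange.comp h2 (toDual ℝ V).continuous
    have h4 : (dualEmb j : H → StrongDual ℝ V) = toDual ℝ V ∘ j.adjoint := by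
      funext h
      ext v
      simp [ContinuousLinearMap.adjoint_inner_left]
    rw [h4]
    exact h3
  have hC : 0 ≤ C := (norm_nonneg _).trans (hb 0)
  rw [Metric.tendsto_atTop]
  intro ε hε
  obtain ⟨_, hg, ⟨g, rfl⟩⟩ := Metric.dense_iff.1 hdense ℓ (ε / (2 * (C + ‖x₀‖ + 1))) (by positivity)
  rw [Metric.mem_ball, dist_eq_norm] at hg
  have h1 : Tendsto (fun k => dualEmb j g (x k)) atTop (𝓝 (dualEmb j g x₀)) :=
    Tendsto.inner tendsto_const_nhds h
  obtain ⟨N, hN⟩ := Metric.tendsto_atTop.1 h1 (ε / 2) (by positivity)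
  refine ⟨N, fun k hk => ?_⟩
  have h2 := hN k hk
  rw [Real.dist_eq] at h2 ⊢
  have h3 : |(dualEmb j g - ℓ) (x k - x₀)| ≤ ε / 2 := by
    refine ((dualEmb j g - ℓ).le_opNorm _).trans ?_
    have h4 : ‖x k - x₀‖ ≤ C + ‖x₀‖ := (norm_sub_le _ _).trans (by linarith [hb k])
    calc ‖dualEmb j g - ℓ‖ * ‖x k - x₀‖ ≤ ε / (2 * (C + ‖x₀‖ + 1)) * (C + ‖x₀‖ + 1) := by
          gcongr
          linarith
      _ = ε / 2 := by field_simp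
  have h5 : (dualEmb j g - ℓ) (x k - x₀) =
      (dualEmb j g (x k) - dualEmb j g x₀) - (ℓ (x k) - ℓ x₀) := by
    rw [map_sub, sub_apply, sub_apply]; ring
  rw [h5] at h3
  have h6 := abs_sub_abs_le_abs_sub (ℓ (x k) - ℓ x₀) (dualEmb j g (x k) - dualEmb j g x₀)
  rw [abs_sub_comm (ℓ (x k) - ℓ x₀)] at h6
  linarith

end WeakConvergence

section ChainRule

variable {n : ℕ} {Ω : BoundedDomain n}

theorem memLp_comp_smul {c : ℝ → ℝ} (hc : Continuous c) {K : ℝ} (hK : ∀ s, |c s| ≤ K)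
    (p : L2 Ω) (q : L2v Ω) : MemLp (fun x => c (p x) • q x) 2 Ω.vol := by
  refine (Lp.memLp q).of_le_mul (c := K)
    ((hc.comp_aestronglyMeasurable (Lp.aestronglyMeasurable p)).smul
      (Lp.aestronglyMeasurable q)) (Eventually.of_forall fun x => ?_)
  rw [norm_smul]
  exact mul_le_mul_of_nonneg_right (hK _) (norm_nonneg _)

/-- The map `(p, q) ↦ c(p) q` from `L²(Ω) × L²(Ω; ℝⁿ)` to `L²(Ω; ℝⁿ)`, for bounded continuous
`c`. -/
noncomputable def compSmul {c : ℝ → ℝ} (hc : Continuous c) {K : ℝ} (hK : ∀ s, |c s| ≤ K)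
    (r : L2 Ω × L2v Ω) : L2v Ω := (memLp_comp_smul hc hK r.1 r.2).toLp _

theorem exists_subseq_ae {α F : Type*} [MeasurableSpace α] {μ : Measure α} [NormedAddCommGroup F]
    {p : ℕ → Lp F 2 μ} {p₀ : Lp F 2 μ} (h : Tendsto p atTop (𝓝 p₀)) :
    ∃ ms : ℕ → ℕ, StrictMono ms ∧ ∀ᵐ x ∂μ, Tendsto (fun k => p (ms k) x) atTop (𝓝 (p₀ x)) := by
  have h1 : Tendsto (fun k => eLpNorm (⇑(p k) - ⇑p₀) 2 μ) atTop (𝓝 0) :=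
    (Lp.tendsto_Lp_iff_tendsto_eLpNorm' p p₀).1 h
  exact (tendstoInMeasure_of_tendsto_eLpNorm (by norm_num)
    (fun k => Lp.aestronglyMeasurable (p k)) (Lp.aestronglyMeasurable p₀) h1).exists_seq_tendsto_ae

/-- Dominated convergence in `L²`. -/
theorem tendsto_toLp_of_dominated {α F : Type*} [MeasurableSpace α] {μ : Measure α}
    [NormedAddCommGroup F] {f : ℕ → α → F} {f₀ : α → F} (hf : ∀ k, MemLp (f k) 2 μ)
    (hf₀ : MemLp f₀ 2 μ) {b : α → ℝ} (hb : MemLp b 2 μ)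
    (hle : ∀ k, ∀ᵐ x ∂μ, ‖f k x - f₀ x‖ ≤ b x)
    (h : ∀ᵐ x ∂μ, Tendsto (fun k => f k x) atTop (𝓝 (f₀ x))) :
    Tendsto (fun k => (hf k).toLp (f k)) atTop (𝓝 (hf₀.toLp f₀)) := by
  rw [tendsto_iff_norm_sub_tendsto_zero]
  have h1 : Tendsto (fun k => ∫ x, ‖f k x - f₀ x‖ ^ 2 ∂μ) atTop (𝓝 0) := by
    have := tendsto_integral_of_dominated_convergence (μ := μ) (fun x => b x ^ 2)
      (F := fun k x => ‖f k x - f₀ x‖ ^ 2) (f := fun _ => 0)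
      (fun k => (((hf k).sub hf₀).1.norm.pow 2)) hb.integrable_sq
      (fun k => by
        filter_upwards [hle k] with x hx
        rw [norm_pow, norm_norm]
        gcongr)
      (by
        filter_upwards [h] with x hx
        have := ((hx.sub_const (f₀ x)).norm).pow 2
        simpa using this)
    simpa using this
  have h2 := h1.sqrt
  rw [Real.sqrt_zero] at h2
  refine h2.congr fun k => ?_
  rw [← MemLp.toLp_sub, ← Real.sqrt_sq (norm_nonneg (((hf k).sub hf₀).toLp (f k - f₀))),
    norm_toLp_two_sq]
  rfl

theorem continuous_compSmul {c : ℝ → ℝ} (hc : Continuous c) {K : ℝ} (hK : ∀ s, |c s| ≤ K) :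
    Continuous (compSmul (Ω := Ω) hc hK) := by
  rw [continuous_iff_seqContinuous]
  intro r r₀ hr
  refine tendsto_of_subseq_tendsto fun ns hns => ?_
  have hp : Tendsto (fun k => (r (ns k)).1) atTop (𝓝 r₀.1) :=
    ((continuous_fst.tendsto _).comp hr).comp hns
  have hq : Tendsto (fun k => (r (ns k)).2) atTop (𝓝 r₀.2) :=
    ((continuous_snd.tendsto _).comp hr).comp hns
  obtain ⟨ms, hms, hae⟩ := exists_subseq_ae hp
  refine ⟨ms, ?_⟩
  -- with the second argument frozen: dominated convergence
  have h1 : Tendsto (fun k => compSmul hc hK ((r (ns (ms k))).1, r₀.2)) atTop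
      (𝓝 (compSmul hc hK r₀)) := by
    refine tendsto_toLp_of_dominated (fun k => memLp_comp_smul hc hK (r (ns (ms k))).1 r₀.2)
      (memLp_comp_smul hc hK r₀.1 r₀.2) (b := fun x => 2 * K * ‖r₀.2 x‖)
      ((Lp.memLp r₀.2).norm.const_mul _) (fun k => Eventually.of_forall fun x => ?_) ?_
    · rw [← sub_smul, norm_smul]
      gcongr
      refine (norm_sub_le _ _).trans ?_
      have h1 := hK ((r (ns (ms k))).1 x)
      have h2 := hK (r₀.1 x)
      simp only [Real.norm_eq_abs]
      linarith
    · filter_upwards [hae] with x hx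
      exact ((hc.tendsto _).comp hx).smul_const _
  -- the error made by freezing the second argument
  have h2 : Tendsto (fun k => compSmul hc hK (r (ns (ms k))) -
      compSmul hc hK ((r (ns (ms k))).1, r₀.2)) atTop (𝓝 0) := by
    rw [tendsto_zero_iff_norm_tendsto_zero]
    have h3 : Tendsto (fun k => K * ‖(r (ns (ms k))).2 - r₀.2‖) atTop (𝓝 0) := by
      have := (tendsto_iff_norm_sub_tendsto_zero.1 (hq.comp hms.tendsto_atTop)).const_mul K
      simpa using this
    refine tendsto_of_tendsto_of_tendsto_of_le_of_le tendsto_const_nhds h3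
      (fun _ => norm_nonneg _) fun k => ?_
    refine Lp.norm_le_mul_norm_of_ae_le_mul ?_
    filter_upwards [Lp.coeFn_sub (compSmul hc hK (r (ns (ms k))))
        (compSmul hc hK ((r (ns (ms k))).1, r₀.2)), Lp.coeFn_sub (r (ns (ms k))).2 r₀.2,
      (memLp_comp_smul hc hK (r (ns (ms k))).1 (r (ns (ms k))).2).coeFn_toLp,
      (memLp_comp_smul hc hK (r (ns (ms k))).1 r₀.2).coeFn_toLp] with x e1 e2 e3 e4
    rw [e1, e2, Pi.sub_apply, Pi.sub_apply]
    simp only [compSmul]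
    rw [e3, e4, ← smul_sub, norm_smul]
    exact mul_le_mul_of_nonneg_right (hK _) (norm_nonneg _)
  have h3 := h2.add h1
  simpa using h3

/-- `C¹` functions with bounded derivative that vanish at `0`: they act on `H₀¹(Ω)`. -/
structure IsChainFun (β : ℝ → ℝ) (K : ℝ) : Prop where
  contDiff : ContDiff ℝ 1 β
  zero : β 0 = 0
  bound : ∀ s, |deriv β s| ≤ K

variable {β : ℝ → ℝ} {K : ℝ}

theorem IsChainFun.continuous_deriv (h : IsChainFun β K) : Continuous (deriv β) :=
  h.contDiff.continuous_deriv le_rfl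

theorem IsChainFun.lipschitz (h : IsChainFun β K) : LipschitzWith K.toNNReal β := by
  refine lipschitzWith_of_nnnorm_deriv_le (h.contDiff.differentiable (by simp)) fun s => ?_
  rw [← NNReal.coe_le_coe, coe_nnnorm, Real.norm_eq_abs,
    Real.coe_toNNReal _ ((abs_nonneg _).trans (h.bound 0))]
  exact h.bound s

/-- The superposition operator of `β` on `L²(Ω)`. -/
noncomputable def IsChainFun.comp (h : IsChainFun β K) (p : L2 Ω) : L2 Ω :=
  h.lipschitz.compLp h.zero p

theorem IsChainFun.coeFn_comp (h : IsChainFun β K) (p : L2 Ω) :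
    h.comp p =ᵐ[Ω.vol] fun x => β (p x) := h.lipschitz.coeFn_compLp h.zero p

theorem IsChainFun.lipschitz_comp (h : IsChainFun β K) :
    LipschitzWith K.toNNReal (h.comp (Ω := Ω)) := h.lipschitz.lipschitzWith_compLp h.zero

theorem contDiff_comp_test {Q : ℝ → ℝ} (hQ : ContDiff ℝ ∞ Q) (h0 : Q 0 = 0) (φ : Ω.Test) :
    ∃ χ : Ω.Test, (∀ x, χ x = Q (φ x)) ∧ ∀ x, gradient χ x = deriv Q (φ x) • gradient φ x := by
  have hsupp : Function.support (fun x => Q (φ x)) ⊆ Function.support φ := fun x hx hx0 =>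
    hx (by simp only [hx0, h0])
  refine ⟨⟨fun x => Q (φ x), hQ.comp φ.contDiff, φ.hasCompactSupport.mono hsupp,
    (closure_mono hsupp).trans φ.tsupport_subset⟩, fun x => rfl, fun x => ?_⟩
  have hd : HasDerivAt Q (deriv Q (φ x)) (φ x) :=
    (hQ.differentiable (by simp) (φ x)).hasDerivAt
  have h1 : HasFDerivAt (fun x => Q (φ x)) (deriv Q (φ x) • fderiv ℝ φ x) x :=
    hd.comp_hasFDerivAt x (test_differentiable φ x).hasFDerivAt
  have h2 : fderiv ℝ (fun x => Q (φ x)) x = deriv Q (φ x) • fderiv ℝ φ x := h1.fderiv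
  change (toDual ℝ (Sp n)).symm (fderiv ℝ (fun x => Q (φ x)) x) = _
  rw [h2, map_smul]
  rfl

/-- The chain rule for test functions, by uniform approximation of `β'` by polynomials. -/
theorem IsChainFun.mem_of_test (h : IsChainFun β K) (φ : Ω.Test) :
    (h.comp (testGraph Ω φ).1, compSmul h.continuous_deriv h.bound (testGraph Ω φ)) ∈
      h10Submodule Ω := by
  obtain ⟨R, hR⟩ := φ.continuous.bounded_above_of_compact_support φ.hasCompactSupport
  have hR0 : 0 ≤ R := (norm_nonneg _).trans (hR 0)
  change _ ∈ closure (Set.range (testGraph Ω))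
  rw [Metric.mem_closure_iff]
  intro ε hε
  -- `P` is close to `β'` on the range of `φ`, and `χ = Q ∘ φ` for the primitive `Q` of `P`
  obtain ⟨P, hP⟩ := exists_polynomial_near_of_continuousOn (-R) R (deriv β)
    h.continuous_deriv.continuousOn (ε / (‖testGraph Ω φ‖ + 1)) (by positivity)
  obtain ⟨hQ, hQd⟩ := contDiff_primitive (θ := fun s => P.eval s)
    (by simpa using P.contDiff_aeval (𝕜 := ℝ) ∞) 0
  obtain ⟨χ, hχ, hχg⟩ := contDiff_comp_test hQ (by simp) φ
  refine ⟨_, ⟨χ, rfl⟩, ?_⟩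
  set δ := ε / (‖testGraph Ω φ‖ + 1) with hδ
  have hφm : ∀ x, φ x ∈ Icc (-R) R := fun x => abs_le.1 (hR x)
  have b1 : ‖h.comp (testGraph Ω φ).1 - (testGraph Ω χ).1‖ ≤ δ * ‖(testGraph Ω φ).1‖ := by
    refine Lp.norm_le_mul_norm_of_ae_le_mul ?_
    filter_upwards [Lp.coeFn_sub (h.comp (testGraph Ω φ).1) (testGraph Ω χ).1,
      h.coeFn_comp (testGraph Ω φ).1, (test_memLp χ).coeFn_toLp,
      (test_memLp φ).coeFn_toLp] with x e1 e2 e3 e4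
    have e4' : (testGraph Ω φ).1 x = φ x := e4
    have e3' : (testGraph Ω χ).1 x = χ x := e3
    rw [e1, Pi.sub_apply, e2, e3', e4', hχ]
    have e5 : β (φ x) = ∫ s in 0..φ x, deriv β s := by
      rw [intervalIntegral.integral_deriv_eq_sub
        (fun s _ => h.contDiff.differentiable (by simp) s)
        (h.continuous_deriv.intervalIntegrable _ _), h.zero, sub_zero]
    rw [e5, ← intervalIntegral.integral_sub (h.continuous_deriv.intervalIntegrable _ _)
      (P.continuous.intervalIntegrable _ _)]
    have := intervalIntegral.norm_integral_le_of_norm_le_const (a := 0) (b := φ x) (C := δ)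
      (f := fun s => deriv β s - P.eval s) fun s hs => by
        rw [Real.norm_eq_abs, abs_sub_comm]
        refine (hP s ?_).le
        have := hφm x
        rcases le_total 0 (φ x) with h0 | h0
        · rw [uIoc_of_le h0] at hs
          exact ⟨by linarith [hs.1], by linarith [hs.2, this.2]⟩
        · rw [uIoc_of_ge h0] at hs
          exact ⟨by linarith [hs.1, this.1], by linarith [hs.2]⟩
    simpa using this
  have b2 : ‖compSmul h.continuous_deriv h.bound (testGraph Ω φ) - (testGraph Ω χ).2‖ ≤
      δ * ‖(testGraph Ω φ).2‖ := by
    refine Lp.norm_le_mul_norm_of_ae_le_mul ?_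
    filter_upwards [Lp.coeFn_sub (compSmul h.continuous_deriv h.bound (testGraph Ω φ))
      (testGraph Ω χ).2, (memLp_comp_smul h.continuous_deriv h.bound (testGraph Ω φ).1
        (testGraph Ω φ).2).coeFn_toLp, (test_gradient_memLp χ).coeFn_toLp,
      (test_gradient_memLp φ).coeFn_toLp, (test_memLp φ).coeFn_toLp] with x e1 e2 e3 e4 e5
    have e2' : compSmul h.continuous_deriv h.bound (testGraph Ω φ) x =
      deriv β ((testGraph Ω φ).1 x) • (testGraph Ω φ).2 x := e2
    have e3' : (testGraph Ω χ).2 x = gradient χ x := e3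
    have e4' : (testGraph Ω φ).2 x = gradient φ x := e4
    have e5' : (testGraph Ω φ).1 x = φ x := e5
    rw [e1, Pi.sub_apply, e2', e3', e4', e5', hχg, hQd, ← sub_smul, norm_smul]
    refine mul_le_mul_of_nonneg_right ?_ (norm_nonneg _)
    rw [Real.norm_eq_abs, abs_sub_comm]
    exact (hP _ (hφm x)).le
  have hδ0 : 0 ≤ δ := by positivity
  have b3 : δ * ‖testGraph Ω φ‖ < ε := by
    rw [hδ, div_mul_eq_mul_div, div_lt_iff₀ (by positivity)]
    linarith
  rw [dist_eq_norm, Prod.norm_def, max_lt_iff]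
  exact ⟨(b1.trans (mul_le_mul_of_nonneg_left (norm_fst_le _) hδ0)).trans_lt b3,
    (b2.trans (mul_le_mul_of_nonneg_left (norm_snd_le _) hδ0)).trans_lt b3⟩

/-- The chain rule `∇(β ∘ v) = β'(v) ∇v` in `H₀¹(Ω)`, by density of the test functions. -/
theorem IsChainFun.mem (h : IsChainFun β K) (v : H10 Ω) :
    (h.comp (H10.fn v), compSmul h.continuous_deriv h.bound (H10.fn v, H10.grad v)) ∈
      h10Submodule Ω := by
  have hc : Continuous fun r : L2 Ω × L2v Ω =>
      (h.comp r.1, compSmul h.continuous_deriv h.bound r) :=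
    (h.lipschitz_comp.continuous.comp continuous_fst).prodMk
      (continuous_compSmul h.continuous_deriv h.bound)
  have h1 : (H10.fn v, H10.grad v) ∈ closure (Set.range (testGraph Ω)) := H10.mem v
  have h2 := map_mem_closure hc h1 (t := (h10Submodule Ω : Set (L2 Ω × L2v Ω))) (by
    rintro _ ⟨φ, rfl⟩
    exact h.mem_of_test φ)
  rwa [isClosed_h10Submodule.closure_eq] at h2

/-- The superposition operator of `β` on `H₀¹(Ω)`. -/
noncomputable def IsChainFun.compH10 (h : IsChainFun β K) (v : H10 Ω) : H10 Ω :=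
  H10.mk _ (h.mem v)

theorem IsChainFun.fn_compH10 (h : IsChainFun β K) (v : H10 Ω) :
    H10.fn (h.compH10 v) = h.comp (H10.fn v) := rfl

theorem IsChainFun.grad_compH10 (h : IsChainFun β K) (v : H10 Ω) :
    H10.grad (h.compH10 v) =ᵐ[Ω.vol] fun x => deriv β (H10.fn v x) • H10.grad v x :=
  (memLp_comp_smul h.continuous_deriv h.bound (H10.fn v) (H10.grad v)).coeFn_toLp

theorem IsChainFun.continuous_compH10 (h : IsChainFun β K) :
    Continuous (h.compH10 (Ω := Ω)) := by
  rw [H10.isometry_grad.isEmbedding.continuous_iff]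
  exact (continuous_compSmul h.continuous_deriv h.bound).comp
    (H10.fn.continuous.prodMk H10.grad.continuous)

theorem IsChainFun.norm_compH10_le (h : IsChainFun β K) (v : H10 Ω) :
    ‖h.compH10 v‖ ≤ K * ‖v‖ := by
  rw [H10.norm_eq, H10.norm_eq]
  refine Lp.norm_le_mul_norm_of_ae_le_mul ?_
  filter_upwards [h.grad_compH10 v] with x hx
  rw [hx, norm_smul]
  exact mul_le_mul_of_nonneg_right (h.bound _) (norm_nonneg _)

end ChainRule

end SemilinearParabolic

namespace SemilinearParabolic

/-! ### The Brezis–Browder theorem -/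

section BrezisBrowder

theorem norm_Lp_le_add_of_ae_le {α F₁ F₂ F₃ : Type*} [MeasurableSpace α] {μ : Measure α}
    [NormedAddCommGroup F₁] [NormedAddCommGroup F₂] [NormedAddCommGroup F₃]
    {f : Lp F₁ 2 μ} {g : Lp F₂ 2 μ} {h : Lp F₃ 2 μ} {A B : ℝ} (hA : 0 ≤ A) (hB : 0 ≤ B)
    (hle : ∀ᵐ x ∂μ, ‖f x‖ ≤ A * ‖g x‖ + B * ‖h x‖) : ‖f‖ ≤ A * ‖g‖ + B * ‖h‖ := by
  have h1 : ‖f‖ ≤ ‖A • (Lp.memLp g).norm.toLp _ + B • (Lp.memLp h).norm.toLp _‖ := by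
    refine Lp.norm_le_norm_of_ae_le ?_
    filter_upwards [hle, Lp.coeFn_add (A • (Lp.memLp g).norm.toLp _)
      (B • (Lp.memLp h).norm.toLp _), Lp.coeFn_smul A ((Lp.memLp g).norm.toLp _),
      Lp.coeFn_smul B ((Lp.memLp h).norm.toLp _), (Lp.memLp g).norm.coeFn_toLp,
      (Lp.memLp h).norm.coeFn_toLp] with x e1 e2 e3 e4 e5 e6
    rw [e2, Pi.add_apply, e3, e4, Pi.smul_apply, Pi.smul_apply, e5, e6]
    exact e1.trans (le_abs_self _)
  refine h1.trans ((norm_add_le _ _).trans ?_)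
  rw [norm_smul, norm_smul, Real.norm_of_nonneg hA, Real.norm_of_nonneg hB, Lp.norm_toLp,
    Lp.norm_toLp, eLpNorm_norm, eLpNorm_norm, ← Lp.norm_def, ← Lp.norm_def]

/-- A regularised version of `min (|a|, |b|)`, with the sign of `a`. -/
noncomputable def signedMin (ε a b : ℝ) : ℝ := 2 * a * b ^ 2 / (a ^ 2 + b ^ 2 + ε)

variable {ε : ℝ}

theorem abs_signedMin_le (hε : 0 < ε) (a b : ℝ) : |signedMin ε a b| ≤ |b| := by
  have hD : 0 < a ^ 2 + b ^ 2 + ε := by positivity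
  rw [signedMin, abs_div, abs_of_pos hD, div_le_iff₀ hD]
  have h1 : |2 * a * b ^ 2| = |b| * (2 * |a| * |b|) := by
    rw [abs_mul, abs_mul, abs_pow, abs_two]; ring
  rw [h1]
  refine mul_le_mul_of_nonneg_left ?_ (abs_nonneg b)
  have := sq_nonneg (|a| - |b|)
  rw [← sq_abs a, ← sq_abs b]
  nlinarith

theorem abs_signedMin_sub_le (hε : 0 < ε) (a b : ℝ) :
    |signedMin ε a b - b| ≤ 2 * |a - b| + √ε := by
  have hD : 0 < a ^ 2 + b ^ 2 + ε := by positivity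
  have h0 : signedMin ε a b - b = -(b * ((a - b) ^ 2 + ε) / (a ^ 2 + b ^ 2 + ε)) := by
    rw [signedMin]; field_simp; ring
  rw [h0, abs_neg, abs_div, abs_of_pos hD, div_le_iff₀ hD, abs_mul,
    abs_of_pos (by positivity : 0 < (a - b) ^ 2 + ε), ← sq_abs (a - b)]
  set s := √ε
  have hs : 0 ≤ s := Real.sqrt_nonneg _
  have hs2 : s ^ 2 = ε := Real.sq_sqrt hε.le
  have h1 : |b| * |a - b| ≤ 2 * (a ^ 2 + b ^ 2 + ε) := by
    rw [← abs_mul]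
    refine abs_le.2 ⟨?_, ?_⟩ <;> nlinarith [sq_nonneg (a - b), sq_nonneg (a + b)]
  have h2 : |b| * s ≤ a ^ 2 + b ^ 2 + ε := by
    rw [← hs2, ← sq_abs b]
    nlinarith [sq_nonneg (|b| - s), sq_nonneg a]
  have h3 := mul_le_mul_of_nonneg_left h1 (abs_nonneg (a - b))
  have h4 := mul_le_mul_of_nonneg_left h2 hs
  have h5 : s * (|b| * s) = |b| * ε := by rw [← hs2]; ring
  nlinarith

theorem mul_signedMin_nonneg (hε : 0 < ε) {g a : ℝ} (h : 0 ≤ g * a) (b : ℝ) :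
    0 ≤ g * signedMin ε a b := by
  have hD : 0 < a ^ 2 + b ^ 2 + ε := by positivity
  have : g * signedMin ε a b = 2 * (g * a) * b ^ 2 / (a ^ 2 + b ^ 2 + ε) := by
    rw [signedMin]; ring
  rw [this]
  positivity

theorem continuous_signedMin_left (hε : 0 < ε) (b : ℝ) : Continuous fun a => signedMin ε a b := by
  unfold signedMin
  refine Continuous.div (by fun_prop) (by fun_prop) fun a => ?_
  positivity

variable {n : ℕ} {Ω : BoundedDomain n}

/-- Regularised minima of test functions are test functions, and their gradients are bounded
independently of `ε`. -/
theorem exists_signedMin_test (hε : 0 < ε) (φ ψ : Ω.Test) :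
    ∃ χ : Ω.Test, (∀ x, χ x = signedMin ε (φ x) (ψ x)) ∧
      ∀ x, ‖gradient χ x‖ ≤ 2 * ‖gradient φ x‖ + 2 * ‖gradient ψ x‖ := by
  have hD : ∀ x, 0 < φ x ^ 2 + ψ x ^ 2 + ε := fun x => by positivity
  have hsupp : Function.support (fun x => signedMin ε (φ x) (ψ x)) ⊆ Function.support ψ :=
    fun x hx hx0 => hx (by simp [signedMin, hx0])
  have hsm : ContDiff ℝ ∞ (fun x => signedMin ε (φ x) (ψ x)) := by
    unfold signedMin
    exact ((contDiff_const.mul φ.contDiff).mul (ψ.contDiff.pow 2)).div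
      (((φ.contDiff.pow 2).add (ψ.contDiff.pow 2)).add contDiff_const) fun x => (hD x).ne'
  refine ⟨⟨fun x => signedMin ε (φ x) (ψ x), hsm, ψ.hasCompactSupport.mono hsupp,
    (closure_mono hsupp).trans ψ.tsupport_subset⟩, fun x => rfl, fun x => ?_⟩
  have ha := (test_differentiable φ x).hasFDerivAt
  have hb := (test_differentiable ψ x).hasFDerivAt
  set D := φ x ^ 2 + ψ x ^ 2 + ε with hDdef
  have hDx : 0 < D := hD x
  have h1 : HasFDerivAt (fun x => signedMin ε (φ x) (ψ x))
      ((2 * ψ x ^ 2 * (ψ x ^ 2 + ε - φ x ^ 2) / D ^ 2) • fderiv ℝ φ x +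
        (4 * φ x * ψ x * (φ x ^ 2 + ε) / D ^ 2) • fderiv ℝ ψ x) x := by
    simp only [signedMin, div_eq_mul_inv _ (_ + _ + _)]
    have h2 := ((ha.const_mul 2).mul (hb.pow 2)).mul ((hasDerivAt_inv (hD x).ne').comp_hasFDerivAt x
      (((ha.pow 2).add (hb.pow 2)).add_const ε))
    refine h2.congr_fderiv ?_
    rw [← hDdef]
    ext e
    simp [← hDdef]
    field_simp
    rw [hDdef]
    ring
  have h2 : gradient (fun x => signedMin ε (φ x) (ψ x)) x =
      (2 * ψ x ^ 2 * (ψ x ^ 2 + ε - φ x ^ 2) / D ^ 2) • gradient φ x +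
        (4 * φ x * ψ x * (φ x ^ 2 + ε) / D ^ 2) • gradient ψ x := by
    simp only [gradient, h1.fderiv, map_add, map_smul]
  change ‖gradient (fun x => signedMin ε (φ x) (ψ x)) x‖ ≤ _
  rw [h2]
  refine (norm_add_le _ _).trans ?_
  rw [norm_smul, norm_smul]
  have hp : ‖2 * ψ x ^ 2 * (ψ x ^ 2 + ε - φ x ^ 2) / D ^ 2‖ ≤ 2 := by
    rw [Real.norm_eq_abs, abs_div, abs_of_pos (pow_pos hDx 2), div_le_iff₀ (pow_pos hDx 2),
      abs_mul, abs_of_nonneg (by positivity : 0 ≤ 2 * ψ x ^ 2), pow_two D, ← mul_assoc]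
    refine mul_le_mul ?_ ?_ (abs_nonneg _) (by positivity)
    · nlinarith [sq_nonneg (φ x)]
    · refine abs_le.2 ⟨?_, ?_⟩ <;> nlinarith [sq_nonneg (φ x), sq_nonneg (ψ x)]
  have hq : ‖4 * φ x * ψ x * (φ x ^ 2 + ε) / D ^ 2‖ ≤ 2 := by
    rw [Real.norm_eq_abs, abs_div, abs_of_pos (pow_pos hDx 2), div_le_iff₀ (pow_pos hDx 2),
      abs_mul, abs_of_nonneg (by positivity : 0 ≤ φ x ^ 2 + ε), pow_two D, ← mul_assoc]
    refine mul_le_mul ?_ ?_ (by positivity) (by positivity)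
    · refine abs_le.2 ⟨?_, ?_⟩ <;> nlinarith [sq_nonneg (φ x + ψ x), sq_nonneg (φ x - ψ x)]
    · nlinarith [sq_nonneg (ψ x)]
  gcongr

theorem integrable_mul_test {G : Sp n → ℝ}
    (hG : LocallyIntegrableOn G (Ω.carrier : Set (Sp n))) (φ : Ω.Test) :
    Integrable (fun x => G x * φ x) Ω.vol := by
  have h1 : IntegrableOn G (tsupport φ) :=
    hG.integrableOn_compact_subset φ.tsupport_subset φ.hasCompactSupport
  have h2 : IntegrableOn (fun x => G x * φ x) (tsupport φ) :=
    h1.mul_continuousOn φ.continuous.continuousOn φ.hasCompactSupport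
  have h3 : Integrable (fun x => G x * φ x) := by
    rwa [integrableOn_iff_integrable_of_support_subset] at h2
    intro x hx
    refine subset_tsupport _ fun h0 => hx ?_
    simp [h0]
  exact h3.restrict

/-- The **Brezis–Browder theorem**, for functionals of nonnegative type: if `ℓ ∈ H⁻¹(Ω)` is given
on test functions by a locally integrable function `G`, and if `G v ≥ 0`, then `ℓ v ≥ 0`, although
`G v` need not be known to be integrable. With test functions `φ_m → v`, the products
`G · signedMin ε φ_m φ_j` are dominated by `|G φ_j|`; this allows `m → ∞` for fixed `j`, and a
diagonal choice provides a bounded sequence of test functions that converges to `v` weakly. -/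
theorem nonneg_of_mul_nonneg {ℓ : Hm1 Ω} {G : Sp n → ℝ}
    (hG : LocallyIntegrableOn G (Ω.carrier : Set (Sp n)))
    (hℓ : ∀ φ : Ω.Test, ℓ (H10.ofTest φ) = ∫ x, G x * φ x ∂Ω.vol) {v : H10 Ω}
    (hv : ∀ᵐ x ∂Ω.vol, 0 ≤ G x * H10.fn v x) : 0 ≤ ℓ v := by
  have hfin := isFiniteMeasure_vol Ω
  obtain ⟨w, hw, hwv⟩ := mem_closure_iff_seq_limit.1 (H10.denseRange_ofTest v)
  choose φ₀ hφ₀ using hw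
  obtain rfl : (fun k => H10.ofTest (φ₀ k)) = w := funext hφ₀
  obtain ⟨ms, hms, hae⟩ := exists_subseq_ae ((H10.fn.continuous.tendsto _).comp hwv)
  set φ : ℕ → Ω.Test := fun k => φ₀ (ms k) with hφ
  have hφv : Tendsto (fun k => H10.ofTest (φ k)) atTop (𝓝 v) := hwv.comp hms.tendsto_atTop
  have hφae : ∀ᵐ x ∂Ω.vol, Tendsto (fun k => φ k x) atTop (𝓝 (H10.fn v x)) := by
    filter_upwards [hae, ae_all_iff.2 fun k => H10.fn_ofTest (φ k)] with x h1 h2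
    exact h1.congr fun k => h2 k
  have hpos : ∀ j : ℕ, 0 < 1 / ((j : ℝ) + 1) := fun j => by positivity
  choose χ hχ hχg using fun m j => exists_signedMin_test (hpos j) (φ m) (φ j)
  -- for fixed `j`, the limit `m → ∞` of `ℓ(χ m j)` is nonnegative
  have hlim : ∀ j : ℕ, ∃ m : ℕ, j ≤ m ∧ -(1 / ((j : ℝ) + 1)) ≤ ℓ (H10.ofTest (χ m j)) := by
    intro j
    have h1 : Tendsto (fun m => ℓ (H10.ofTest (χ m j))) atTop
        (𝓝 (∫ x, G x * signedMin (1 / ((j : ℝ) + 1)) (H10.fn v x) (φ j x) ∂Ω.vol)) := by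
      simp_rw [hℓ]
      refine tendsto_integral_of_dominated_convergence (fun x => ‖G x * φ j x‖)
        (fun m => (integrable_mul_test hG (χ m j)).1) (integrable_mul_test hG (φ j)).norm
        (fun m => Eventually.of_forall fun x => ?_) ?_
      · rw [norm_mul, norm_mul, hχ]
        exact mul_le_mul_of_nonneg_left (abs_signedMin_le (hpos j) _ _) (norm_nonneg _)
      · filter_upwards [hφae] with x hx
        simp_rw [hχ]
        exact (((continuous_signedMin_left (hpos j) (φ j x)).tendsto _).comp hx).const_mul _
    have h2 : 0 ≤ ∫ x, G x * signedMin (1 / ((j : ℝ) + 1)) (H10.fn v x) (φ j x) ∂Ω.vol := by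
      refine integral_nonneg_of_ae ?_
      filter_upwards [hv] with x hx
      exact mul_signedMin_nonneg (hpos j) hx _
    have h3 := h1.eventually (lt_mem_nhds (show -(1 / ((j : ℝ) + 1)) < _ by linarith [hpos j]))
    obtain ⟨m, hm1, hm2⟩ := (h3.and (eventually_ge_atTop j)).exists
    exact ⟨m, hm2, hm1.le⟩
  choose m hjm hm using hlim
  have hmt : Tendsto m atTop atTop := tendsto_atTop_mono hjm tendsto_id
  -- the diagonal sequence `χ (m j) j` converges to `v` weakly
  obtain ⟨C, hC⟩ : ∃ C, ∀ k, ‖H10.ofTest (φ k)‖ ≤ C := by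
    obtain ⟨C, hC⟩ := (Metric.isBounded_range_of_tendsto _ hφv).exists_norm_le
    exact ⟨C, fun k => hC _ (mem_range_self k)⟩
  have hb : ∀ j, ‖H10.ofTest (χ (m j) j)‖ ≤ 2 * C + 2 * C := by
    intro j
    refine le_trans ?_ (add_le_add (mul_le_mul_of_nonneg_left (hC (m j)) zero_le_two)
      (mul_le_mul_of_nonneg_left (hC j) zero_le_two))
    simp only [H10.norm_eq]
    refine norm_Lp_le_add_of_ae_le zero_le_two zero_le_two ?_
    filter_upwards [H10.grad_ofTest (χ (m j) j), H10.grad_ofTest (φ (m j)),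
      H10.grad_ofTest (φ j)] with x e1 e2 e3
    rw [e1, e2, e3]
    exact hχg _ _ x
  have hconv : Tendsto (fun j => H10.fn (H10.ofTest (χ (m j) j))) atTop (𝓝 (H10.fn v)) := by
    let one : L2 Ω := (memLp_const (1 : ℝ)).toLp _
    have hfv := (H10.fn.continuous.tendsto _).comp hφv
    have hd : Tendsto (fun j => 2 * ‖H10.fn (H10.ofTest (φ (m j))) - H10.fn (H10.ofTest (φ j))‖ +
        √(1 / ((j : ℝ) + 1)) * ‖one‖) atTop (𝓝 0) := by
      have h1 := (((hfv.comp hmt).sub hfv).norm.const_mul 2).add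
        ((tendsto_one_div_add_atTop_nhds_zero_nat (𝕜 := ℝ)).sqrt.mul_const ‖one‖)
      simpa using h1
    have hd2 : Tendsto (fun j => H10.fn (H10.ofTest (χ (m j) j)) - H10.fn (H10.ofTest (φ j)))
        atTop (𝓝 0) := by
      refine squeeze_zero_norm (fun j => ?_) hd
      refine norm_Lp_le_add_of_ae_le zero_le_two (Real.sqrt_nonneg _) ?_
      filter_upwards [Lp.coeFn_sub (H10.fn (H10.ofTest (χ (m j) j))) (H10.fn (H10.ofTest (φ j))),
        Lp.coeFn_sub (H10.fn (H10.ofTest (φ (m j)))) (H10.fn (H10.ofTest (φ j))),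
        H10.fn_ofTest (χ (m j) j), H10.fn_ofTest (φ (m j)), H10.fn_ofTest (φ j),
        (memLp_const (μ := Ω.vol) (p := 2) (1 : ℝ)).coeFn_toLp] with x e1 e2 e3 e4 e5 e6
      rw [e1, e2, Pi.sub_apply, Pi.sub_apply, e3, e4, e5, e6, hχ]
      simpa using abs_signedMin_sub_le (hpos j) (φ (m j) x) (φ j x)
    simpa using hd2.add hfv
  have h1 := tendsto_apply_of_bounded H10.fn_injective hb hconv ℓ
  have h2 : Tendsto (fun j : ℕ => -(1 / ((j : ℝ) + 1))) atTop (𝓝 0) := by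
    simpa using (tendsto_one_div_add_atTop_nhds_zero_nat (𝕜 := ℝ)).neg
  exact le_of_tendsto_of_tendsto' h2 h1 hm

end BrezisBrowder

end SemilinearParabolic

namespace SemilinearParabolic

/-! ### Rellich's theorem -/

section Rellich

/-- The Cauchy–Schwarz inequality for the integral of `f` against the constant `1`. -/
theorem enorm_integral_sq_le {α E : Type*} [MeasurableSpace α] [NormedAddCommGroup E]
    [NormedSpace ℝ E] {μ : Measure α} {f : α → E} (hf : AEStronglyMeasurable f μ) :
    ‖∫ x, f x ∂μ‖ₑ ^ 2 ≤ μ univ * ∫⁻ x, ‖f x‖ₑ ^ 2 ∂μ := by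
  have h1 := ENNReal.lintegral_mul_le_Lp_mul_Lq μ (p := 2) (q := 2)
    Real.HolderConjugate.two_two (f := fun _ => 1) (g := fun x => ‖f x‖ₑ)
    aemeasurable_const hf.enorm
  simp only [Pi.mul_apply, one_mul, lintegral_const, ENNReal.rpow_ofNat] at h1
  have h2 := pow_le_pow_left' ((enorm_integral_le_lintegral_enorm f).trans h1) 2
  refine h2.trans_eq ?_
  have h3 : ∀ a : ℝ≥0∞, (a ^ (1 / 2 : ℝ)) ^ 2 = a := fun a => by
    rw [← ENNReal.rpow_natCast, ← ENNReal.rpow_mul]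
    norm_num
  rw [mul_pow, h3, h3, one_pow, one_mul]

variable {n : ℕ} {Ω : BoundedDomain n}

/-- `‖φ(· + h) - φ‖ ≤ |h| ‖∇φ‖` in `L²(ℝⁿ)`: test functions of `Ω` are defined on all of `ℝⁿ`, so that
the segment from `x` to `x + h` may leave `Ω`. -/
theorem lintegral_translate_sub_le (φ : Ω.Test) (h : Sp n) :
    ∫⁻ x, ‖φ (x + h) - φ x‖ₑ ^ 2 ≤ ‖h‖ₑ ^ 2 * ∫⁻ x, ‖gradient φ x‖ₑ ^ 2 := by
  have hg := test_gradient_continuous φ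
  have h1 : ∀ x, ‖φ (x + h) - φ x‖ₑ ^ 2 ≤
      ∫⁻ s in Ioc (0 : ℝ) 1, ‖h‖ₑ ^ 2 * ‖gradient φ (x + s • h)‖ₑ ^ 2 := by
    intro x
    have hc : Continuous fun s : ℝ => inner ℝ (gradient φ (x + s • h)) h := by fun_prop
    have h2 : φ (x + h) - φ x = ∫ s in (0 : ℝ)..1, inner ℝ (gradient φ (x + s • h)) h := by
      rw [intervalIntegral.integral_eq_sub_of_hasDerivAt (f := fun s : ℝ => φ (x + s • h))
        (fun s _ => ?_) (hc.intervalIntegrable _ _)]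
      · simp
      · have h3 : HasDerivAt (fun s : ℝ => x + s • h) h s := by
          simpa using ((hasDerivAt_id s).smul_const h).const_add x
        have h4 := (test_differentiable φ (x + s • h)).hasFDerivAt.comp_hasDerivAt s h3
        have h5 : inner ℝ (gradient φ (x + s • h)) h = fderiv ℝ φ (x + s • h) h := by
          simp [gradient]
        rw [h5]
        exact h4
    rw [h2, intervalIntegral.integral_of_le zero_le_one]
    refine (enorm_integral_sq_le hc.aestronglyMeasurable).trans ?_
    rw [Measure.restrict_apply_univ, Real.volume_Ioc, sub_zero, ENNReal.ofReal_one, one_mul]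
    refine lintegral_mono fun s => ?_
    rw [← mul_pow]
    refine pow_le_pow_left' ?_ 2
    rw [mul_comm]
    rw [← ofReal_norm, ← ofReal_norm, ← ofReal_norm, ← ENNReal.ofReal_mul (norm_nonneg _)]
    exact ENNReal.ofReal_le_ofReal (norm_inner_le_norm _ _)
  refine (lintegral_mono h1).trans ?_
  rw [lintegral_lintegral_swap (by
    refine Measurable.aemeasurable ?_
    refine Measurable.const_mul ?_ _
    refine Measurable.pow_const ?_ 2
    exact (Continuous.enorm (by fun_prop)).measurable)]
  have h3 : ∀ s : ℝ, ∫⁻ x, ‖h‖ₑ ^ 2 * ‖gradient φ (x + s • h)‖ₑ ^ 2 =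
      ‖h‖ₑ ^ 2 * ∫⁻ x, ‖gradient φ x‖ₑ ^ 2 := by
    intro s
    rw [lintegral_const_mul' _ _ (by simp), lintegral_add_right_eq_self
      (fun x => ‖gradient φ x‖ₑ ^ 2)]
  simp only [h3, lintegral_const, Measure.restrict_apply_univ, Real.volume_Ioc, sub_zero,
    ENNReal.ofReal_one, mul_one, le_refl]

/-- The cells of the cubic lattice of mesh size `δ`. -/
def cell (δ : ℝ) (m : Fin n → ℤ) : Set (Sp n) := {x | ∀ i, ⌊x i / δ⌋ = m i}

variable {δ : ℝ}

theorem mem_cell_floor (x : Sp n) : x ∈ cell δ (fun i => ⌊x i / δ⌋) := fun _ => rfl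

theorem eq_floor_of_mem_cell {x : Sp n} {m : Fin n → ℤ} (h : x ∈ cell δ m) :
    m = fun i => ⌊x i / δ⌋ := funext fun i => (h i).symm

theorem cell_eq (hδ : 0 < δ) (m : Fin n → ℤ) : cell δ m =
    (MeasurableEquiv.toLp 2 (Fin n → ℝ)).symm ⁻¹'
      (univ.pi fun i => Ico (m i * δ) (m i * δ + δ)) := by
  ext x
  simp only [cell, mem_ofPred_eq, mem_preimage, mem_univ_pi, mem_Ico]
  refine forall_congr' fun i => ?_
  rw [Int.floor_eq_iff, le_div_iff₀ hδ, div_lt_iff₀ hδ, add_mul, one_mul]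
  rfl

theorem measurableSet_cell (hδ : 0 < δ) (m : Fin n → ℤ) : MeasurableSet (cell δ m) := by
  rw [cell_eq hδ]
  exact (MeasurableEquiv.measurable _) (MeasurableSet.univ_pi fun i => measurableSet_Ico)

theorem volume_cell (hδ : 0 < δ) (m : Fin n → ℤ) : volume (cell δ m) = ENNReal.ofReal (δ ^ n) := by
  rw [cell_eq hδ, (EuclideanSpace.volume_preserving_symm_measurableEquiv_toLp
    (Fin n)).measure_preimage (MeasurableSet.univ_pi fun i =>
      measurableSet_Ico).nullMeasurableSet, Real.volume_pi_Ico]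
  simp [ENNReal.ofReal_pow hδ.le]

theorem dist_le_of_mem_cell (hδ : 0 < δ) {m : Fin n → ℤ} {x y : Sp n} (hx : x ∈ cell δ m)
    (hy : y ∈ cell δ m) : dist y x ≤ n * δ := by
  rw [EuclideanSpace.dist_eq]
  have h1 : ∀ i, dist (y i) (x i) ^ 2 ≤ δ ^ 2 := by
    intro i
    rw [cell_eq hδ] at hx hy
    have h2 := hx i trivial
    have h3 := hy i trivial
    change _ ≤ x i ∧ x i < _ at h2
    change _ ≤ y i ∧ y i < _ at h3
    rw [Real.dist_eq, sq_abs]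
    exact sq_le_sq' (by linarith [h2.2, h3.1]) (by linarith [h2.1, h3.2])
  refine Real.sqrt_le_iff.2 ⟨by positivity, ?_⟩
  refine (Finset.sum_le_sum fun i _ => h1 i).trans ?_
  simp only [Finset.sum_const, Finset.card_univ, Fintype.card_fin, nsmul_eq_mul, mul_pow]
  refine mul_le_mul_of_nonneg_right ?_ (sq_nonneg _)
  exact_mod_cast Nat.le_self_pow two_ne_zero n

/-- The distance between a function and its mean values over the cells of mesh size `δ` is at most
a multiple of `δ` times the norm of the gradient: by Jensen's inequality it is controlled by
differences of the function at points at a distance of at most `n δ`. -/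
theorem lintegral_sub_average_le (hδ : 0 < δ) (φ : Ω.Test) :
    ∫⁻ x, ‖φ x - (δ ^ n)⁻¹ * ∫ y in cell δ (fun i => ⌊x i / δ⌋), φ y‖ₑ ^ 2 ≤
      ENNReal.ofReal (n ^ (n + 2) * δ ^ 2) * volume (Metric.ball (0 : Sp n) 1) *
        ∫⁻ x, ‖gradient φ x‖ₑ ^ 2 := by
  have hφ := φ.continuous
  have hκ : 0 < δ ^ n := by positivity
  set κ := δ ^ n with hκdef
  set r : ℝ := n * δ with hr
  have hφi : Integrable φ := hφ.integrable_of_hasCompactSupport φ.hasCompactSupport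
  have h1 : ∀ x, ‖φ x - κ⁻¹ * ∫ y in cell δ (fun i => ⌊x i / δ⌋), φ y‖ₑ ^ 2 ≤
      ENNReal.ofReal κ⁻¹ * ∫⁻ h in Metric.closedBall (0 : Sp n) r, ‖φ (x + h) - φ x‖ₑ ^ 2 := by
    intro x
    set Q := cell δ (fun i => ⌊x i / δ⌋)
    have hvQ : volume Q = ENNReal.ofReal κ := volume_cell hδ _
    have hfin : volume Q ≠ ⊤ := by rw [hvQ]; simp
    have h2 : φ x - κ⁻¹ * ∫ y in Q, φ y = κ⁻¹ * ∫ y in Q, (φ x - φ y) := by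
      rw [integral_sub (f := fun _ => φ x) (integrableOn_const hfin) hφi.integrableOn,
        setIntegral_const, Measure.real, hvQ, ENNReal.toReal_ofReal hκ.le, smul_eq_mul, mul_sub]
      field_simp
    have h3 : ∫⁻ y in Q, ‖φ x - φ y‖ₑ ^ 2 ≤
        ∫⁻ h in Metric.closedBall (0 : Sp n) r, ‖φ (x + h) - φ x‖ₑ ^ 2 := by
      have h4 : Q ⊆ Metric.closedBall x r := fun y hy =>
        dist_le_of_mem_cell hδ (mem_cell_floor x) hy
      refine (lintegral_mono_set h4).trans_eq ?_
      rw [← lintegral_indicator Metric.isClosed_closedBall.measurableSet,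
        ← lintegral_indicator Metric.isClosed_closedBall.measurableSet,
        ← lintegral_add_left_eq_self ((Metric.closedBall x r).indicator _) x]
      refine lintegral_congr fun h => ?_
      classical
      simp only [indicator_apply, Metric.mem_closedBall, dist_self_add_left, dist_zero_right]
      congr 2
      rw [← enorm_neg, neg_sub]
    rw [h2, enorm_mul, mul_pow]
    refine (mul_le_mul_right ((enorm_integral_sq_le (by fun_prop)).trans
      (mul_le_mul_right h3 _)) _).trans_eq ?_
    rw [Measure.restrict_apply_univ, hvQ, ← mul_assoc, Real.enorm_of_nonneg (by positivity),
      ← ENNReal.ofReal_pow (by positivity), ← ENNReal.ofReal_mul (by positivity)]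
    congr 2
    field_simp
  refine (lintegral_mono h1).trans ?_
  rw [lintegral_const_mul' _ _ (by simp), lintegral_lintegral_swap (by
    refine Measurable.aemeasurable ?_
    refine Measurable.pow_const ?_ 2
    exact (Continuous.enorm (by fun_prop)).measurable)]
  have h5 : ∫⁻ h in Metric.closedBall (0 : Sp n) r, ∫⁻ x, ‖φ (x + h) - φ x‖ₑ ^ 2 ≤
      ∫⁻ h in Metric.closedBall (0 : Sp n) r,
        ENNReal.ofReal (r ^ 2) * ∫⁻ x, ‖gradient φ x‖ₑ ^ 2 := by
    refine setLIntegral_mono' Metric.isClosed_closedBall.measurableSet fun h hh => ?_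
    refine (lintegral_translate_sub_le φ h).trans ?_
    refine mul_le_mul_left ?_ _
    rw [ENNReal.ofReal_pow (by positivity), ← ofReal_norm]
    refine pow_le_pow_left' (ENNReal.ofReal_le_ofReal ?_) 2
    simpa using hh
  refine (mul_le_mul_right h5 _).trans_eq ?_
  rw [lintegral_const, Measure.restrict_apply_univ, Measure.addHaar_closedBall _ _ (by positivity),
    finrank_euclideanSpace, Fintype.card_fin]
  have h6 : ENNReal.ofReal (n ^ (n + 2) * δ ^ 2) =
      ENNReal.ofReal κ⁻¹ * ENNReal.ofReal (r ^ 2) * ENNReal.ofReal (r ^ n) := by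
    rw [← ENNReal.ofReal_mul (by positivity), ← ENNReal.ofReal_mul (by positivity)]
    congr 1
    rw [hr, hκdef]
    field_simp
    ring
  rw [h6]
  ring

theorem norm_Lp_sq_eq_lintegral {E : Type*} [NormedAddCommGroup E] {α : Type*} [MeasurableSpace α]
    {μ : Measure α} (f : Lp E 2 μ) : ENNReal.ofReal (‖f‖ ^ 2) = ∫⁻ x, ‖f x‖ₑ ^ 2 ∂μ := by
  rw [norm_Lp_two_sq, ofReal_integral_eq_lintegral_ofReal
    (memLp_two_norm_sq_integrable (Lp.memLp f)) (Eventually.of_forall fun x => by positivity)]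
  refine lintegral_congr fun x => ?_
  rw [ENNReal.ofReal_pow (norm_nonneg _), ofReal_norm]

/-- The embedding of `H₀¹(Ω)` into `L²(Ω)` is a norm limit of operators of finite rank, namely of the
mean values over the cells of a lattice. -/
theorem exists_finite_rank_cells (Ω : BoundedDomain n) {ε : ℝ} (hε : 0 < ε) :
    ∃ (S : Finset (Fin n → ℤ)) (c : ℝ) (e : (Fin n → ℤ) → L2 Ω), ∀ v : H10 Ω,
      ‖H10.fn v - ∑ m ∈ S, (c * inner ℝ (e m) (H10.fn v)) • e m‖ ≤ ε * ‖v‖ := by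
  have hfin := isFiniteMeasure_vol Ω
  set K : ℝ := n ^ (n + 2) * (volume (Metric.ball (0 : Sp n) 1)).toReal with hK
  have hK0 : 0 ≤ K := by positivity
  -- the mesh size, chosen such that the error bound `√K δ ‖∇v‖` is at most `ε ‖∇v‖`
  set δ : ℝ := ε / (√K + 1) with hδdef
  have hδ : 0 < δ := by positivity
  have hδK : K * δ ^ 2 ≤ ε ^ 2 := by
    rw [hδdef, div_pow, ← mul_div_assoc, div_le_iff₀ (by positivity), mul_comm]
    refine mul_le_mul_of_nonneg_left ?_ (sq_nonneg _)
    nlinarith [Real.sq_sqrt hK0, Real.sqrt_nonneg K]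
  obtain ⟨R, hR0, hR⟩ := Ω.bounded.exists_pos_norm_le
  -- the cells that meet `Ω`
  let S : Finset (Fin n → ℤ) := Fintype.piFinset fun _ => Finset.Icc ⌊-R / δ⌋ ⌊R / δ⌋
  let e : (Fin n → ℤ) → L2 Ω := fun m =>
    indicatorConstLp 2 (measurableSet_cell hδ m) (measure_ne_top Ω.vol _) 1
  have hS : ∀ x ∈ (Ω.carrier : Set (Sp n)), (fun i => ⌊x i / δ⌋) ∈ S := by
    intro x hx
    rw [Fintype.mem_piFinset]
    intro i
    have h1 := abs_le.1 ((PiLp.norm_apply_le x i).trans (hR x hx))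
    rw [Finset.mem_Icc]
    exact ⟨Int.floor_le_floor (by gcongr; exact h1.1), Int.floor_le_floor (by gcongr; exact h1.2)⟩
  refine ⟨S, (δ ^ n)⁻¹, e, fun v => ?_⟩
  have hcl : IsClosed {v : H10 Ω | ‖H10.fn v - ∑ m ∈ S, ((δ ^ n)⁻¹ *
      inner ℝ (e m) (H10.fn v)) • e m‖ ≤ ε * ‖v‖} :=
    isClosed_le (by fun_prop) (by fun_prop)
  -- both sides are continuous in `v`, so that `v` may be assumed to be a test function
  refine hcl.closure_subset_iff.2 ?_ (H10.denseRange_ofTest v)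
  rintro _ ⟨φ, rfl⟩
  rw [mem_ofPred_eq]
  set p := H10.fn (H10.ofTest φ) with hp
  have hin : ∀ m, inner ℝ (e m) p = ∫ y in cell δ m, φ y := by
    intro m
    rw [L2.inner_indicatorConstLp_one, ← setIntegral_eq_integral_of_forall_compl_eq_zero
      (s := (Ω.carrier : Set (Sp n))) (μ := volume.restrict (cell δ m))
      (fun x hx => test_eq_zero_of_notMem φ hx), Measure.restrict_comm
        Ω.carrier.isOpen.measurableSet]
    exact integral_congr_ae (ae_restrict_of_ae (H10.fn_ofTest φ))
  have hsum : ∀ T : Finset (Fin n → ℤ), ⇑(∑ m ∈ T, ((δ ^ n)⁻¹ * inner ℝ (e m) p) • e m) =ᵐ[Ω.vol]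
      fun x => ∑ m ∈ T, ((δ ^ n)⁻¹ * ∫ y in cell δ m, φ y) * (cell δ m).indicator 1 x := by
    intro T
    have h1 : ∀ m, ⇑(((δ ^ n)⁻¹ * inner ℝ (e m) p) • e m) =ᵐ[Ω.vol]
        fun x => ((δ ^ n)⁻¹ * ∫ y in cell δ m, φ y) * (cell δ m).indicator 1 x := by
      intro m
      filter_upwards [Lp.coeFn_smul ((δ ^ n)⁻¹ * inner ℝ (e m) p) (e m),
        indicatorConstLp_coeFn (p := 2) (hs := measurableSet_cell hδ m)
          (hμs := measure_ne_top Ω.vol _) (c := (1 : ℝ))] with x e1 e2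
      rw [e1, Pi.smul_apply, e2, hin, smul_eq_mul]
      rfl
    filter_upwards [Lp.coeFn_finsetSum T fun m => ((δ ^ n)⁻¹ * inner ℝ (e m) p) • e m,
      ae_all_iff.2 h1] with x e1 e2
    rw [e1, Finset.sum_apply]
    exact Finset.sum_congr rfl fun m _ => e2 m
  refine abs_le_of_sq_le_sq' ?_ (by positivity) |>.2
  rw [← ENNReal.ofReal_le_ofReal_iff (by positivity), norm_Lp_sq_eq_lintegral, mul_pow,
    H10.norm_eq, ENNReal.ofReal_mul (by positivity), norm_Lp_sq_eq_lintegral]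
  have h1 : ∫⁻ x, ‖(p - ∑ m ∈ S, ((δ ^ n)⁻¹ * inner ℝ (e m) p) • e m : L2 Ω) x‖ₑ ^ 2 ∂Ω.vol =
      ∫⁻ x, ‖φ x - (δ ^ n)⁻¹ * ∫ y in cell δ (fun i => ⌊x i / δ⌋), φ y‖ₑ ^ 2 ∂Ω.vol := by
    refine lintegral_congr_ae ?_
    filter_upwards [hsum S, Lp.coeFn_sub p (∑ m ∈ S, ((δ ^ n)⁻¹ * inner ℝ (e m) p) • e m),
      H10.fn_ofTest φ, ae_restrict_mem Ω.carrier.isOpen.measurableSet] with x e1 e2 e3 e4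
    rw [e2, Pi.sub_apply, e1, e3, Finset.sum_eq_single_of_mem _ (hS x e4) fun m _ hm => ?_]
    · rw [indicator_of_mem (mem_cell_floor x)]
      simp
    · rw [indicator_of_notMem fun h => hm (eq_floor_of_mem_cell h), mul_zero]
  have h2 : ∫⁻ x, ‖H10.grad (H10.ofTest φ) x‖ₑ ^ 2 ∂Ω.vol = ∫⁻ x, ‖gradient φ x‖ₑ ^ 2 := by
    have h3 : ∫⁻ x, ‖H10.grad (H10.ofTest φ) x‖ₑ ^ 2 ∂Ω.vol =
        ∫⁻ x, ‖gradient φ x‖ₑ ^ 2 ∂Ω.vol := by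
      refine lintegral_congr_ae ?_
      filter_upwards [H10.grad_ofTest φ] with x hx
      rw [hx]
    rw [h3]
    refine setLIntegral_eq_of_support_subset ?_
    intro x hx
    by_contra hxΩ
    refine hx ?_
    have : x ∉ tsupport (fderiv ℝ φ) := fun h =>
      hxΩ (φ.tsupport_subset (tsupport_fderiv_subset ℝ h))
    simp [gradient, image_eq_zero_of_notMem_tsupport this]
  rw [h1, h2]
  refine (lintegral_mono' Measure.restrict_le_self le_rfl).trans
    ((lintegral_sub_average_le hδ φ).trans (mul_le_mul_left ?_ _))
  rw [← ENNReal.ofReal_toReal (measure_ball_lt_top (μ := (volume : Measure (Sp n)))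
    (x := 0) (r := 1)).ne, ← ENNReal.ofReal_mul (by positivity)]
  refine ENNReal.ofReal_le_ofReal ?_
  rw [hK] at hδK
  linarith

/-- **Rellich's theorem**: the embedding of `H₀¹(Ω)` into `L²(Ω)` is a norm limit of operators of
finite rank, which may be chosen of the form `v ↦ ∑ ⟨p_m, v⟩ g_m` with `p_m ∈ H₀¹(Ω)`. -/
theorem exists_finite_rank (Ω : BoundedDomain n) {ε : ℝ} (hε : 0 < ε) :
    ∃ (S : Finset (Fin n → ℤ)) (p : (Fin n → ℤ) → H10 Ω) (g : (Fin n → ℤ) → L2 Ω), ∀ v : H10 Ω,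
      ‖H10.fn v - ∑ m ∈ S, inner ℝ (H10.fn (p m)) (H10.fn v) • g m‖ ≤ ε * ‖v‖ := by
  obtain ⟨S, c, e, he⟩ := exists_finite_rank_cells Ω (half_pos hε)
  set R := ‖H10.fn (Ω := Ω)‖
  set N := |c| * R * ∑ m ∈ S, ‖e m‖ with hN
  have hN0 : 0 ≤ N := by positivity
  have hη : 0 < ε / (2 * (N + 1)) := by positivity
  -- the indicator functions of the cells are approximated by elements of `H₀¹(Ω)`
  have hp : ∀ m, ∃ p : H10 Ω, ‖e m - H10.fn p‖ < ε / (2 * (N + 1)) := fun m => by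
    obtain ⟨p, hp⟩ := H10.denseRange_fn.exists_dist_lt (e m) hη
    exact ⟨p, by rwa [← dist_eq_norm]⟩
  choose p hp using hp
  refine ⟨S, p, fun m => c • e m, fun v => ?_⟩
  have h1 : H10.fn v - ∑ m ∈ S, inner ℝ (H10.fn (p m)) (H10.fn v) • c • e m =
      (H10.fn v - ∑ m ∈ S, (c * inner ℝ (e m) (H10.fn v)) • e m) +
        ∑ m ∈ S, (c * inner ℝ (e m - H10.fn (p m)) (H10.fn v)) • e m := by
    have : ∀ m, (c * inner ℝ (e m - H10.fn (p m)) (H10.fn v)) • e m =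
        (c * inner ℝ (e m) (H10.fn v)) • e m - inner ℝ (H10.fn (p m)) (H10.fn v) • c • e m := by
      intro m
      rw [inner_sub_left, mul_sub, sub_smul, smul_smul, mul_comm c (inner ℝ (H10.fn (p m)) _)]
    rw [Finset.sum_congr rfl fun m _ => this m, Finset.sum_sub_distrib]
    abel
  have h2 : ‖∑ m ∈ S, (c * inner ℝ (e m - H10.fn (p m)) (H10.fn v)) • e m‖ ≤
      ∑ m ∈ S, |c| * (ε / (2 * (N + 1)) * (R * ‖v‖)) * ‖e m‖ := by
    refine norm_sum_le_of_le _ fun m _ => ?_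
    rw [norm_smul, norm_mul, Real.norm_eq_abs c]
    have h3 := norm_inner_le_norm (𝕜 := ℝ) (e m - H10.fn (p m)) (H10.fn v)
    have h4 := H10.fn.le_opNorm v
    have h5 := (hp m).le
    gcongr
    exact h3.trans (mul_le_mul h5 h4 (norm_nonneg _) hη.le)
  have h3 : ∑ m ∈ S, |c| * (ε / (2 * (N + 1)) * (R * ‖v‖)) * ‖e m‖ =
      N / (N + 1) * (ε / 2 * ‖v‖) := by
    rw [← Finset.mul_sum, hN]
    field_simp
  have h4 : N / (N + 1) * (ε / 2 * ‖v‖) ≤ ε / 2 * ‖v‖ := by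
    refine mul_le_of_le_one_left (by positivity) ?_
    rw [div_le_one (by positivity)]
    linarith
  rw [h1]
  refine (norm_add_le _ _).trans ?_
  linarith [he v]

end Rellich

end SemilinearParabolic

namespace SemilinearParabolic

/-! ### `L²(X × Y)` as `L²(Y; L²(X))` -/

section Slices

variable {X Y : Type*} [MeasurableSpace X] [MeasurableSpace Y] {μ : Measure X} {ν : Measure Y}

theorem ae_ae_of_ae_prod_swap [SFinite μ] [SFinite ν] {p : X × Y → Prop}
    (h : ∀ᵐ z ∂μ.prod ν, p z) : ∀ᵐ t ∂ν, ∀ᵐ x ∂μ, p (x, t) :=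
  Measure.ae_ae_of_ae_prod
    ((Measure.measurePreserving_swap (μ := ν) (ν := μ)).quasiMeasurePreserving.ae h)

/-- `U : Y → L²(X)` is the function `u` on `X × Y`, seen as a function of the second variable. -/
def IsSlice (u : Lp ℝ 2 (μ.prod ν)) (U : Lp (Lp ℝ 2 μ) 2 ν) : Prop :=
  ∀ᵐ t ∂ν, ⇑(U t) =ᵐ[μ] fun x => u (x, t)

variable [SFinite μ] [SFinite ν] {u u' : Lp ℝ 2 (μ.prod ν)} {U U' : Lp (Lp ℝ 2 μ) 2 ν}

theorem IsSlice.norm_eq (h : IsSlice u U) : ‖U‖ = ‖u‖ := by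
  have h1 : ENNReal.ofReal (‖U‖ ^ 2) = ENNReal.ofReal (‖u‖ ^ 2) := by
    rw [norm_Lp_sq_eq_lintegral, norm_Lp_sq_eq_lintegral, lintegral_prod_symm _
      ((Lp.aestronglyMeasurable u).enorm.pow_const 2)]
    refine lintegral_congr_ae ?_
    filter_upwards [h] with t ht
    rw [← ofReal_norm, ← ENNReal.ofReal_pow (norm_nonneg _), norm_Lp_sq_eq_lintegral]
    refine lintegral_congr_ae ?_
    filter_upwards [ht] with x hx
    rw [hx]
  rw [ENNReal.ofReal_eq_ofReal_iff (by positivity) (by positivity)] at h1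
  exact (sq_eq_sq₀ (norm_nonneg _) (norm_nonneg _)).1 h1

theorem IsSlice.add (h : IsSlice u U) (h' : IsSlice u' U') : IsSlice (u + u') (U + U') := by
  filter_upwards [h, h', Lp.coeFn_add U U', ae_ae_of_ae_prod_swap (Lp.coeFn_add u u')]
    with t h1 h2 h3 h4
  rw [h3, Pi.add_apply]
  filter_upwards [h1, h2, h4, Lp.coeFn_add (U t) (U' t)] with x e1 e2 e3 e4
  rw [e4, e3, Pi.add_apply, Pi.add_apply, e1, e2]

theorem IsSlice.smul (h : IsSlice u U) (c : ℝ) : IsSlice (c • u) (c • U) := by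
  filter_upwards [h, Lp.coeFn_smul c U, ae_ae_of_ae_prod_swap (Lp.coeFn_smul c u)]
    with t h1 h3 h4
  rw [h3, Pi.smul_apply]
  filter_upwards [h1, h4, Lp.coeFn_smul c (U t)] with x e1 e3 e4
  rw [e4, e3, Pi.smul_apply, Pi.smul_apply, e1]

theorem IsSlice.sub (h : IsSlice u U) (h' : IsSlice u' U') : IsSlice (u - u') (U - U') := by
  simpa [sub_eq_add_neg] using h.add (h'.smul (-1))

theorem IsSlice.of_tendsto {u : ℕ → Lp ℝ 2 (μ.prod ν)} {U : ℕ → Lp (Lp ℝ 2 μ) 2 ν}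
    (h : ∀ k, IsSlice (u k) (U k)) {u₀ : Lp ℝ 2 (μ.prod ν)} {U₀ : Lp (Lp ℝ 2 μ) 2 ν}
    (hu : Tendsto u atTop (𝓝 u₀)) (hU : Tendsto U atTop (𝓝 U₀)) : IsSlice u₀ U₀ := by
  obtain ⟨ms, hms, hae⟩ := exists_subseq_ae hu
  obtain ⟨ns, hns, hae'⟩ := exists_subseq_ae (hU.comp hms.tendsto_atTop)
  filter_upwards [ae_all_iff.2 h, ae_ae_of_ae_prod_swap hae, hae'] with t h1 h2 h3
  obtain ⟨qs, hqs, h4⟩ := exists_subseq_ae h3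
  filter_upwards [ae_all_iff.2 h1, h2, h4] with x e1 e2 e3
  refine tendsto_nhds_unique e3 ?_
  refine (e2.comp (hns.tendsto_atTop.comp hqs.tendsto_atTop)).congr fun k => ?_
  exact (e1 _).symm

theorem IsSlice.right_unique (h : IsSlice u U) (h' : IsSlice u U') : U = U' := by
  have h1 := (h.sub h').norm_eq
  rw [sub_self, norm_zero, norm_eq_zero, sub_eq_zero] at h1
  exact h1

/-- Every element of `L²(Y; L²(X))` is a function on `X × Y`: this holds for indicator functions
with values in `L²(X)`, is stable under sums, and passes to limits since taking slices is
isometric. -/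
theorem exists_left_of_isSlice (U : Lp (Lp ℝ 2 μ) 2 ν) :
    ∃ u : Lp ℝ 2 (μ.prod ν), IsSlice u U := by
  refine Lp.induction (by norm_num) (fun U : Lp (Lp ℝ 2 μ) 2 ν => ∃ u, IsSlice u U) ?_ ?_ ?_ U
  · intro h s hs hνs
    have hmem : MemLp (fun z : X × Y => s.indicator (1 : Y → ℝ) z.2 * h z.1) 2 (μ.prod ν) := by
      have hm : AEStronglyMeasurable (fun z : X × Y => s.indicator (1 : Y → ℝ) z.2 * h z.1)
          (μ.prod ν) :=
        ((stronglyMeasurable_one.indicator hs).aestronglyMeasurable.comp_snd).mul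
          (Lp.aestronglyMeasurable h).comp_fst
      refine ⟨hm, ?_⟩
      rw [eLpNorm_lt_top_iff_lintegral_rpow_enorm_lt_top (by norm_num) (by norm_num)]
      simp only [ENNReal.toReal_ofNat, ENNReal.rpow_ofNat]
      rw [lintegral_prod_symm _ (hm.enorm.pow_const 2)]
      have e : ∀ t, ∫⁻ x, ‖s.indicator (1 : Y → ℝ) t * h x‖ₑ ^ 2 ∂μ =
          s.indicator (fun _ => ∫⁻ x, ‖h x‖ₑ ^ 2 ∂μ) t := by
        intro t
        by_cases ht : t ∈ s <;> simp [ht]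
      simp only [e]
      rw [lintegral_indicator hs, setLIntegral_const, ← norm_Lp_sq_eq_lintegral]
      exact ENNReal.mul_lt_top ENNReal.ofReal_lt_top hνs
    refine ⟨hmem.toLp _, ?_⟩
    have h2 : ⇑(Lp.simpleFunc.indicatorConst 2 hs hνs.ne h : Lp (Lp ℝ 2 μ) 2 ν) =ᵐ[ν]
        s.indicator fun _ => h := by
      rw [Lp.simpleFunc.coe_indicatorConst]
      exact indicatorConstLp_coeFn
    filter_upwards [h2, ae_ae_of_ae_prod_swap hmem.coeFn_toLp] with t e1 e2
    rw [e1]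
    by_cases ht : t ∈ s
    · filter_upwards [e2] with x e3
      rw [e3]
      simp [ht]
    · filter_upwards [e2, Lp.coeFn_zero ℝ 2 μ] with x e3 e4
      rw [e3]
      rw [indicator_of_notMem ht, indicator_of_notMem ht, zero_mul, e4, Pi.zero_apply]
  · rintro f g hf hg - ⟨u, hu⟩ ⟨u', hu'⟩
    exact ⟨u + u', hu.add hu'⟩
  · refine isClosed_of_closure_subset fun U hU => ?_
    obtain ⟨V, hV, hVU⟩ := mem_closure_iff_seq_limit.1 hU
    choose u hu using hV
    have hc : CauchySeq u := by
      refine Metric.cauchySeq_iff.2 fun ε hε => ?_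
      obtain ⟨N, hN⟩ := Metric.cauchySeq_iff.1 hVU.cauchySeq ε hε
      refine ⟨N, fun k hk m hm => ?_⟩
      rw [dist_eq_norm, ← ((hu k).sub (hu m)).norm_eq, ← dist_eq_norm]
      exact hN k hk m hm
    obtain ⟨u₀, hu₀⟩ := cauchySeq_tendsto_of_complete hc
    exact ⟨u₀, IsSlice.of_tendsto hu hu₀ hVU⟩

theorem isClosed_setOf_exists_isSlice :
    IsClosed {u : Lp ℝ 2 (μ.prod ν) | ∃ U : Lp (Lp ℝ 2 μ) 2 ν, IsSlice u U} := by
  refine isClosed_of_closure_subset fun u hu => ?_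
  obtain ⟨w, hw, hwu⟩ := mem_closure_iff_seq_limit.1 hu
  choose U hU using hw
  have hc : CauchySeq U := by
    refine Metric.cauchySeq_iff.2 fun ε hε => ?_
    obtain ⟨N, hN⟩ := Metric.cauchySeq_iff.1 hwu.cauchySeq ε hε
    refine ⟨N, fun k hk m hm => ?_⟩
    rw [dist_eq_norm, ((hU k).sub (hU m)).norm_eq, ← dist_eq_norm]
    exact hN k hk m hm
  obtain ⟨U₀, hU₀⟩ := cauchySeq_tendsto_of_complete hc
  exact ⟨U₀, IsSlice.of_tendsto hU hwu hU₀⟩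

end Slices

section SliceEquiv

variable {X Y : Type*} [MeasurableSpace X] [PseudoMetricSpace X] [SecondCountableTopology X]
  [BorelSpace X] [MeasurableSpace Y] [PseudoMetricSpace Y] [SecondCountableTopology Y]
  [BorelSpace Y] {μ : Measure X} {ν : Measure Y} [IsFiniteMeasure μ] [IsFiniteMeasure ν]

/-- Every element of `L²(X × Y)` has slices: bounded continuous functions are dense, and
their slices depend continuously on the second variable. -/
theorem exists_right_of_isSlice (u : Lp ℝ 2 (μ.prod ν)) :
    ∃ U : Lp (Lp ℝ 2 μ) 2 ν, IsSlice u U := by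
  have hd : DenseRange (BoundedContinuousFunction.toLp (E := ℝ) 2 (μ.prod ν) ℝ) :=
    BoundedContinuousFunction.toLp_denseRange ℝ (μ.prod ν) ℝ (by norm_num)
  refine isClosed_setOf_exists_isSlice.closure_subset_iff.2 ?_ (hd u)
  rintro _ ⟨b, rfl⟩
  have hb : ∀ t, MemLp (fun x => b (x, t)) 2 μ := fun t =>
    MemLp.of_bound (by fun_prop) ‖b‖ (Eventually.of_forall fun x => b.norm_coe_le_norm _)
  have hc : Continuous fun t => (hb t).toLp (fun x => b (x, t)) := by
    rw [continuous_iff_seqContinuous]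
    intro s t hst
    refine tendsto_toLp_of_dominated (fun k => hb (s k)) (hb t) (memLp_const (2 * ‖b‖))
      (fun k => Eventually.of_forall fun x => ?_) (Eventually.of_forall fun x => ?_)
    · refine (norm_sub_le _ _).trans ?_
      linarith [b.norm_coe_le_norm (x, s k), b.norm_coe_le_norm (x, t)]
    · exact ((by fun_prop : Continuous fun t => b (x, t)).tendsto t).comp hst
  have hm : MemLp (fun t => (hb t).toLp (fun x => b (x, t))) 2 ν := by
    refine MemLp.of_bound hc.aestronglyMeasurable
      (‖(memLp_const ‖b‖ : MemLp (fun _ : X => ‖b‖) 2 μ).toLp _‖)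
      (Eventually.of_forall fun t => ?_)
    refine Lp.norm_le_norm_of_ae_le ?_
    filter_upwards [(hb t).coeFn_toLp, (memLp_const ‖b‖ : MemLp (fun _ : X => ‖b‖) 2 μ).coeFn_toLp]
      with x e1 e2
    rw [e1, e2, norm_norm]
    exact b.norm_coe_le_norm _
  refine ⟨hm.toLp _, ?_⟩
  filter_upwards [hm.coeFn_toLp, ae_ae_of_ae_prod_swap
    (BoundedContinuousFunction.coeFn_toLp (p := 2) (μ.prod ν) (𝕜 := ℝ) b)] with t e1 e2
  rw [e1]
  filter_upwards [(hb t).coeFn_toLp, e2] with x e3 e4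
  rw [e3, e4]

variable (μ ν) in
/-- The identification of `L²(X × Y)` with `L²(Y; L²(X))`. -/
noncomputable def sliceEquiv : Lp ℝ 2 (μ.prod ν) ≃ₗᵢ[ℝ] Lp (Lp ℝ 2 μ) 2 ν :=
  LinearIsometryEquiv.ofSurjective
    { toFun := fun u => (exists_right_of_isSlice u).choose
      map_add' := fun u u' => (exists_right_of_isSlice (u + u')).choose_spec.right_unique
        ((exists_right_of_isSlice u).choose_spec.add (exists_right_of_isSlice u').choose_spec)
      map_smul' := fun c u => (exists_right_of_isSlice (c • u)).choose_spec.right_unique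
        ((exists_right_of_isSlice u).choose_spec.smul c)
      norm_map' := fun u => (exists_right_of_isSlice u).choose_spec.norm_eq }
    fun U => ⟨(exists_left_of_isSlice U).choose,
      (exists_right_of_isSlice (exists_left_of_isSlice U).choose).choose_spec.right_unique
        (exists_left_of_isSlice U).choose_spec⟩

theorem isSlice_sliceEquiv (u : Lp ℝ 2 (μ.prod ν)) : IsSlice u (sliceEquiv μ ν u) :=
  (exists_right_of_isSlice u).choose_spec

theorem isSlice_sliceEquiv_symm (U : Lp (Lp ℝ 2 μ) 2 ν) :
    IsSlice ((sliceEquiv μ ν).symm U) U := by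
  simpa using isSlice_sliceEquiv ((sliceEquiv μ ν).symm U)

end SliceEquiv

end SemilinearParabolic

namespace SemilinearParabolic

/-! ### The elliptic operator -/

section EllipticOperator

variable {n : ℕ} {Ω : BoundedDomain n}

/-- Multiplication by a bounded function, as an operator on `L²(Ω)`. -/
noncomputable def mulL2 {b : Sp n → ℝ} (hb : MemLp b ∞ Ω.vol) : L2 Ω →L[ℝ] L2 Ω :=
  (ContinuousLinearMap.mul ℝ ℝ).holderL Ω.vol ∞ 2 2 (hb.toLp b)

theorem coeFn_mulL2 {b : Sp n → ℝ} (hb : MemLp b ∞ Ω.vol) (p : L2 Ω) :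
    mulL2 hb p =ᵐ[Ω.vol] fun x => b x * p x := by
  filter_upwards [(ContinuousLinearMap.mul ℝ ℝ).coeFn_holder (r := 2) (hb.toLp b) p,
    hb.coeFn_toLp] with x h1 h2
  rw [← h2]
  exact h1

/-- The weak partial derivatives of an element of `H₀¹(Ω)`. -/
noncomputable def H10.partialDeriv (i : Fin n) : H10 Ω →L[ℝ] L2 Ω :=
  ((EuclideanSpace.proj i : Sp n →L[ℝ] ℝ).compLpL 2 Ω.vol).comp H10.grad

theorem H10.coeFn_partialDeriv (i : Fin n) (v : H10 Ω) :
    H10.partialDeriv i v =ᵐ[Ω.vol] fun x => H10.grad v x i :=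
  ContinuousLinearMap.coeFn_compLpL _ _

/-- The bilinear form `(v, w) ↦ ∫ (P v) (R w)`. -/
noncomputable def pairForm (P R : H10 Ω →L[ℝ] L2 Ω) : H10 Ω →L[ℝ] Hm1 Ω :=
  ((ContinuousLinearMap.compL ℝ (H10 Ω) (L2 Ω) ℝ).flip R).comp ((innerSL ℝ).comp P)

theorem pairForm_apply (P R : H10 Ω →L[ℝ] L2 Ω) (v w : H10 Ω) :
    pairForm P R v w = inner ℝ (P v) (R w) := rfl

variable {a : Fin n → Fin n → Sp n → ℝ} {a₀ : Sp n → ℝ}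

/-- The operator `A : H₀¹(Ω) → H⁻¹(Ω)`. -/
noncomputable def IsEllipticOperator.op (hA : IsEllipticOperator Ω a a₀) : H10 Ω →L[ℝ] Hm1 Ω :=
  (∑ i, ∑ j, pairForm ((mulL2 (hA.memLp i j)).comp (H10.partialDeriv i)) (H10.partialDeriv j)) +
    pairForm ((mulL2 hA.memLp_zero).comp H10.fn) H10.fn

/-- The form `∫ (∑ a_{ij} ∂_i v ∂_j w + a₀ v w)` converges absolutely and is `⟨A v, w⟩`. -/
theorem IsEllipticOperator.integrable (hA : IsEllipticOperator Ω a a₀) (v w : H10 Ω) :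
    Integrable (fun x => (∑ i, ∑ j, a i j x * H10.grad v x i * H10.grad w x j) +
      a₀ x * H10.fn v x * H10.fn w x) Ω.vol ∧
    ∫ x, ((∑ i, ∑ j, a i j x * H10.grad v x i * H10.grad w x j) +
      a₀ x * H10.fn v x * H10.fn w x) ∂Ω.vol = hA.op v w := by
  have h1 : ∀ i j, (fun x => inner ℝ (mulL2 (hA.memLp i j) (H10.partialDeriv i v) x)
      (H10.partialDeriv j w x)) =ᵐ[Ω.vol] fun x => a i j x * H10.grad v x i * H10.grad w x j := by
    intro i j
    filter_upwards [coeFn_mulL2 (hA.memLp i j) (H10.partialDeriv i v),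
      H10.coeFn_partialDeriv i v, H10.coeFn_partialDeriv j w] with x e1 e2 e3
    rw [e1, e2, e3]
    exact mul_comm _ _
  have h2 : (fun x => inner ℝ (mulL2 hA.memLp_zero (H10.fn v) x) (H10.fn w x)) =ᵐ[Ω.vol]
      fun x => a₀ x * H10.fn v x * H10.fn w x := by
    filter_upwards [coeFn_mulL2 hA.memLp_zero (H10.fn v)] with x e1
    rw [e1]
    exact mul_comm _ _
  have i1 : ∀ i j, Integrable (fun x => a i j x * H10.grad v x i * H10.grad w x j) Ω.vol :=
    fun i j => (L2.integrable_inner _ _).congr (h1 i j)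
  have i2 : Integrable (fun x => a₀ x * H10.fn v x * H10.fn w x) Ω.vol :=
    (L2.integrable_inner _ _).congr h2
  have i3 : Integrable (fun x => ∑ i, ∑ j, a i j x * H10.grad v x i * H10.grad w x j) Ω.vol :=
    integrable_finsetSum _ fun i _ => integrable_finsetSum _ fun j _ => i1 i j
  refine ⟨i3.add i2, ?_⟩
  rw [integral_add i3 i2, integral_finsetSum _ fun i _ => integrable_finsetSum _ fun j _ => i1 i j]
  simp only [IsEllipticOperator.op, add_apply, sum_apply, pairForm_apply]
  congr 1
  · refine Finset.sum_congr rfl fun i _ => ?_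
    rw [integral_finsetSum _ fun j _ => i1 i j]
    refine Finset.sum_congr rfl fun j _ => ?_
    rw [L2.inner_def]
    exact (integral_congr_ae (h1 i j)).symm
  · rw [L2.inner_def]
    exact (integral_congr_ae h2).symm

theorem IsEllipticOperator.op_ofTest (hA : IsEllipticOperator Ω a a₀) (v : H10 Ω) (φ : Ω.Test) :
    Integrable (fun x => (∑ i, ∑ j, a i j x * H10.grad v x i * gradient φ x j) +
      a₀ x * H10.fn v x * φ x) Ω.vol ∧
    ∫ x, ((∑ i, ∑ j, a i j x * H10.grad v x i * gradient φ x j) +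
      a₀ x * H10.fn v x * φ x) ∂Ω.vol = hA.op v (H10.ofTest φ) := by
  obtain ⟨h1, h2⟩ := hA.integrable v (H10.ofTest φ)
  have h3 : (fun x => (∑ i, ∑ j, a i j x * H10.grad v x i * H10.grad (H10.ofTest φ) x j) +
      a₀ x * H10.fn v x * H10.fn (H10.ofTest φ) x) =ᵐ[Ω.vol]
      fun x => (∑ i, ∑ j, a i j x * H10.grad v x i * gradient φ x j) +
        a₀ x * H10.fn v x * φ x := by
    filter_upwards [H10.fn_ofTest φ, H10.grad_ofTest φ] with x e1 e2
    rw [e1, e2]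
  exact ⟨h1.congr h3, (integral_congr_ae h3).symm.trans h2⟩

theorem IsEllipticOperator.exists_coercive (hA : IsEllipticOperator Ω a a₀) :
    ∃ α : ℝ, 0 < α ∧ ∀ v : H10 Ω, α * ‖v‖ ^ 2 ≤ hA.op v v := by
  obtain ⟨α, hα, h⟩ := hA.elliptic
  refine ⟨α, hα, fun v => ?_⟩
  obtain ⟨h1, h2⟩ := hA.integrable v v
  rw [← h2, H10.norm_eq, norm_Lp_two_sq, ← integral_const_mul]
  refine integral_mono_ae ((memLp_two_norm_sq_integrable (Lp.memLp _)).const_mul _) h1 ?_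
  filter_upwards [h, hA.nonneg] with x e1 e2
  have e3 : 0 ≤ a₀ x * H10.fn v x * H10.fn v x := by
    rw [mul_assoc]; exact mul_nonneg e2 (mul_self_nonneg _)
  linarith [e1 (H10.grad v x)]

/-- `⟨A v, β(v)⟩ ≥ 0` for nondecreasing `β`: by the chain rule, the form is the integral of
`β'(v) ∑ a_{ij} ∂_i v ∂_j v + a₀ v β(v)`. -/
theorem IsEllipticOperator.op_compH10_nonneg (hA : IsEllipticOperator Ω a a₀) {β : ℝ → ℝ} {K : ℝ}
    (hβ : IsChainFun β K) (hβ' : ∀ s, 0 ≤ deriv β s) (v : H10 Ω) :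
    0 ≤ hA.op v (hβ.compH10 v) := by
  obtain ⟨α, hα, h⟩ := hA.elliptic
  rw [← (hA.integrable v (hβ.compH10 v)).2]
  refine integral_nonneg_of_ae ?_
  have hmono : Monotone β :=
    monotone_of_deriv_nonneg (hβ.contDiff.differentiable (by simp)) hβ'
  filter_upwards [h, hA.nonneg, hβ.grad_compH10 v, hβ.coeFn_comp (H10.fn v)] with x e1 e2 e3 e4
  rw [hβ.fn_compH10, e3, e4, Pi.zero_apply]
  have e5 : ∑ i, ∑ j, a i j x * H10.grad v x i * (deriv β (H10.fn v x) • H10.grad v x) j =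
      deriv β (H10.fn v x) * ∑ i, ∑ j, a i j x * H10.grad v x i * H10.grad v x j := by
    simp only [Finset.mul_sum, PiLp.smul_apply, smul_eq_mul]
    refine Finset.sum_congr rfl fun i _ => Finset.sum_congr rfl fun j _ => ?_
    ring
  have e6 : 0 ≤ H10.fn v x * β (H10.fn v x) := by
    rcases le_total 0 (H10.fn v x) with h0 | h0
    · exact mul_nonneg h0 (hβ.zero ▸ hmono h0)
    · exact mul_nonneg_of_nonpos_of_nonpos h0 (hβ.zero ▸ hmono h0)
  rw [e5, mul_assoc]
  exact add_nonneg (mul_nonneg (hβ' _) ((mul_nonneg hα.le (sq_nonneg _)).trans (e1 _)))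
    (mul_nonneg e2 e6)

end EllipticOperator

end SemilinearParabolic

namespace SemilinearParabolic

/-! ### Yosida approximations and convex potentials -/

section Yosida

/-- The resolvent `J = (1 + l g)⁻¹` of a nondecreasing `C¹` function `g`, and the properties of the
Yosida approximation `g ∘ J`. -/
theorem exists_resolvent {g : ℝ → ℝ} (hg : ContDiff ℝ 1 g) (hg0 : g 0 = 0)
    (hg' : ∀ s, 0 ≤ deriv g s) {l : ℝ} (hl : 0 < l) :
    ∃ J : ℝ → ℝ, (∀ s, J s + l * g (J s) = s) ∧ IsChainFun (g ∘ J) (1 / l) ∧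
      (∀ s, 0 ≤ deriv (g ∘ J) s) ∧ ∀ s, |g (J s)| ≤ |g s| := by
  have hgd : ∀ s, HasDerivAt g (deriv g s) s := fun s =>
    (hg.differentiable (by simp) s).hasDerivAt
  have hmono : Monotone g := monotone_of_deriv_nonneg (hg.differentiable (by simp)) hg'
  set E : ℝ → ℝ := fun s => s + l * g s with hE
  have hEc : Continuous E := by have := hg.continuous; fun_prop
  have hEm : StrictMono E := fun s t hst => by
    have := mul_le_mul_of_nonneg_left (hmono hst.le) hl.le
    simp only [hE]; linarith
  have hEs : Function.Surjective E := by
    refine hEc.surjective ?_ ?_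
    · refine tendsto_atTop_mono' _ ?_ tendsto_id
      filter_upwards [eventually_ge_atTop 0] with s hs
      have := mul_nonneg hl.le (hg0 ▸ hmono hs : 0 ≤ g s)
      simp only [hE, id]; linarith
    · refine tendsto_atBot_mono' _ ?_ tendsto_id
      filter_upwards [eventually_le_atBot 0] with s hs
      have := mul_nonpos_of_nonneg_of_nonpos hl.le (hg0 ▸ hmono hs : g s ≤ 0)
      simp only [hE, id]; linarith
  let e := hEm.orderIsoOfSurjective E hEs
  set J : ℝ → ℝ := fun s => e.symm s
  have hEJ : ∀ s, E (J s) = s := fun s => e.apply_symm_apply s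
  have hJc : Continuous J := e.symm.continuous
  have hJ0 : J 0 = 0 := by
    refine hEm.injective ?_
    rw [hEJ]; simp [hE, hg0]
  have hpos : ∀ s, 0 < 1 + l * deriv g s := fun s => by
    have := mul_nonneg hl.le (hg' s); linarith
  have hJd : ∀ s, HasDerivAt J (1 + l * deriv g (J s))⁻¹ s := fun s => by
    refine HasDerivAt.of_local_left_inverse hJc.continuousAt ?_ (hpos _).ne'
      (Eventually.of_forall hEJ)
    exact (hasDerivAt_id _).add ((hgd _).const_mul l)
  have hgc := hg.continuous_deriv le_rfl
  have hJC : ContDiff ℝ 1 J := by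
    rw [contDiff_one_iff_deriv]
    refine ⟨fun s => (hJd s).differentiableAt, ?_⟩
    rw [show deriv J = fun s => (1 + l * deriv g (J s))⁻¹ from funext fun s => (hJd s).deriv]
    exact Continuous.inv₀ (by fun_prop) fun s => (hpos _).ne'
  have hd : ∀ s, deriv (g ∘ J) s = deriv g (J s) / (1 + l * deriv g (J s)) := fun s =>
    ((hgd (J s)).comp s (hJd s)).deriv
  have hd0 : ∀ s, 0 ≤ deriv (g ∘ J) s := fun s => by
    rw [hd]; exact div_nonneg (hg' _) (hpos _).le
  refine ⟨J, hEJ, ⟨hg.comp hJC, by simp [hJ0, hg0], fun s => ?_⟩, hd0, fun s => ?_⟩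
  · rw [abs_of_nonneg (hd0 s), hd, div_le_div_iff₀ (hpos _) hl]
    linarith
  · have h1 := hEJ s
    simp only [hE] at h1
    have hJm : Monotone J := e.symm.monotone
    rcases le_total 0 s with hs | hs
    · have h2 : 0 ≤ J s := hJ0 ▸ hJm hs
      have h3 : 0 ≤ g (J s) := hg0 ▸ hmono h2
      have h4 : g (J s) ≤ g s := hmono (by linarith [mul_nonneg hl.le h3])
      rwa [abs_of_nonneg h3, abs_of_nonneg (h3.trans h4)]
    · have h2 : J s ≤ 0 := hJ0 ▸ hJm hs
      have h3 : g (J s) ≤ 0 := hg0 ▸ hmono h2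
      have h4 : g s ≤ g (J s) := hmono (by linarith [mul_nonpos_of_nonneg_of_nonpos hl.le h3])
      rw [abs_of_nonpos h3, abs_of_nonpos (h4.trans h3)]
      linarith

theorem monotone_add_mul {f : ℝ → ℝ} (hf : ContDiff ℝ 1 f) {Λ : ℝ} (hf' : ∀ s, -Λ ≤ deriv f s) :
    Monotone fun s => f s + Λ * s := by
  have hd : ∀ s, HasDerivAt (fun s => f s + Λ * s) (deriv f s + Λ * 1) s := fun s =>
    (hf.differentiable (by simp) s).hasDerivAt.add ((hasDerivAt_id s).const_mul Λ)
  refine monotone_of_deriv_nonneg (fun s => (hd s).differentiableAt) fun s => ?_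
  rw [(hd s).deriv]
  linarith [hf' s]

theorem monotone_mul_sub_nonneg {g : ℝ → ℝ} (hg : Monotone g) (s r : ℝ) :
    0 ≤ (g s - g r) * (s - r) := by
  rcases le_total s r with h | h
  · exact mul_nonneg_of_nonpos_of_nonpos (sub_nonpos.2 (hg h)) (sub_nonpos.2 h)
  · exact mul_nonneg (sub_nonneg.2 (hg h)) (sub_nonneg.2 h)

/-- Yosida approximations with different parameters are monotone relative to each other up to an
error that is small with the parameters. -/
theorem le_mul_of_resolvent {g : ℝ → ℝ} (hg : Monotone g) {l m r s r' s' : ℝ} (hl : 0 < l)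
    (hm : 0 < m) (hr : r' + l * g r' = r) (hs : s' + m * g s' = s) :
    -((l + m) * (g r' ^ 2 + g s' ^ 2)) ≤ (g r' - g s') * (r - s) := by
  have h1 := monotone_mul_sub_nonneg hg r' s'
  have h2 : (g r' - g s') * (r - s) = (g r' - g s') * (r' - s') +
      (g r' - g s') * (l * g r' - m * g s') := by rw [← hr, ← hs]; ring
  rw [h2]
  nlinarith [mul_nonneg hl.le (sq_nonneg (g r')), mul_nonneg hm.le (sq_nonneg (g s')),
    mul_nonneg (add_pos hl hm).le (sq_nonneg (g r' - g s'))]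

end Yosida

section Potential

variable {n : ℕ} {Ω : BoundedDomain n} {β : ℝ → ℝ} {K : ℝ}

theorem integral_primitive_sub_le {β : ℝ → ℝ} (hβ : Continuous β) (hm : Monotone β) (a b : ℝ) :
    (∫ s in 0..a, β s) - (∫ s in 0..b, β s) ≤ β a * (a - b) := by
  have hi : ∀ a b, IntervalIntegrable β volume a b := fun a b => hβ.intervalIntegrable a b
  rw [intervalIntegral.integral_interval_sub_left (hi _ _) (hi _ _)]
  rcases le_total b a with h | h
  · refine (intervalIntegral.integral_mono_on h (hi _ _)
      (intervalIntegrable_const (c := β a)) fun s hs => hm hs.2).trans_eq ?_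
    simp [mul_comm]
  · rw [intervalIntegral.integral_symm]
    have := intervalIntegral.integral_mono_on h (intervalIntegrable_const (c := β a)) (hi a b)
      fun s hs => hm hs.1
    simp only [intervalIntegral.integral_const, smul_eq_mul] at this
    linarith

theorem IsChainFun.abs_le (h : IsChainFun β K) (s : ℝ) : |β s| ≤ K * |s| := by
  have h1 := h.lipschitz.dist_le_mul s 0
  rwa [h.zero, Real.dist_eq, Real.dist_eq, sub_zero, sub_zero,
    Real.coe_toNNReal _ ((abs_nonneg _).trans (h.bound 0))] at h1

/-- The convex functional `p ↦ ∫ G(p)` on `L²(Ω)`, where `G' = β` and `G(0) = 0`. -/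
noncomputable def potential (β : ℝ → ℝ) (p : L2 Ω) : ℝ := ∫ x, (∫ s in 0..p x, β s) ∂Ω.vol

theorem IsChainFun.integrable_primitive (h : IsChainFun β K) (hm : Monotone β) (p : L2 Ω) :
    Integrable (fun x => ∫ s in 0..p x, β s) Ω.vol ∧ ∀ s, 0 ≤ ∫ r in 0..s, β r := by
  have hc := h.contDiff.continuous
  have h0 : ∀ s, 0 ≤ ∫ r in 0..s, β r := fun s => by
    have := integral_primitive_sub_le hc hm 0 s
    rw [h.zero, zero_mul, intervalIntegral.integral_same] at this
    linarith
  refine ⟨?_, h0⟩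
  refine ((memLp_two_norm_sq_integrable (Lp.memLp p)).const_mul K).mono'
    ((intervalIntegral.continuous_primitive
      (fun a b => hc.intervalIntegrable a b) 0).comp_aestronglyMeasurable
        (Lp.aestronglyMeasurable p)) (Eventually.of_forall fun x => ?_)
  rw [Real.norm_of_nonneg (h0 _)]
  have h1 := integral_primitive_sub_le hc hm (p x) 0
  rw [intervalIntegral.integral_same, sub_zero, sub_zero] at h1
  refine h1.trans ((le_abs_self _).trans ?_)
  rw [abs_mul, Real.norm_eq_abs, pow_two, ← mul_assoc]
  exact mul_le_mul_of_nonneg_right (h.abs_le _) (abs_nonneg _)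

/-- `β(p)` is a subgradient of the potential at `p`. -/
theorem IsChainFun.potential_sub_le (h : IsChainFun β K) (hm : Monotone β) (p q : L2 Ω) :
    potential β p - potential β q ≤ inner ℝ (h.comp p) (p - q) := by
  rw [potential, potential, ← integral_sub (h.integrable_primitive hm p).1
    (h.integrable_primitive hm q).1, L2.inner_def]
  refine integral_mono_ae ((h.integrable_primitive hm p).1.sub (h.integrable_primitive hm q).1)
    (L2.integrable_inner _ _) ?_
  filter_upwards [h.coeFn_comp p, Lp.coeFn_sub p q] with x e1 e2
  rw [e1, e2, Pi.sub_apply]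
  refine (integral_primitive_sub_le h.contDiff.continuous hm (p x) (q x)).trans_eq ?_
  exact mul_comm _ _

theorem IsChainFun.potential_nonneg (h : IsChainFun β K) (hm : Monotone β) (p : L2 Ω) :
    0 ≤ potential β p :=
  integral_nonneg fun _ => (h.integrable_primitive hm p).2 _

theorem IsChainFun.potential_le (h : IsChainFun β K) (hm : Monotone β) (p : L2 Ω) :
    potential β p ≤ inner ℝ (h.comp p) p := by
  have h1 := h.potential_sub_le hm p 0
  have h2 : potential β (0 : L2 Ω) = 0 := by
    refine integral_eq_zero_of_ae ?_
    filter_upwards [Lp.coeFn_zero ℝ 2 Ω.vol] with x hx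
    rw [hx]
    simp
  rwa [h2, sub_zero, sub_zero] at h1

theorem IsChainFun.continuous_potential (h : IsChainFun β K) (hm : Monotone β) :
    Continuous (potential β : L2 Ω → ℝ) := by
  refine continuous_iff_continuousAt.2 fun q => ?_
  have h1 : Tendsto (fun p : L2 Ω => potential β q + inner ℝ (h.comp p) (p - q)) (𝓝 q)
      (𝓝 (potential β q + inner ℝ (h.comp q) (q - q))) :=
    (continuous_const.add (h.lipschitz_comp.continuous.inner
      (continuous_id.sub continuous_const))).tendsto q
  have h2 : Tendsto (fun p : L2 Ω => potential β q - inner ℝ (h.comp q) (q - p)) (𝓝 q)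
      (𝓝 (potential β q - inner ℝ (h.comp q) (q - q))) :=
    (continuous_const.sub (continuous_const.inner
      (continuous_const.sub continuous_id))).tendsto q
  rw [sub_self, inner_zero_right, add_zero] at h1
  rw [sub_self, inner_zero_right, sub_zero] at h2
  refine tendsto_of_tendsto_of_tendsto_of_le_of_le h2 h1 (fun p => ?_) fun p => ?_
  · have := h.potential_sub_le hm q p
    simp only; linarith
  · have := h.potential_sub_le hm p q
    simp only; linarith

end Potential

end SemilinearParabolic

namespace SemilinearParabolic

/-! ### Weak limits of superpositions -/

section AlmostEverywhereWeak

variable {α : Type*} [MeasurableSpace α] {μ : Measure α}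

/-- A sequence that is bounded in `L²` and tends to zero almost everywhere tends to zero weakly in
`L²`. Where `|D_k| ≤ R |w|` the product `w D_k` is dominated by `R w²`; elsewhere it is at most
`D_k² / R`. -/
theorem tendsto_inner_zero_of_ae {D : ℕ → Lp ℝ 2 μ} {C : ℝ} (hC : ∀ k, ‖D k‖ ≤ C)
    (hD : ∀ᵐ x ∂μ, Tendsto (fun k => D k x) atTop (𝓝 0)) (w : Lp ℝ 2 μ) :
    Tendsto (fun k => inner ℝ w (D k)) atTop (𝓝 0) := by
  rw [Metric.tendsto_atTop]
  intro ε hε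
  have hC0 : 0 ≤ C := (norm_nonneg _).trans (hC 0)
  -- with this choice the second contribution `‖D_k‖² / R` is less than `ε / 2`
  set R := 2 * (C ^ 2 + 1) / ε with hRdef
  have hR : 0 < R := by positivity
  have hw2 := memLp_two_norm_sq_integrable (Lp.memLp w)
  have hm : ∀ k, AEStronglyMeasurable (fun x => min (‖w x‖ * ‖D k x‖) (R * ‖w x‖ ^ 2)) μ :=
    fun k => (((Lp.aestronglyMeasurable w).norm.mul (Lp.aestronglyMeasurable (D k)).norm).inf
      (((Lp.aestronglyMeasurable w).norm.pow 2).const_mul R))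
  have hb : ∀ k x, ‖min (‖w x‖ * ‖D k x‖) (R * ‖w x‖ ^ 2)‖ ≤ R * ‖w x‖ ^ 2 := fun k x => by
    rw [Real.norm_of_nonneg (by positivity)]
    exact min_le_right _ _
  have h1 : Tendsto (fun k => ∫ x, min (‖w x‖ * ‖D k x‖) (R * ‖w x‖ ^ 2) ∂μ) atTop (𝓝 0) := by
    have := tendsto_integral_of_dominated_convergence (f := fun _ => (0 : ℝ))
      (fun x => R * ‖w x‖ ^ 2) hm (hw2.const_mul R)
      (fun k => Eventually.of_forall (hb k)) (by
        filter_upwards [hD] with x hx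
        have h2 := (hx.norm.const_mul ‖w x‖).min
          (tendsto_const_nhds (x := R * ‖w x‖ ^ 2))
        rwa [norm_zero, mul_zero, min_eq_left (by positivity)] at h2)
    simpa using this
  obtain ⟨N, hN⟩ := Metric.tendsto_atTop.1 h1 (ε / 2) (by positivity)
  refine ⟨N, fun k hk => ?_⟩
  have h2 := hN k hk
  rw [Real.dist_eq, sub_zero] at h2 ⊢
  have hD2 := memLp_two_norm_sq_integrable (Lp.memLp (D k))
  have h3 : |inner ℝ w (D k)| ≤
      ∫ x, (min (‖w x‖ * ‖D k x‖) (R * ‖w x‖ ^ 2) + R⁻¹ * ‖D k x‖ ^ 2) ∂μ := by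
    rw [L2.inner_def, ← Real.norm_eq_abs]
    refine norm_integral_le_of_norm_le
      (((hw2.const_mul R).mono' (hm k) (Eventually.of_forall (hb k))).add (hD2.const_mul R⁻¹))
      (Eventually.of_forall fun x => ?_)
    refine (norm_inner_le_norm _ _).trans ?_
    rcases le_total (‖D k x‖) (R * ‖w x‖) with h | h
    · rw [min_eq_left]
      · exact le_add_of_nonneg_right (by positivity)
      · rw [pow_two, mul_comm ‖w x‖, ← mul_assoc]
        exact mul_le_mul_of_nonneg_right h (norm_nonneg _)
    · have h4 : ‖w x‖ * ‖D k x‖ ≤ R⁻¹ * ‖D k x‖ ^ 2 := by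
        rw [pow_two, ← mul_assoc]
        refine mul_le_mul_of_nonneg_right ?_ (norm_nonneg _)
        rw [inv_mul_eq_div, le_div_iff₀ hR, mul_comm]
        exact h
      exact h4.trans (le_add_of_nonneg_left (by positivity))
  rw [integral_add ((hw2.const_mul R).mono' (hm k) (Eventually.of_forall (hb k)))
    (hD2.const_mul R⁻¹), integral_const_mul, ← norm_Lp_two_sq] at h3
  have h4 : R⁻¹ * ‖D k‖ ^ 2 ≤ ε / 2 * (C ^ 2 / (C ^ 2 + 1)) := by
    have h5 : ‖D k‖ ^ 2 ≤ C ^ 2 := pow_le_pow_left₀ (norm_nonneg _) (hC k) 2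
    calc R⁻¹ * ‖D k‖ ^ 2 ≤ R⁻¹ * C ^ 2 := by gcongr
      _ = ε / 2 * (C ^ 2 / (C ^ 2 + 1)) := by rw [hRdef]; field_simp
  have h5 : ε / 2 * (C ^ 2 / (C ^ 2 + 1)) ≤ ε / 2 := by
    refine mul_le_of_le_one_right (by positivity) ?_
    rw [div_le_one (by positivity)]
    linarith
  linarith [le_abs_self (∫ x, min (‖w x‖ * ‖D k x‖) (R * ‖w x‖ ^ 2) ∂μ)]

/-- If `p_k → p` in `L²` and `g(p_k)` is bounded in `L²`, then `g(p) ∈ L²` and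
`g(p_k) ⇀ g(p)`, since a subsequence of `p_k` converges almost everywhere. -/
theorem exists_weak_limit_superposition {g : ℝ → ℝ} (hg : Continuous g) {p : ℕ → Lp ℝ 2 μ}
    {p₀ : Lp ℝ 2 μ} (hp : Tendsto p atTop (𝓝 p₀)) {G : ℕ → Lp ℝ 2 μ}
    (hG : ∀ k, G k =ᵐ[μ] fun x => g (p k x)) {C : ℝ} (hC : ∀ k, ‖G k‖ ≤ C) :
    ∃ G₀ : Lp ℝ 2 μ, (G₀ =ᵐ[μ] fun x => g (p₀ x)) ∧
      ∀ w : Lp ℝ 2 μ, Tendsto (fun k => inner ℝ w (G k)) atTop (𝓝 (inner ℝ w G₀)) := by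
  have hC0 : 0 ≤ C := (norm_nonneg _).trans (hC 0)
  have hsub : ∀ ns : ℕ → ℕ, Tendsto ns atTop atTop → ∃ ms : ℕ → ℕ,
      ∀ᵐ x ∂μ, Tendsto (fun k => G (ns (ms k)) x) atTop (𝓝 (g (p₀ x))) := fun ns hns => by
    obtain ⟨ms, -, hms⟩ := exists_subseq_ae (hp.comp hns)
    refine ⟨ms, ?_⟩
    filter_upwards [hms, ae_all_iff.2 hG] with x h1 h2
    simp only [h2]
    exact (hg.tendsto _).comp h1
  have hmem : MemLp (fun x => g (p₀ x)) 2 μ := by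
    refine ⟨hg.comp_aestronglyMeasurable (Lp.aestronglyMeasurable p₀), ?_⟩
    obtain ⟨ms, hms⟩ := hsub id tendsto_id
    refine (Lp.eLpNorm_lim_le_liminf_eLpNorm (fun k => Lp.aestronglyMeasurable (G (ms k))) _
      hms).trans_lt ?_
    refine (liminf_le_of_frequently_le' (x := ENNReal.ofReal C)
      (Frequently.of_forall fun k => ?_)).trans_lt ENNReal.ofReal_lt_top
    rw [← Lp.enorm_def, ← ofReal_norm]
    exact ENNReal.ofReal_le_ofReal (hC _)
  refine ⟨hmem.toLp _, hmem.coeFn_toLp, fun w => ?_⟩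
  refine tendsto_of_subseq_tendsto fun ns hns => ?_
  obtain ⟨ms, hms⟩ := hsub ns hns
  refine ⟨ms, ?_⟩
  have h1 := tendsto_inner_zero_of_ae (D := fun k => G (ns (ms k)) - hmem.toLp _)
    (C := C + ‖hmem.toLp _‖) (fun k => (norm_sub_le _ _).trans (by gcongr; exact hC _)) (by
      have h2 : ∀ k, ⇑(G (ns (ms k)) - hmem.toLp _) =ᵐ[μ]
          fun x => G (ns (ms k)) x - g (p₀ x) := fun k => by
        filter_upwards [Lp.coeFn_sub (G (ns (ms k))) (hmem.toLp _), hmem.coeFn_toLp]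
          with x e1 e2
        rw [e1, Pi.sub_apply, e2]
      filter_upwards [hms, ae_all_iff.2 h2] with x e1 e2
      simp only [e2]
      simpa using e1.sub_const (g (p₀ x))) w
  have h2 := h1.add_const (inner ℝ w (hmem.toLp _))
  simpa [inner_sub_right] using h2

end AlmostEverywhereWeak

section SliceSuperposition

variable {X Y : Type*} [MeasurableSpace X] [MeasurableSpace Y] {μ : Measure X} {ν : Measure Y}
  [SFinite μ] [SFinite ν]

theorem ae_eq_of_ae_ae_eq {u w : X × Y → ℝ} (hu : AEStronglyMeasurable u (μ.prod ν))
    (hw : AEStronglyMeasurable w (μ.prod ν)) (h : ∀ᵐ t ∂ν, ∀ᵐ x ∂μ, u (x, t) = w (x, t)) :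
    u =ᵐ[μ.prod ν] w := by
  have h1 : ∫⁻ z, ‖u z - w z‖ₑ ∂μ.prod ν = 0 := by
    rw [lintegral_prod_symm (fun z => ‖u z - w z‖ₑ) (hu.sub hw).enorm]
    refine (lintegral_eq_zero_of_ae_eq_zero ?_)
    filter_upwards [h] with t ht
    refine lintegral_eq_zero_of_ae_eq_zero ?_
    filter_upwards [ht] with x hx
    simp [hx]
  have h2 := (lintegral_eq_zero_iff' (hu.sub hw).enorm).1 h1
  filter_upwards [h2] with z hz
  simpa [sub_eq_zero] using hz

/-- `G = g(p)` as functions on `X × Y` if and only if this holds for almost all slices. -/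
theorem IsSlice.superposition {g : ℝ → ℝ} (hg : Continuous g) {p G : Lp ℝ 2 (μ.prod ν)}
    {P Γ : Lp (Lp ℝ 2 μ) 2 ν} (hp : IsSlice p P) (hG : IsSlice G Γ) :
    (G =ᵐ[μ.prod ν] fun z => g (p z)) ↔ ∀ᵐ t ∂ν, Γ t =ᵐ[μ] fun x => g (P t x) := by
  constructor
  · intro h
    filter_upwards [hp, hG, ae_ae_of_ae_prod_swap h] with t h1 h2 h3
    filter_upwards [h1, h2, h3] with x e1 e2 e3
    rw [e1, e2, e3]
  · intro h
    refine ae_eq_of_ae_ae_eq (Lp.aestronglyMeasurable G)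
      (hg.comp_aestronglyMeasurable (Lp.aestronglyMeasurable p)) ?_
    filter_upwards [hp, hG, h] with t h1 h2 h3
    filter_upwards [h1, h2, h3] with x e1 e2 e3
    rw [← e1, ← e2, e3]

end SliceSuperposition

section VectorSuperposition

variable {X Y : Type*} [MeasurableSpace X] [PseudoMetricSpace X] [SecondCountableTopology X]
  [BorelSpace X] [MeasurableSpace Y] [PseudoMetricSpace Y] [SecondCountableTopology Y]
  [BorelSpace Y] {μ : Measure X} {ν : Measure Y} [IsFiniteMeasure μ] [IsFiniteMeasure ν]

theorem inner_sliceEquiv_symm (P Q : Lp (Lp ℝ 2 μ) 2 ν) :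
    inner ℝ ((sliceEquiv μ ν).symm P) ((sliceEquiv μ ν).symm Q) = inner ℝ P Q :=
  (sliceEquiv μ ν).symm.inner_map_map P Q

/-- The version of `exists_weak_limit_superposition` for functions of time with values in
`L²(X)`. -/
theorem exists_weak_limit_superposition_slice {g : ℝ → ℝ} (hg : Continuous g)
    {p : ℕ → Lp (Lp ℝ 2 μ) 2 ν} {p₀ : Lp (Lp ℝ 2 μ) 2 ν} (hp : Tendsto p atTop (𝓝 p₀))
    {G : ℕ → Lp (Lp ℝ 2 μ) 2 ν} (hG : ∀ k, ∀ᵐ t ∂ν, G k t =ᵐ[μ] fun x => g (p k t x)) {C : ℝ}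
    (hC : ∀ k, ‖G k‖ ≤ C) :
    ∃ G₀ : Lp (Lp ℝ 2 μ) 2 ν, (∀ᵐ t ∂ν, G₀ t =ᵐ[μ] fun x => g (p₀ t x)) ∧
      ∀ w : Lp (Lp ℝ 2 μ) 2 ν, Tendsto (fun k => inner ℝ w (G k)) atTop (𝓝 (inner ℝ w G₀)) := by
  set e := (sliceEquiv μ ν).symm
  obtain ⟨G₀, h1, h2⟩ := exists_weak_limit_superposition hg
    ((e.continuous.tendsto p₀).comp hp) (G := fun k => e (G k))
    (fun k => ((isSlice_sliceEquiv_symm (p k)).superposition hg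
      (isSlice_sliceEquiv_symm (G k))).2 (hG k)) (fun k => (e.norm_map _).trans_le (hC k))
  refine ⟨sliceEquiv μ ν G₀, ((isSlice_sliceEquiv_symm p₀).superposition hg
    (isSlice_sliceEquiv G₀)).1 h1, fun w => ?_⟩
  have h3 := h2 (e w)
  have h4 : inner ℝ (e w) G₀ = inner ℝ w (sliceEquiv μ ν G₀) := by
    rw [← inner_sliceEquiv_symm, LinearIsometryEquiv.symm_apply_apply]
  rw [h4] at h3
  refine h3.congr fun k => inner_sliceEquiv_symm _ _

end VectorSuperposition

/-! ### The energy estimate with Gronwall's inequality -/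

section EnergyGronwall

variable {V H : Type*} [NormedAddCommGroup V] [NormedSpace ℝ V] [CompleteSpace V]
  [NormedAddCommGroup H] [InnerProductSpace ℝ H] {j : V →L[ℝ] H} {T : ℝ}

/-- The energy estimate, after Gronwall's lemma. -/
theorem IsPath.energy_gronwall {y : ℝ → V} {z : ℝ → StrongDual ℝ V} {Y : ℝ → H}
    (h : IsPath j T y z Y) (hT : 0 ≤ T) {α c : ℝ} (hα : 0 ≤ α) (hc : 0 ≤ c) {p ρ : ℝ → ℝ}
    (hp : IntegrableOn p (Ioo 0 T))
    (hz : ∀ᵐ t ∂timeVol T, z t (y t) ≤ p t + c * ‖Y t‖ ^ 2 - α * ‖y t‖ ^ 2)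
    (hρc : ContinuousOn ρ (Icc 0 T)) (hρ0 : ∀ t ∈ Icc 0 T, 0 ≤ ρ t)
    (hρ : ∀ t ∈ Icc 0 T, ‖Y 0‖ ^ 2 + 2 * ∫ s in 0..t, p s ≤ ρ t) :
    ∀ t ∈ Icc 0 T, ‖Y t‖ ^ 2 + 2 * α * ∫ s in 0..t, ‖y s‖ ^ 2 ≤
      ρ t + 2 * c * (Real.exp (2 * c * T) * ∫ s in 0..T, ρ s) := by
  have hYc : ContinuousOn (fun t => ‖Y t‖ ^ 2) (Icc 0 T) := h.continuousOn.norm.pow 2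
  have hYi : IntegrableOn (fun t => ‖Y t‖ ^ 2) (Ioo 0 T) :=
    (hYc.integrableOn_Icc).mono_set Ioo_subset_Icc_self
  have h1 : ∀ t ∈ Icc 0 T, ‖Y t‖ ^ 2 + 2 * α * ∫ s in 0..t, ‖y s‖ ^ 2 ≤
      ρ t + 2 * c * ∫ s in 0..t, ‖Y s‖ ^ 2 := fun t ht => by
    have h2 := h.energy_le_of_le (hp.add (hYi.const_mul c)) hz ht
    simp only [Pi.add_apply] at h2
    rw [intervalIntegral.integral_add (intervalIntegrable_zero_of_mem hp ht)
      (intervalIntegrable_zero_of_mem (hYi.const_mul c) ht),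
      intervalIntegral.integral_const_mul] at h2
    linarith [hρ t ht]
  have hG := integral_le_of_le_add_integral hT (by positivity : 0 ≤ 2 * c) hYc hρc hρ0
    fun t ht => by
      have h3 : 0 ≤ ∫ s in 0..t, ‖y s‖ ^ 2 :=
        intervalIntegral.integral_nonneg ht.1 fun s _ => by positivity
      have := h1 t ht
      have h4 := mul_nonneg (mul_nonneg zero_le_two hα) h3
      linarith
  intro t ht
  have h3 := intervalIntegral_le_of_nonneg hYi (fun t => by positivity) ht
  refine (h1 t ht).trans (add_le_add_right ?_ _)
  exact mul_le_mul_of_nonneg_left (h3.trans hG) (by positivity)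

end EnergyGronwall

end SemilinearParabolic

namespace SemilinearParabolic

/-! ### Approximate problems -/

section Approximation

variable {n : ℕ} {Ω : BoundedDomain n} {T : ℝ} {a : Fin n → Fin n → Sp n → ℝ} {a₀ : Sp n → ℝ}
  {β : ℝ → ℝ} {K : ℝ}

theorem norm_toLp_sq_intervalIntegral {E : Type*} [NormedAddCommGroup E] (hT : 0 ≤ T) {f : ℝ → E}
    (hf : MemLp f 2 (timeVol T)) : ‖hf.toLp f‖ ^ 2 = ∫ t in 0..T, ‖f t‖ ^ 2 := by
  rw [norm_toLp_two_sq, setIntegral_timeVol_eq hT]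

theorem norm_Lp_sq_intervalIntegral {E : Type*} [NormedAddCommGroup E] (hT : 0 ≤ T)
    (f : Lp E 2 (timeVol T)) : ‖f‖ ^ 2 = ∫ t in 0..T, ‖f t‖ ^ 2 := by
  rw [norm_Lp_two_sq, setIntegral_timeVol_eq hT]

theorem IsChainFun.memLp_comp (h : IsChainFun β K) {Y : ℝ → L2 Ω} (hY : ContinuousOn Y (Icc 0 T)) :
    MemLp (fun t => h.comp (Y t)) 2 (timeVol T) :=
  memLp_timeVol_of_continuousOn (h.lipschitz_comp.continuous.comp_continuousOn hY) 2

/-- The problem with a nonlinearity `β(y) - c y`, where `β` is nondecreasing with bounded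
derivative. Testing with `β(y)` bounds `β(y)` in `L²`, with no dependence on the bound for the
derivative of `β`. -/
theorem exists_path_chainFun (hT : 0 < T) (hA : IsEllipticOperator Ω a a₀) (h : IsChainFun β K)
    (hβ' : ∀ s, 0 ≤ deriv β s) (c : ℝ) (u : Lp (L2 Ω) 2 (timeVol T)) (v₀ : H10 Ω) :
    ∃ (y : ℝ → H10 Ω) (Y : ℝ → L2 Ω) (hp : IsPath H10.fn T y (fun t => dualEmb H10.fn (u t) -
        hA.op (y t) - dualEmb H10.fn (h.comp (Y t) - c • Y t)) Y),
      Y 0 = H10.fn v₀ ∧ ‖(h.memLp_comp hp.continuousOn).toLp _‖ ^ 2 ≤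
        2 * potential β (H10.fn v₀) +
          ‖u + c • (memLp_timeVol_of_continuousOn hp.continuousOn 2).toLp Y‖ ^ 2 := by
  obtain ⟨α, hα, hcoer⟩ := hA.exists_coercive
  have hm : Monotone β := monotone_of_deriv_nonneg (h.contDiff.differentiable (by simp)) hβ'
  have hB : LipschitzWith (K.toNNReal + ‖c‖₊) fun p : L2 Ω => h.comp p - c • p :=
    h.lipschitz_comp.sub (lipschitzWith_smul c)
  obtain ⟨y, Y, hp, hY0⟩ := exists_path_lipschitz H10.fn hT hα hcoer hB (Lp.memLp u) v₀
  refine ⟨y, Y, hp, hY0, ?_⟩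
  have hYm := memLp_timeVol_of_continuousOn hp.continuousOn 2
  have hγm := h.memLp_comp hp.continuousOn
  have hb : MemLp (fun t => h.compH10 (y t)) 2 (timeVol T) :=
    hp.memLp.of_le_mul (c := K) (h.continuous_compH10.comp_aestronglyMeasurable hp.memLp.1)
      (Eventually.of_forall fun t => h.norm_compH10_le _)
  -- test with `β(y)`; the principal part contributes a nonnegative term
  have h1 := hp.chain_rule_le (h.continuous_potential hm) (h.potential_sub_le hm) hb
    (by filter_upwards [hp.ae_eq] with t ht; rw [ht, h.fn_compH10]) ⟨hT.le, le_rfl⟩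
  have hs : MemLp (fun t => u t + c • Y t) 2 (timeVol T) := (Lp.memLp u).add (hYm.const_smul c)
  have hi1 := memLp_two_norm_sq_integrable hs
  have hi2 := memLp_two_norm_sq_integrable hγm
  have h2 := intervalIntegral_mono_timeVol
    (memLp_two_bilin_integrable (ContinuousLinearMap.id ℝ (Hm1 Ω)) hp.memLp_deriv hb)
    ((hi1.const_mul (1 / 2)).sub (hi2.const_mul (1 / 2))) (by
      filter_upwards [hp.ae_eq] with t ht
      have e1 := hA.op_compH10_nonneg h hβ' (y t)
      have e2 := real_inner_le_norm (u t + c • Y t) (h.comp (Y t))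
      have e3 : inner ℝ (h.comp (Y t)) (h.comp (Y t)) = ‖h.comp (Y t)‖ ^ 2 :=
        real_inner_self_eq_norm_sq _
      simp only [ContinuousLinearMap.id_apply, sub_apply, dualEmb_apply, h.fn_compH10, ← ht,
        Pi.sub_apply]
      rw [inner_sub_left]
      rw [inner_add_left] at e2
      nlinarith [sq_nonneg (‖u t + c • Y t‖ - ‖h.comp (Y t)‖)]) ⟨hT.le, le_rfl⟩
  simp only [ContinuousLinearMap.id_apply, Pi.sub_apply] at h2
  rw [intervalIntegral.integral_sub
    (intervalIntegrable_zero_of_mem (hi1.const_mul _) ⟨hT.le, le_rfl⟩)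
    (intervalIntegrable_zero_of_mem (hi2.const_mul _) ⟨hT.le, le_rfl⟩),
    intervalIntegral.integral_const_mul, intervalIntegral.integral_const_mul,
    ← norm_toLp_sq_intervalIntegral hT.le hs, ← norm_toLp_sq_intervalIntegral hT.le hγm] at h2
  have h3 : u + c • hYm.toLp Y = hs.toLp _ := by
    rw [← MemLp.toLp_const_smul]
    conv_lhs => rw [← Lp.toLp_coeFn u (Lp.memLp u), ← MemLp.toLp_add]
    rfl
  have h4 := h.potential_nonneg hm (Y T)
  rw [h3]
  rw [hY0] at h1
  linarith

/-- The inequality `le_mul_of_resolvent`, integrated over `Ω`. -/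
theorem le_inner_comp_of_resolvent {g J J' : ℝ → ℝ} (hg : Monotone g) {l m K K' : ℝ} (hl : 0 < l)
    (hm : 0 < m) (hJ : ∀ s, J s + l * g (J s) = s) (hJ' : ∀ s, J' s + m * g (J' s) = s)
    (h : IsChainFun (g ∘ J) K) (h' : IsChainFun (g ∘ J') K') (p q : L2 Ω) :
    -((l + m) * (‖h.comp p‖ ^ 2 + ‖h'.comp q‖ ^ 2)) ≤ inner ℝ (h.comp p - h'.comp q) (p - q) := by
  have hi := memLp_two_norm_sq_integrable (Lp.memLp (h.comp p))
  have hi' := memLp_two_norm_sq_integrable (Lp.memLp (h'.comp q))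
  rw [norm_Lp_two_sq, norm_Lp_two_sq, ← integral_add hi hi', ← integral_const_mul, ← integral_neg,
    L2.inner_def]
  refine integral_mono_ae ((hi.add hi').const_mul _).neg (L2.integrable_inner _ _) ?_
  filter_upwards [h.coeFn_comp p, h'.coeFn_comp q, Lp.coeFn_sub p q,
    Lp.coeFn_sub (h.comp p) (h'.comp q)] with x e1 e2 e3 e4
  rw [e3, e4, Pi.sub_apply, Pi.sub_apply, e1, e2]
  simp only [Real.norm_eq_abs, sq_abs, Function.comp_apply]
  refine (le_mul_of_resolvent hg hl hm (hJ (p x)) (hJ' (q x))).trans_eq ?_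
  exact mul_comm _ _

/-- The energy bound, uniform with respect to the nonlinearity `β`. -/
theorem norm_path_le (hT : 0 ≤ T) (hA : IsEllipticOperator Ω a a₀) (h : IsChainFun β K)
    (hm : Monotone β) {c : ℝ} (hc : 0 ≤ c) {u : Lp (L2 Ω) 2 (timeVol T)} {y : ℝ → H10 Ω}
    {Y : ℝ → L2 Ω} (hp : IsPath H10.fn T y (fun t => dualEmb H10.fn (u t) -
        hA.op (y t) - dualEmb H10.fn (h.comp (Y t) - c • Y t)) Y) {t : ℝ} (ht : t ∈ Icc 0 T) :
    ‖Y t‖ ^ 2 ≤ (‖Y 0‖ ^ 2 + ‖u‖ ^ 2) *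
      (1 + (2 * c + 1) * Real.exp ((2 * c + 1) * T) * T) := by
  obtain ⟨α, hα, hcoer⟩ := hA.exists_coercive
  have hu2 := memLp_two_norm_sq_integrable (Lp.memLp u)
  have h1 := hp.energy_gronwall (α := α) (c := c + 1 / 2) (p := fun t => 1 / 2 * ‖u t‖ ^ 2)
    (ρ := fun _ => ‖Y 0‖ ^ 2 + ‖u‖ ^ 2) hT hα.le (by positivity) (hu2.const_mul _) (by
      filter_upwards [hp.ae_eq] with t ht
      have e1 := hcoer (y t)
      have e2 := real_inner_le_norm (u t) (Y t)
      have e3 := (h.potential_nonneg hm (Y t)).trans (h.potential_le hm (Y t))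
      simp only [sub_apply, dualEmb_apply, ← ht]
      rw [inner_sub_left, real_inner_smul_left, real_inner_self_eq_norm_sq]
      nlinarith [sq_nonneg (‖u t‖ - ‖Y t‖)]) continuousOn_const (fun t _ => by positivity)
    (fun t ht => by
      rw [intervalIntegral.integral_const_mul, norm_Lp_sq_intervalIntegral hT u]
      linarith [intervalIntegral_le_of_nonneg hu2 (fun t => by positivity) ht]) t ht
  have h2 : 0 ≤ ∫ s in 0..t, ‖y s‖ ^ 2 :=
    intervalIntegral.integral_nonneg ht.1 fun s _ => by positivity
  rw [intervalIntegral.integral_const, smul_eq_mul, sub_zero,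
    show 2 * (c + 1 / 2) = 2 * c + 1 by ring] at h1
  have h3 := mul_nonneg (mul_nonneg zero_le_two hα.le) h2
  linarith

end Approximation

end SemilinearParabolic

namespace SemilinearParabolic

/-! ### Existence -/

section Existence

variable {n : ℕ} {Ω : BoundedDomain n} {T : ℝ} {a : Fin n → Fin n → Sp n → ℝ} {a₀ : Sp n → ℝ}
  {f : ℝ → ℝ}

/-- `y` with continuous representative `Y` solves the equation `y' + A y + F = u` in
`L²(0,T;H⁻¹(Ω))`, where `F = f(y) ∈ L²(0,T;L²(Ω))`. -/
structure IsPathSolution (hA : IsEllipticOperator Ω a a₀) (f : ℝ → ℝ)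
    (u : Lp (L2 Ω) 2 (timeVol T)) (y : ℝ → H10 Ω) (F : Lp (L2 Ω) 2 (timeVol T))
    (Y : ℝ → L2 Ω) : Prop where
  path : IsPath H10.fn T y
    (fun t => dualEmb H10.fn (u t) - hA.op (y t) - dualEmb H10.fn (F t)) Y
  superposition : ∀ᵐ t ∂timeVol T, F t =ᵐ[Ω.vol] fun x => f (Y t x)

theorem inner_indicator_Ioo {H : Type*} [NormedAddCommGroup H] [InnerProductSpace ℝ H]
    {r t : ℝ} (hr : 0 ≤ r) (hrt : r ≤ t) (ht : t ≤ T) (h : H)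
    (q : Lp H 2 (timeVol T)) :
    inner ℝ (indicatorConstLp 2 (measurableSet_Ioo (a := r) (b := t))
      (measure_ne_top (timeVol T) _) h) q = ∫ s in r..t, inner ℝ (q s) h := by
  rw [L2.inner_indicatorConstLp_eq_setIntegral_inner, Measure.restrict_restrict_of_subset
    (Ioo_subset_Ioo hr ht), intervalIntegral.integral_of_le hrt, integral_Ioc_eq_integral_Ioo]
  exact integral_congr_ae (Eventually.of_forall fun s => real_inner_comm _ _)

theorem tendsto_toLp_of_tendstoUniformlyOn {H : Type*} [NormedAddCommGroup H]
    {Y : ℕ → ℝ → H} {Y₀ : ℝ → H} (hY : ∀ k, ContinuousOn (Y k) (Icc 0 T))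
    (hY₀ : ContinuousOn Y₀ (Icc 0 T)) (h : TendstoUniformlyOn Y Y₀ atTop (Icc 0 T)) :
    Tendsto (fun k => (memLp_timeVol_of_continuousOn (hY k) 2).toLp (Y k)) atTop
      (𝓝 ((memLp_timeVol_of_continuousOn hY₀ 2).toLp Y₀)) := by
  rw [Lp.tendsto_Lp_iff_tendsto_eLpNorm'' _ _ _ (memLp_timeVol_of_continuousOn hY₀ 2)]
  rw [ENNReal.tendsto_nhds_zero]
  intro ε hε
  obtain ⟨δ, hδ, hδε⟩ : ∃ δ : ℝ, 0 < δ ∧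
      (timeVol T) univ ^ (2 : ℝ≥0∞).toReal⁻¹ * ENNReal.ofReal δ ≤ ε := by
    set c := (timeVol T) univ ^ (2 : ℝ≥0∞).toReal⁻¹
    have hc : c ≠ ⊤ := ENNReal.rpow_ne_top_of_nonneg (by positivity) (measure_ne_top _ _)
    have h1 : Tendsto (fun δ : ℝ => c * ENNReal.ofReal δ) (𝓝[>] 0) (𝓝 (c * ENNReal.ofReal 0)) :=
      ENNReal.Tendsto.const_mul ((ENNReal.continuous_ofReal.tendsto 0).mono_left
        nhdsWithin_le_nhds) (Or.inr hc)
    rw [ENNReal.ofReal_zero, mul_zero] at h1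
    obtain ⟨δ, h2, h3⟩ := ((ENNReal.tendsto_nhds_zero.1 h1 ε hε).and self_mem_nhdsWithin).exists
    exact ⟨δ, h3, h2⟩
  filter_upwards [Metric.tendstoUniformlyOn_iff.1 h δ hδ] with k hk
  refine (eLpNorm_le_of_ae_bound (C := δ) ?_).trans hδε
  filter_upwards [ae_restrict_mem measurableSet_Ioo] with t ht
  rw [Pi.sub_apply, ← dist_eq_norm, dist_comm]
  exact (hk t (Ioo_subset_Icc_self ht)).le

set_option maxHeartbeats 1000000 in
/-- Existence. The nonlinearity `g = f + Λ` is replaced by its Yosida approximations, whose values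
are bounded in `L²` when tested with themselves; by monotonicity the approximate solutions form
a Cauchy sequence, and `g(y)` is identified by almost everywhere convergence. -/
theorem exists_isPathSolution (hT : 0 < T) (hA : IsEllipticOperator Ω a a₀)
    (hf : ContDiff ℝ 1 f) (hf0 : f 0 = 0) {Λ : ℝ} (hΛ : 0 ≤ Λ) (hf' : ∀ s, -Λ ≤ deriv f s)
    (u : Lp (L2 Ω) 2 (timeVol T)) (p₀ : L2 Ω) {L : ℝ} (hL : 0 ≤ L)
    (hp₀ : ∀ᵐ x ∂Ω.vol, |f (p₀ x) + Λ * p₀ x| ≤ L * |p₀ x|) :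
    ∃ (y : ℝ → H10 Ω) (F : Lp (L2 Ω) 2 (timeVol T)) (Y : ℝ → L2 Ω)
      (h : IsPathSolution hA f u y F Y), Y 0 = p₀ ∧
      ‖F + Λ • (memLp_timeVol_of_continuousOn h.path.continuousOn 2).toLp Y‖ ^ 2 ≤
        2 * L * ‖p₀‖ ^ 2 +
          ‖u + Λ • (memLp_timeVol_of_continuousOn h.path.continuousOn 2).toLp Y‖ ^ 2 := by
  have hfin := isFiniteMeasure_vol Ω
  obtain ⟨α, hα, hcoer⟩ := hA.exists_coercive
  -- the nondecreasing function `g` and its resolvents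
  set g : ℝ → ℝ := fun s => f s + Λ * s with hgdef
  have hg : ContDiff ℝ 1 g := hf.add (contDiff_const.mul contDiff_id)
  have hg0 : g 0 = 0 := by simp [hgdef, hf0]
  have hg' : ∀ s, 0 ≤ deriv g s := fun s => by
    have h1 : HasDerivAt g (deriv f s + Λ * 1) s :=
      (hf.differentiable (by simp) s).hasDerivAt.add ((hasDerivAt_id s).const_mul Λ)
    rw [h1.deriv]; linarith [hf' s]
  have hgm : Monotone g := monotone_of_deriv_nonneg (hg.differentiable (by simp)) hg'
  let l : ℕ → ℝ := fun k => 1 / ((k : ℝ) + 1)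
  have hl : ∀ k, 0 < l k := fun k => by positivity
  have hl1 : ∀ k, l k ≤ 1 := fun k => by
    rw [div_le_one (by positivity)]; linarith [(Nat.cast_nonneg k : (0 : ℝ) ≤ k)]
  have hl0 : Tendsto l atTop (𝓝 0) := tendsto_one_div_add_atTop_nhds_zero_nat
  choose J hJ hβ hβ' hJg using fun k => exists_resolvent hg hg0 hg' (hl k)
  have hβm : ∀ k, Monotone (g ∘ J k) := fun k =>
    monotone_of_deriv_nonneg ((hβ k).contDiff.differentiable (by simp)) (hβ' k)
  -- initial values in `H₀¹(Ω)`, with an error that outweighs the Lipschitz constant `1 / l k`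
  have hv : ∀ k, ∃ v : H10 Ω, ‖H10.fn v - p₀‖ ≤ l k ^ 2 := fun k => by
    obtain ⟨v, hv⟩ := H10.denseRange_fn.exists_dist_lt p₀ (pow_pos (hl k) 2)
    exact ⟨v, by rw [← dist_eq_norm, dist_comm]; exact hv.le⟩
  choose v hv using hv
  choose y Y hp hY0 hγ using fun k => exists_path_chainFun hT hA (hβ k) (hβ' k) Λ u (v k)
  set γ : ℕ → ℝ → L2 Ω := fun k t => (hβ k).comp (Y k t) with hγdef
  have hYm := fun k => memLp_timeVol_of_continuousOn (hp k).continuousOn 2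
  have hγm : ∀ k, MemLp (γ k) 2 (timeVol T) := fun k => (hβ k).memLp_comp (hp k).continuousOn
  -- the initial potentials are bounded, since the Yosida approximations satisfy
  -- `|g(J k s)| ≤ |g(s)|` and have the Lipschitz constant `1 / l k`, while `v k - p₀` is of the
  -- order `(l k)²`
  set N := ‖p₀‖ with hN
  have hpot : ∀ k, potential (g ∘ J k) (H10.fn (v k)) ≤
      (l k + L * N) * (N + l k ^ 2) := fun k => by
    refine ((hβ k).potential_le (hβm k) _).trans ((real_inner_le_norm _ _).trans ?_)
    have h1 : ‖(hβ k).comp p₀‖ ≤ L * N := by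
      refine Lp.norm_le_mul_norm_of_ae_le_mul ?_
      filter_upwards [(hβ k).coeFn_comp p₀, hp₀] with x e1 e2
      rw [e1]
      exact (hJg k _).trans e2
    have h2 : ‖(hβ k).comp (H10.fn (v k)) - (hβ k).comp p₀‖ ≤ l k := by
      have h3 := (hβ k).lipschitz_comp.dist_le_mul (H10.fn (v k)) p₀
      rw [dist_eq_norm, dist_eq_norm, Real.coe_toNNReal _ (by positivity)] at h3
      refine h3.trans ?_
      refine (mul_le_mul_of_nonneg_left (hv k) (by positivity)).trans_eq ?_
      field_simp
    have h4 : ‖(hβ k).comp (H10.fn (v k))‖ ≤ l k + L * N :=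
      (norm_le_norm_sub_add _ ((hβ k).comp p₀)).trans (add_le_add h2 h1)
    have h5 : ‖H10.fn (v k)‖ ≤ N + l k ^ 2 := by
      rw [add_comm]
      exact (norm_le_norm_sub_add _ p₀).trans (add_le_add (hv k) le_rfl)
    exact mul_le_mul h4 h5 (norm_nonneg _) (add_nonneg (hl k).le (by positivity))
  have hpot0 : Tendsto (fun k => 2 * ((l k + L * N) * (N + l k ^ 2))) atTop
      (𝓝 (2 * L * N ^ 2)) := by
    have h1 := (((hl0.add_const (L * N)).mul ((hl0.pow 2).const_add N)).const_mul 2)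
    convert h1 using 2
    ring
  -- uniform bounds
  set D := ((N + 1) ^ 2 + ‖u‖ ^ 2) * (1 + (2 * Λ + 1) * Real.exp ((2 * Λ + 1) * T) * T) with hD
  have hYb : ∀ k, ∀ t ∈ Icc 0 T, ‖Y k t‖ ^ 2 ≤ D := fun k t ht => by
    refine (norm_path_le hT.le hA (hβ k) (hβm k) hΛ (hp k) ht).trans ?_
    have h1 : ‖Y k 0‖ ≤ N + 1 := by
      rw [hY0, add_comm]
      refine (norm_le_norm_sub_add _ p₀).trans (add_le_add ((hv k).trans ?_) le_rfl)
      exact pow_le_one₀ (hl k).le (hl1 k)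
    rw [hD]
    gcongr
  have hYL : ∀ k, ‖(hYm k).toLp (Y k)‖ ^ 2 ≤ T * D := fun k => by
    rw [norm_toLp_sq_intervalIntegral hT.le]
    have h1 := intervalIntegral_mono_timeVol (memLp_two_norm_sq_integrable (hYm k))
      (integrableOn_const (C := D) (by simp)) (by
        filter_upwards [ae_restrict_mem measurableSet_Ioo] with t ht
        exact hYb k t (Ioo_subset_Icc_self ht)) ⟨hT.le, le_rfl⟩
    simpa using h1
  obtain ⟨Γ, hΓ⟩ : ∃ Γ, ∀ k, ‖(hγm k).toLp (γ k)‖ ^ 2 ≤ Γ := by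
    refine ⟨2 * ((1 + L * N) * (N + 1)) + (2 * ‖u‖ ^ 2 + 2 * (Λ ^ 2 * (T * D))), fun k => ?_⟩
    refine (hγ k).trans (add_le_add ?_ ?_)
    · refine mul_le_mul_of_nonneg_left ((hpot k).trans ?_) zero_le_two
      have h1 := hl1 k
      have h2 := pow_le_one₀ (n := 2) (hl k).le (hl1 k)
      have h3 := (hl k).le
      gcongr
    · have h1 := norm_add_le u (Λ • (hYm k).toLp (Y k))
      have h2 : ‖Λ • (hYm k).toLp (Y k)‖ ^ 2 ≤ Λ ^ 2 * (T * D) := by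
        rw [norm_smul, mul_pow, Real.norm_eq_abs, sq_abs]
        exact mul_le_mul_of_nonneg_left (hYL k) (sq_nonneg _)
      have h3 := pow_le_pow_left₀ (norm_nonneg _) h1 2
      nlinarith [sq_nonneg (‖u‖ - ‖Λ • (hYm k).toLp (Y k)‖)]
  have hΓ0 : 0 ≤ Γ := (sq_nonneg _).trans (hΓ 0)
  -- the approximate solutions form a Cauchy sequence
  set E := 1 + 2 * Λ * (Real.exp (2 * Λ * T) * T) with hE
  have hE0 : 0 ≤ E := by positivity
  have hdiff : ∀ k m, ∀ t ∈ Icc 0 T, ‖Y k t - Y m t‖ ^ 2 +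
      2 * α * ∫ s in 0..t, ‖y k s - y m s‖ ^ 2 ≤ (l k + l m) * ((2 + 4 * Γ) * E) := by
    intro k m t ht
    have hi : ∀ k, Integrable (fun t => ‖γ k t‖ ^ 2) (timeVol T) := fun k =>
      memLp_two_norm_sq_integrable (hγm k)
    have hi2 : Integrable (fun t => ‖γ k t‖ ^ 2 + ‖γ m t‖ ^ 2) (timeVol T) := (hi k).add (hi m)
    have h0 : ‖(Y k - Y m) 0‖ ^ 2 ≤ 2 * (l k + l m) := by
      have h1 : ‖(Y k - Y m) 0‖ ≤ l k ^ 2 + l m ^ 2 := by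
        rw [Pi.sub_apply, hY0, hY0, ← sub_sub_sub_cancel_right _ _ p₀]
        exact (norm_sub_le _ _).trans (add_le_add (hv k) (hv m))
      have h2 : l k ^ 2 ≤ l k := pow_le_of_le_one (hl k).le (hl1 k) two_ne_zero
      have h3 : l m ^ 2 ≤ l m := pow_le_of_le_one (hl m).le (hl1 m) two_ne_zero
      nlinarith [norm_nonneg ((Y k - Y m) 0), hl k, hl m, hl1 k, hl1 m]
    have h1 := ((hp k).sub (hp m)).energy_gronwall (α := α) (c := Λ)
      (p := fun t => (l k + l m) * (‖γ k t‖ ^ 2 + ‖γ m t‖ ^ 2))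
      (ρ := fun _ => (l k + l m) * (2 + 4 * Γ)) hT.le hα.le hΛ
      (hi2.const_mul (l k + l m)) (by
        filter_upwards [(hp k).ae_eq, (hp m).ae_eq] with t e1 e2
        have e3 := hcoer (y k t - y m t)
        have e4 := le_inner_comp_of_resolvent hgm (hl k) (hl m) (hJ k) (hJ m) (hβ k) (hβ m)
          (Y k t) (Y m t)
        have e5 : inner ℝ (Y k t) (Y k t - Y m t) - inner ℝ (Y m t) (Y k t - Y m t) =
            ‖Y k t - Y m t‖ ^ 2 := by
          rw [← inner_sub_left, real_inner_self_eq_norm_sq]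
        rw [inner_sub_left] at e4
        simp only [Pi.sub_apply, sub_apply, dualEmb_apply, map_sub, ← e1, ← e2,
          real_inner_smul_left, inner_sub_right, hγdef] at e3 e4 e5 ⊢
        have e6 := congrArg (fun r => Λ * r) e5
        linarith) continuousOn_const
      (fun t _ => mul_nonneg (add_pos (hl k) (hl m)).le (by positivity)) (fun t ht => by
        have h2 := intervalIntegral_le_of_nonneg (hi2.const_mul (l k + l m))
          (fun t => mul_nonneg (add_pos (hl k) (hl m)).le (by positivity)) ht
        have hTT : T ∈ Icc 0 T := ⟨hT.le, le_rfl⟩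
        rw [intervalIntegral.integral_const_mul, intervalIntegral.integral_const_mul,
          intervalIntegral.integral_add (μ := volume) (a := 0) (b := T)
            (intervalIntegrable_zero_of_mem (hi k) hTT)
            (intervalIntegrable_zero_of_mem (hi m) hTT),
          ← norm_toLp_sq_intervalIntegral hT.le (hγm k),
          ← norm_toLp_sq_intervalIntegral hT.le (hγm m)] at h2
        have h3 := mul_le_mul_of_nonneg_left (add_le_add (hΓ k) (hΓ m))
          (add_pos (hl k) (hl m)).le
        rw [intervalIntegral.integral_const_mul]
        linarith) t ht
    refine h1.trans_eq ?_
    rw [intervalIntegral.integral_const, smul_eq_mul, sub_zero, hE]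
    ring
  obtain ⟨y₀, Y₀, hy₀m, hy₀, hY₀c, hY₀, hae⟩ := exists_limit_of_cauchy hT.le hp
    (d := fun k => l k * ((2 + 4 * Γ) * E * (1 + 1 / (2 * α))))
    (by simpa using hl0.mul_const ((2 + 4 * Γ) * E * (1 + 1 / (2 * α))))
    (fun k m t ht => by
      have h1 := hdiff k m t ht
      have h2 : 0 ≤ ∫ s in 0..t, ‖y k s - y m s‖ ^ 2 :=
        intervalIntegral.integral_nonneg ht.1 fun s _ => by positivity
      have h3 : 0 ≤ (l k + l m) * ((2 + 4 * Γ) * E) * (1 / (2 * α)) :=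
        mul_nonneg (mul_nonneg (add_pos (hl k) (hl m)).le (by positivity)) (by positivity)
      have h4 := mul_nonneg (mul_nonneg zero_le_two hα.le) h2
      linarith)
    (fun k m => by
      have h1 := hdiff k m T ⟨hT.le, le_rfl⟩
      have h2 : 2 * α * ∫ s in 0..T, ‖y k s - y m s‖ ^ 2 ≤ (l k + l m) * ((2 + 4 * Γ) * E) := by
        linarith [sq_nonneg ‖Y k T - Y m T‖]
      rw [mul_comm, ← le_div_iff₀ (by positivity)] at h2
      have h3 : 0 ≤ (l k + l m) * ((2 + 4 * Γ) * E) :=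
        mul_nonneg (add_pos (hl k) (hl m)).le (by positivity)
      refine h2.trans ?_
      rw [div_eq_mul_one_div]
      linarith)
  have hY₀m := memLp_timeVol_of_continuousOn hY₀c 2
  have hYlim := tendsto_toLp_of_tendstoUniformlyOn (fun k => (hp k).continuousOn) hY₀c hY₀
  -- identification of the limit of the nonlinear term
  obtain ⟨G₀, hG₀, hGw⟩ := exists_weak_limit_superposition_slice hg.continuous
    -- the resolvents `J k (Y k)`, which have the same limit as `Y k`, and `γ k = g(J k (Y k))`
    (p := fun k => (hYm k).toLp (Y k) - l k • (hγm k).toLp (γ k)) (p₀ := hY₀m.toLp Y₀)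
    (by
      have h1 : Tendsto (fun k => l k • (hγm k).toLp (γ k)) atTop (𝓝 0) := by
        refine squeeze_zero_norm (a := fun k => l k * √Γ) (fun k => ?_)
          (by simpa using hl0.mul_const √Γ)
        rw [norm_smul, Real.norm_of_nonneg (hl k).le]
        exact mul_le_mul_of_nonneg_left (Real.le_sqrt_of_sq_le (hΓ k)) (hl k).le
      simpa using hYlim.sub h1)
    (G := fun k => (hγm k).toLp (γ k)) (fun k => by
      filter_upwards [Lp.coeFn_sub ((hYm k).toLp (Y k)) (l k • (hγm k).toLp (γ k)),
        Lp.coeFn_smul (l k) ((hγm k).toLp (γ k)), (hYm k).coeFn_toLp, (hγm k).coeFn_toLp]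
        with t e1 e2 e3 e4
      rw [e1, Pi.sub_apply, e2, Pi.smul_apply, e3, e4]
      filter_upwards [Lp.coeFn_sub (Y k t) (l k • γ k t), Lp.coeFn_smul (l k) (γ k t),
        (hβ k).coeFn_comp (Y k t)] with x h1 h2 h3
      rw [h1, Pi.sub_apply, h2, Pi.smul_apply, hγdef]
      simp only
      rw [h3, Function.comp_apply, smul_eq_mul]
      congr 1
      linarith [hJ k (Y k t x)])
    (C := √Γ) (fun k => Real.le_sqrt_of_sq_le (hΓ k))
  have hpath : IsPath H10.fn T y₀ (fun t => dualEmb H10.fn (u t) - hA.op (y₀ t) -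
      dualEmb H10.fn ((G₀ - Λ • hY₀m.toLp Y₀ : Lp (L2 Ω) 2 (timeVol T)) t)) Y₀ := by
    set F := G₀ - Λ • hY₀m.toLp Y₀ with hF
    have hq : ∀ {q : Lp (L2 Ω) 2 (timeVol T)}, MemLp (fun t => dualEmb H10.fn (q t)) 2
        (timeVol T) := fun {q} => (dualEmb H10.fn).comp_memLp' (Lp.memLp q)
    have hp' : ∀ k, IsPath H10.fn T (y k) (fun t => dualEmb H10.fn (u t) - hA.op (y k t) -
        dualEmb H10.fn (((hγm k).toLp (γ k) - Λ • (hYm k).toLp (Y k) :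
          Lp (L2 Ω) 2 (timeVol T)) t)) (Y k) := fun k => by
      refine (hp k).congr_deriv ?_
      filter_upwards [Lp.coeFn_sub ((hγm k).toLp (γ k)) (Λ • (hYm k).toLp (Y k)),
        Lp.coeFn_smul Λ ((hYm k).toLp (Y k)), (hYm k).coeFn_toLp, (hγm k).coeFn_toLp]
        with t e1 e2 e3 e4
      rw [e1, Pi.sub_apply, e2, Pi.smul_apply, e3, e4]
    refine IsPath.of_tendsto hp' hy₀m ((hq.sub (hA.op.comp_memLp' hy₀m)).sub hq) hY₀c hae
      (fun t ht => hY₀.tendsto_at ht) fun t ht w => ?_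
    have e1 : ∀ (q : Lp (L2 Ω) 2 (timeVol T)) (r : ℝ → H10 Ω), MemLp r 2 (timeVol T) →
        ∫ s in 0..t, (dualEmb H10.fn (u s) - hA.op (r s) - dualEmb H10.fn (q s)) w =
          (∫ s in 0..t, inner ℝ (u s) (H10.fn w)) - (∫ s in 0..t, hA.op (r s) w) -
            ∫ s in 0..t, inner ℝ (q s) (H10.fn w) := fun q r hr => by
      have hi : ∀ {ζ : ℝ → Hm1 Ω}, MemLp ζ 2 (timeVol T) →
          IntervalIntegrable (fun s => ζ s w) volume 0 t := fun hζ =>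
        intervalIntegrable_zero_of_mem (memLp_timeVol_integrableOn
          ((ContinuousLinearMap.apply ℝ ℝ w).comp_memLp' hζ)) ht
      simp only [sub_apply]
      have i1 := hi (hq (q := u))
      have i2 := hi (ζ := fun s => hA.op (r s)) (hA.op.comp_memLp' hr)
      have i3 := hi (hq (q := q))
      rw [intervalIntegral.integral_sub (i1.sub i2) i3, intervalIntegral.integral_sub i1 i2]
      rfl
    simp_rw [e1 _ _ (hp _).memLp, e1 _ _ hy₀m]
    have hle : timeVol t ≤ timeVol T := Measure.restrict_mono (Ioo_subset_Ioo_right ht.2) le_rfl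
    have e2 := tendsto_integral_bilin hA.op (fun k => (hp k).memLp.mono_measure hle)
      (hy₀m.mono_measure hle)
      (memLp_timeVol_of_continuousOn (T := t) (f := fun _ => w) continuousOn_const 2)
      (tendsto_of_tendsto_of_tendsto_of_le_of_le tendsto_const_nhds hy₀ (fun _ => zero_le)
        fun k => eLpNorm_mono_measure _ hle)
    simp only [setIntegral_timeVol_eq ht.1] at e2
    refine (e2.const_sub _).sub ?_
    simp only [← inner_indicator_Ioo le_rfl ht.1 ht.2, hF, inner_sub_right]
    exact (hGw _).sub (tendsto_const_nhds.inner (hYlim.const_smul Λ))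
  refine ⟨y₀, G₀ - Λ • hY₀m.toLp Y₀, Y₀, ⟨hpath, ?_⟩, ?_, ?_⟩
  · filter_upwards [hG₀, Lp.coeFn_sub G₀ (Λ • hY₀m.toLp Y₀), Lp.coeFn_smul Λ (hY₀m.toLp Y₀),
      hY₀m.coeFn_toLp] with t e1 e2 e3 e4
    rw [e2, Pi.sub_apply, e3, Pi.smul_apply, e4]
    rw [e4] at e1
    filter_upwards [e1, Lp.coeFn_sub (G₀ t) (Λ • Y₀ t), Lp.coeFn_smul Λ (Y₀ t)] with x h1 h2 h3
    rw [h2, Pi.sub_apply, h1, h3, Pi.smul_apply, hgdef, smul_eq_mul]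
    simp
  · have h0 : (0 : ℝ) ∈ Icc 0 T := ⟨le_rfl, hT.le⟩
    refine tendsto_nhds_unique (hY₀.tendsto_at h0) ?_
    simp only [hY0]
    rw [tendsto_iff_norm_sub_tendsto_zero]
    exact squeeze_zero (fun _ => norm_nonneg _) hv (by simpa using hl0.pow 2)
  · rw [sub_add_cancel]
    -- the bound for the nonlinear term is preserved by weak convergence: test with `G₀` itself
    have h0 : Tendsto (fun k => ‖u + Λ • (hYm k).toLp (Y k)‖) atTop
        (𝓝 ‖u + Λ • hY₀m.toLp Y₀‖) :=
      (tendsto_const_nhds.add (hYlim.const_smul Λ)).norm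
    have h1 : Tendsto (fun k => 1 / 2 * ‖G₀‖ ^ 2 + 1 / 2 * (2 * ((l k + L * N) * (N + l k ^ 2)) +
        ‖u + Λ • (hYm k).toLp (Y k)‖ ^ 2)) atTop (𝓝 (1 / 2 * ‖G₀‖ ^ 2 + 1 / 2 *
          (2 * L * N ^ 2 + ‖u + Λ • hY₀m.toLp Y₀‖ ^ 2))) :=
      ((hpot0.add (h0.pow 2)).const_mul _).const_add _
    have hle : ∀ k, inner ℝ G₀ ((hγm k).toLp (γ k)) ≤ 1 / 2 * ‖G₀‖ ^ 2 +
        1 / 2 * (2 * ((l k + L * N) * (N + l k ^ 2)) + ‖u + Λ • (hYm k).toLp (Y k)‖ ^ 2) :=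
      fun k => by
        have h3 := real_inner_le_norm G₀ ((hγm k).toLp (γ k))
        have h4 : ‖(hγm k).toLp (γ k)‖ ^ 2 ≤ 2 * potential (g ∘ J k) (H10.fn (v k)) +
          ‖u + Λ • (hYm k).toLp (Y k)‖ ^ 2 := hγ k
        have h5 := hpot k
        have h6 := two_mul_le_add_sq ‖G₀‖ ‖(hγm k).toLp (γ k)‖
        linarith
    have h2 := le_of_tendsto_of_tendsto' (hGw G₀) h1 hle
    rw [real_inner_self_eq_norm_sq] at h2
    linarith

end Existence

end SemilinearParabolic

namespace SemilinearParabolic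

/-! ### Products of weakly convergent sequences -/

section WeakConvergence

/-- Weak convergence, tested with functionals. -/
theorem weaklyTendsto_iff {X : Type*} [NormedAddCommGroup X] [NormedSpace ℝ X] {x : ℕ → X} {z : X} :
    WeaklyTendsto x z ↔ ∀ ℓ : StrongDual ℝ X, Tendsto (fun k => ℓ (x k)) atTop (𝓝 (ℓ z)) := by
  unfold WeaklyTendsto
  have hinj : Function.Injective ((topDualPairing ℝ X).flip) := fun a b h => by
    refine (SeparatingDual.eq_iff_forall_dual_eq (R := ℝ)).2 fun ℓ => ?_
    exact DFunLike.congr_fun h ℓ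
  exact WeakBilin.tendsto_iff_forall_eval_tendsto _ hinj

theorem weaklyTendsto_iff_inner {X : Type*} [NormedAddCommGroup X] [InnerProductSpace ℝ X]
    [CompleteSpace X] {x : ℕ → X} {z : X} :
    WeaklyTendsto x z ↔ ∀ w : X, Tendsto (fun k => inner ℝ w (x k)) atTop (𝓝 (inner ℝ w z)) := by
  rw [weaklyTendsto_iff]
  constructor
  · intro h w
    exact h (innerSL ℝ w)
  · intro h ℓ
    have := h ((toDual ℝ X).symm ℓ)
    simpa using this

theorem exists_bound_of_weaklyTendsto {X : Type*} [NormedAddCommGroup X] [InnerProductSpace ℝ X]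
    [CompleteSpace X] {x : ℕ → X} {z : X} (h : WeaklyTendsto x z) : ∃ C, ∀ k, ‖x k‖ ≤ C := by
  rw [weaklyTendsto_iff_inner] at h
  obtain ⟨C, hC⟩ := banach_steinhaus (g := fun k => innerSL ℝ (x k)) fun w => by
    obtain ⟨C, hC⟩ := (Metric.isBounded_range_of_tendsto _ (h w)).exists_norm_le
    refine ⟨C, fun k => ?_⟩
    rw [innerSL_apply_apply, real_inner_comm]
    exact hC _ (mem_range_self k)
  exact ⟨C, fun k => by simpa using hC k⟩

end WeakConvergence

section CompensatedProduct

variable {V H : Type*} [NormedAddCommGroup V] [InnerProductSpace ℝ V]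
  [NormedAddCommGroup H] [InnerProductSpace ℝ H] {j : V →L[ℝ] H} {T : ℝ}

variable [CompleteSpace H]

theorem abs_integral_mul_le_sqrt_mul_sqrt {α : Type*} [MeasurableSpace α] {μ : Measure α}
    {f g : α → ℝ} (hf : MemLp f 2 μ) (hg : MemLp g 2 μ) :
    |∫ x, f x * g x ∂μ| ≤ √(∫ x, ‖f x‖ ^ 2 ∂μ) * √(∫ x, ‖g x‖ ^ 2 ∂μ) := by
  rw [← norm_toLp_two_sq hf, ← norm_toLp_two_sq hg, Real.sqrt_sq (norm_nonneg _),
    Real.sqrt_sq (norm_nonneg _)]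
  refine le_trans (le_of_eq ?_) (abs_real_inner_le_norm (hf.toLp f) (hg.toLp g))
  rw [L2.inner_def]
  congr 1
  refine integral_congr_ae ?_
  filter_upwards [hf.coeFn_toLp, hg.coeFn_toLp] with x h1 h2
  rw [h1, h2]
  exact mul_comm _ _

/-- For one test element: the factor that converges weakly is integrated in time, which makes it
converge strongly, and the derivative falls on the path. -/
theorem tendsto_integral_inner_mul_inner {D : ℕ → Lp H 2 (timeVol T)} (hD : WeaklyTendsto D 0)
    {w : ℕ → ℝ → V} {ζ : ℕ → ℝ → StrongDual ℝ V} {W : ℕ → ℝ → H}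
    (hp : ∀ k, IsPath j T (w k) (ζ k) (W k)) (hW0 : ∀ k, W k 0 = 0) {B : ℝ}
    (hζ : ∀ k, ∫ s in 0..T, ‖ζ k s‖ ^ 2 ≤ B) {t : ℝ} (ht : t ∈ Icc 0 T) (h : H) (p : V) :
    Tendsto (fun k => ∫ s in 0..t, inner ℝ (D k s) h * inner ℝ (W k s) (j p)) atTop (𝓝 0) := by
  obtain ⟨C, hC⟩ := exists_bound_of_weaklyTendsto hD
  have hD' := weaklyTendsto_iff_inner.1 hD
  have hle : timeVol t ≤ timeVol T := Measure.restrict_mono (Ioo_subset_Ioo_right ht.2) le_rfl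
  -- the primitive of the weakly convergent factor tends to zero pointwise and boundedly
  set A : ℕ → ℝ → ℝ := fun k r => ∫ s in r..t, inner ℝ (D k s) h with hA
  have hDh : ∀ k, MemLp (fun s => (inner ℝ (D k s) h : ℝ)) 2 (timeVol t) := fun k =>
    ((Lp.memLp (D k)).inner_const h).mono_measure hle
  have hζp : ∀ k, MemLp (fun r => ζ k r p) 2 (timeVol t) := fun k =>
    ((ContinuousLinearMap.apply ℝ ℝ p).comp_memLp' (hp k).memLp_deriv).mono_measure hle
  have hAc : ∀ k, ContinuousOn (A k) (Icc 0 t) := fun k => by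
    have h1 := memLp_timeVol_integrableOn (hDh k)
    have h2 : ContinuousOn (fun r => (∫ s in 0..t, inner ℝ (D k s) h) -
        ∫ s in 0..r, (inner ℝ (D k s) h : ℝ)) (Icc 0 t) := by
      refine continuousOn_const.sub ?_
      rw [← uIcc_of_le ht.1]
      refine intervalIntegral.continuousOn_primitive_interval ?_
      rw [uIcc_of_le ht.1]
      exact (integrableOn_Icc_iff_integrableOn_Ioo).2 h1
    refine h2.congr fun r hr => ?_
    exact (intervalIntegral.integral_interval_sub_left
      (intervalIntegrable_zero_of_mem h1 ⟨ht.1, le_rfl⟩) (intervalIntegrable_zero_of_mem h1 hr)).symm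
  have hAL := fun k => memLp_timeVol_of_continuousOn (hAc k) 2
  have hAr : ∀ k, ∀ r ∈ Ioo 0 t, A k r = inner ℝ (indicatorConstLp 2
      (measurableSet_Ioo (a := r) (b := t)) (measure_ne_top (timeVol T) _) h) (D k) :=
    fun k r hr => (inner_indicator_Ioo hr.1.le hr.2.le ht.2 h (D k)).symm
  have hlim : Tendsto (fun k => ∫ r, ‖A k r‖ ^ 2 ∂timeVol t) atTop (𝓝 0) := by
    have h0 : (0 : ℝ) = ∫ r, (0 : ℝ) ∂timeVol t := by simp
    rw [h0]
    refine tendsto_integral_of_dominated_convergence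
      (fun _ => (‖h‖ * (timeVol T).real univ ^ (1 / (2 : ℝ≥0∞).toReal) * C) ^ 2)
      (fun k => ((hAL k).1.norm.pow 2)) (integrable_const _) (fun k => ?_) ?_
    · filter_upwards [ae_restrict_mem measurableSet_Ioo] with r hr
      rw [hAr k r hr, norm_pow, norm_norm]
      refine pow_le_pow_left₀ (norm_nonneg _) ((norm_inner_le_norm _ _).trans ?_) 2
      refine mul_le_mul ?_ (hC k) (norm_nonneg _) (by positivity)
      refine norm_indicatorConstLp_le.trans ?_
      gcongr
      · exact measure_ne_top _ _
      · exact subset_univ _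
    · filter_upwards [ae_restrict_mem measurableSet_Ioo] with r hr
      have h1 := (hD' (indicatorConstLp 2 (measurableSet_Ioo (a := r) (b := t))
        (measure_ne_top (timeVol T) _) h)).norm.pow 2
      rw [inner_zero_right, norm_zero, zero_pow two_ne_zero] at h1
      simpa only [hAr _ r hr] using h1
  have hb : ∀ k, ∫ r, ‖ζ k r p‖ ^ 2 ∂timeVol t ≤ ‖p‖ ^ 2 * B := fun k => by
    have hT0 : 0 ≤ T := ht.1.trans ht.2
    have h1 : Integrable (fun r => ‖p‖ ^ 2 * ‖ζ k r‖ ^ 2) (timeVol T) :=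
      (memLp_two_norm_sq_integrable (hp k).memLp_deriv).const_mul _
    calc ∫ r, ‖ζ k r p‖ ^ 2 ∂timeVol t ≤ ∫ r, ‖p‖ ^ 2 * ‖ζ k r‖ ^ 2 ∂timeVol t := by
          refine integral_mono (memLp_two_norm_sq_integrable (hζp k)) (h1.mono_measure hle)
            fun r => ?_
          simp only
          rw [← mul_pow, mul_comm ‖p‖]
          exact pow_le_pow_left₀ (norm_nonneg _) ((ζ k r).le_opNorm p) 2
      _ ≤ ∫ r, ‖p‖ ^ 2 * ‖ζ k r‖ ^ 2 ∂timeVol T :=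
          integral_mono_measure hle (Eventually.of_forall fun r => by positivity) h1
      _ ≤ ‖p‖ ^ 2 * B := by
          rw [integral_const_mul, setIntegral_timeVol_eq hT0]
          exact mul_le_mul_of_nonneg_left (hζ k) (sq_nonneg _)
  -- the path is the primitive of its derivative; interchange the integrals
  have key : ∀ k, ∫ s in 0..t, inner ℝ (D k s) h * inner ℝ (W k s) (j p) =
      ∫ r, A k r * ζ k r p ∂timeVol t := fun k => by
    have h1 := integral_bilin_primitive (ContinuousLinearMap.mul ℝ ℝ) ht.1
      (memLp_timeVol_integrableOn (hDh k)) (memLp_timeVol_integrableOn (hζp k))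
    rw [setIntegral_timeVol_eq ht.1]
    refine Eq.trans ?_ h1
    refine intervalIntegral.integral_congr fun s hs => ?_
    rw [uIcc_of_le ht.1] at hs
    have hs' : s ∈ Icc 0 T := ⟨hs.1, hs.2.trans ht.2⟩
    have h2 := DFunLike.congr_fun ((hp k).primitive s hs') p
    rw [hW0, map_zero, zero_add, ContinuousLinearMap.intervalIntegral_apply
      (intervalIntegrable_zero_of_mem (memLp_timeVol_integrableOn (hp k).memLp_deriv) hs')] at h2
    simp only [ContinuousLinearMap.mul_apply']
    rw [← h2]
    rfl
  simp only [key]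
  refine squeeze_zero_norm (a := fun k => √(∫ r, ‖A k r‖ ^ 2 ∂timeVol t) * √(‖p‖ ^ 2 * B))
    (fun k => ?_) ?_
  · exact (abs_integral_mul_le_sqrt_mul_sqrt (hAL k) (hζp k)).trans
      (mul_le_mul_of_nonneg_left (Real.sqrt_le_sqrt (hb k)) (Real.sqrt_nonneg _))
  · have h1 := ((Real.continuous_sqrt.tendsto 0).comp hlim).mul_const √(‖p‖ ^ 2 * B)
    simpa using h1

/-- If the embedding `j` is approximated in norm by operators of finite rank, a weakly null
sequence tested with a bounded sequence of paths starting at `0` gives a null sequence. -/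
theorem tendsto_integral_inner_path {ι : Type*}
    (hj : ∀ ε : ℝ, 0 < ε → ∃ (S : Finset ι) (p : ι → V) (g : ι → H),
      ∀ v, ‖j v - ∑ m ∈ S, inner ℝ (j (p m)) (j v) • g m‖ ≤ ε * ‖v‖)
    {D : ℕ → Lp H 2 (timeVol T)} (hD : WeaklyTendsto D 0)
    {w : ℕ → ℝ → V} {ζ : ℕ → ℝ → StrongDual ℝ V} {W : ℕ → ℝ → H}
    (hp : ∀ k, IsPath j T (w k) (ζ k) (W k)) (hW0 : ∀ k, W k 0 = 0) {B : ℝ}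
    (hw : ∀ k, ∫ s in 0..T, ‖w k s‖ ^ 2 ≤ B) (hζ : ∀ k, ∫ s in 0..T, ‖ζ k s‖ ^ 2 ≤ B)
    {t : ℝ} (ht : t ∈ Icc 0 T) :
    Tendsto (fun k => ∫ s in 0..t, inner ℝ (D k s) (W k s)) atTop (𝓝 0) := by
  obtain ⟨C, hC⟩ := exists_bound_of_weaklyTendsto hD
  have hT : 0 ≤ T := ht.1.trans ht.2
  have hB : 0 ≤ B := (intervalIntegral.integral_nonneg hT fun _ _ => by positivity).trans (hw 0)
  rw [Metric.tendsto_atTop]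
  intro ε hε
  -- the accuracy of the finite-rank approximation
  set δ := ε / (C ^ 2 + B + 1) with hδ
  have hδ0 : 0 < δ := by positivity
  obtain ⟨S, p, g, hS⟩ := hj δ hδ0
  have hfin : Tendsto (fun k => ∑ m ∈ S, ∫ s in 0..t, inner ℝ (D k s) (g m) *
      inner ℝ (W k s) (j (p m))) atTop (𝓝 0) := by
    have := tendsto_finsetSum S fun m _ =>
      tendsto_integral_inner_mul_inner hD hp hW0 hζ ht (g m) (p m)
    simpa using this
  obtain ⟨N, hN⟩ := (Metric.tendsto_atTop.1 hfin) (ε / 2) (half_pos hε)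
  refine ⟨N, fun k hk => ?_⟩
  have hDm : MemLp (fun s => D k s) 2 (timeVol T) := Lp.memLp (D k)
  have hWm := memLp_timeVol_of_continuousOn (hp k).continuousOn 2
  have i1 : IntegrableOn (fun s => (inner ℝ (D k s) (W k s) : ℝ)) (Ioo 0 T) :=
    memLp_two_bilin_integrable (innerSL ℝ) hDm hWm
  have i2 : ∀ m, IntegrableOn (fun s => (inner ℝ (D k s) (g m) * inner ℝ (W k s) (j (p m)) : ℝ))
      (Ioo 0 T) := fun m => memLp_two_bilin_integrable (ContinuousLinearMap.mul ℝ ℝ)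
        (hDm.inner_const (g m)) (hWm.inner_const (j (p m)))
  have i3 : IntegrableOn (fun s => ‖D k s‖ ^ 2) (Ioo 0 T) := memLp_two_norm_sq_integrable hDm
  have i4 : IntegrableOn (fun s => ‖w k s‖ ^ 2) (Ioo 0 T) :=
    memLp_two_norm_sq_integrable (hp k).memLp
  have hsum : IntegrableOn (fun s => ∑ m ∈ S, inner ℝ (D k s) (g m) * inner ℝ (W k s) (j (p m)))
      (Ioo 0 T) := integrable_finsetSum S fun m _ => i2 m
  have hdiff : |(∫ s in 0..t, inner ℝ (D k s) (W k s)) - ∑ m ∈ S, ∫ s in 0..t,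
      inner ℝ (D k s) (g m) * inner ℝ (W k s) (j (p m))| ≤ δ / 2 * (C ^ 2 + B) := by
    rw [← intervalIntegral.integral_finsetSum fun m _ => intervalIntegrable_zero_of_mem (i2 m) ht,
      ← intervalIntegral.integral_sub (intervalIntegrable_zero_of_mem i1 ht)
        (intervalIntegrable_zero_of_mem hsum ht)]
    refine (intervalIntegral.abs_integral_le_integral_abs ht.1).trans ?_
    have i5 : IntegrableOn (fun s => δ / 2 * (‖D k s‖ ^ 2 + ‖w k s‖ ^ 2)) (Ioo 0 T) :=
      (i3.add i4).const_mul _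
    refine (intervalIntegral_mono_timeVol (i1.sub hsum).abs i5 ?_ ht).trans ?_
    · filter_upwards [(hp k).ae_eq] with s hs
      simp only [Pi.sub_apply]
      have h1 : inner ℝ (D k s) (W k s) - ∑ m ∈ S, inner ℝ (D k s) (g m) *
          inner ℝ (W k s) (j (p m)) = (inner ℝ (D k s) (j (w k s) -
            ∑ m ∈ S, inner ℝ (j (p m)) (j (w k s)) • g m) : ℝ) := by
        rw [inner_sub_right, inner_sum, hs]
        congr 1
        refine Finset.sum_congr rfl fun m _ => ?_
        rw [inner_smul_right, mul_comm, real_inner_comm]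
      rw [h1]
      refine (abs_real_inner_le_norm _ _).trans ?_
      refine (mul_le_mul_of_nonneg_left (hS (w k s)) (norm_nonneg _)).trans ?_
      nlinarith [mul_nonneg hδ0.le (sq_nonneg (‖D k s‖ - ‖w k s‖))]
    · refine (intervalIntegral_le_of_nonneg i5 (fun s => by positivity) ht).trans ?_
      rw [intervalIntegral.integral_const_mul, intervalIntegral.integral_add
        (intervalIntegrable_zero_of_mem i3 ⟨hT, le_rfl⟩)
        (intervalIntegrable_zero_of_mem i4 ⟨hT, le_rfl⟩), ← norm_Lp_sq_intervalIntegral hT]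
      have h2 := pow_le_pow_left₀ (norm_nonneg _) (hC k) 2
      have h3 := hw k
      gcongr
  have h1 := hN k hk
  rw [dist_zero_right, Real.norm_eq_abs] at h1 ⊢
  have h2 : δ / 2 * (C ^ 2 + B) < ε / 2 := by
    have h3 : δ * (C ^ 2 + B + 1) = ε := by rw [hδ]; field_simp
    nlinarith
  have h3 := abs_sub_abs_le_abs_sub (∫ s in 0..t, inner ℝ (D k s) (W k s))
    (∑ m ∈ S, ∫ s in 0..t, inner ℝ (D k s) (g m) * inner ℝ (W k s) (j (p m)))
  linarith

end CompensatedProduct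

end SemilinearParabolic

namespace SemilinearParabolic

/-! ### Uniqueness -/

section Uniqueness

variable {n : ℕ} {Ω : BoundedDomain n} {T : ℝ} {a : Fin n → Fin n → Sp n → ℝ} {a₀ : Sp n → ℝ}
  {f : ℝ → ℝ}

theorem Lp_locallyIntegrableOn (p : L2 Ω) :
    LocallyIntegrableOn p (Ω.carrier : Set (Sp n)) := by
  have hfin := isFiniteMeasure_vol Ω
  have h1 : IntegrableOn p (Ω.carrier : Set (Sp n)) := (Lp.memLp p).integrable (by norm_num)
  exact h1.locallyIntegrableOn

theorem dualEmb_ofTest (p : L2 Ω) (φ : Ω.Test) :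
    dualEmb H10.fn p (H10.ofTest φ) = ∫ x, p x * φ x ∂Ω.vol := by
  rw [dualEmb_apply, L2.inner_def]
  refine integral_congr_ae ?_
  filter_upwards [H10.fn_ofTest φ] with x h1
  rw [h1]
  exact mul_comm _ _

theorem integral_op_add_mul_test (hA : IsEllipticOperator Ω a a₀) (v : H10 Ω) {G : Sp n → ℝ}
    (hG : LocallyIntegrableOn G (Ω.carrier : Set (Sp n))) (φ : Ω.Test) :
    ∫ x, ((∑ i, ∑ j, a i j x * H10.grad v x i * gradient φ x j) +
      a₀ x * H10.fn v x * φ x + G x * φ x) ∂Ω.vol =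
    hA.op v (H10.ofTest φ) + ∫ x, G x * φ x ∂Ω.vol := by
  rw [integral_add (hA.op_ofTest v φ).1 (integrable_mul_test hG φ), (hA.op_ofTest v φ).2]

/-- The difference of two solutions of the stationary equation `z + A v + f(v) = u` (understood in
the sense of distributions) may be tested with itself, although `f(v)` is only locally integrable:
this is the Brezis–Browder theorem for `f + Λ`. -/
theorem sub_apply_sub_le (hA : IsEllipticOperator Ω a a₀) (hf : ContDiff ℝ 1 f)
    {Λ : ℝ} (hf' : ∀ s, -Λ ≤ deriv f s) {v v' : H10 Ω} {z z' : Hm1 Ω} {b : Ω.Test → ℝ}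
    (hv : LocallyIntegrableOn (fun x => f (H10.fn v x)) (Ω.carrier : Set (Sp n)))
    (hv' : LocallyIntegrableOn (fun x => f (H10.fn v' x)) (Ω.carrier : Set (Sp n)))
    (h : ∀ φ : Ω.Test, z (H10.ofTest φ) +
      ∫ x, ((∑ i, ∑ j, a i j x * H10.grad v x i * gradient φ x j) +
        a₀ x * H10.fn v x * φ x + f (H10.fn v x) * φ x) ∂Ω.vol = b φ)
    (h' : ∀ φ : Ω.Test, z' (H10.ofTest φ) +
      ∫ x, ((∑ i, ∑ j, a i j x * H10.grad v' x i * gradient φ x j) +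
        a₀ x * H10.fn v' x * φ x + f (H10.fn v' x) * φ x) ∂Ω.vol = b φ) :
    (z - z') (v - v') ≤ Λ * ‖H10.fn (v - v')‖ ^ 2 - hA.op (v - v') (v - v') := by
  have hw := Lp_locallyIntegrableOn (H10.fn (v - v'))
  have key := nonneg_of_mul_nonneg (ℓ := -(z - z') - hA.op (v - v') +
      Λ • dualEmb H10.fn (H10.fn (v - v')))
    (G := fun x => f (H10.fn v x) - f (H10.fn v' x) + Λ * H10.fn (v - v') x)
    ((hv.sub hv').add (hw.smul Λ)) (fun φ => ?_) (v := v - v') ?_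
  · rw [add_apply, sub_apply, neg_apply,
      smul_apply, dualEmb_apply, real_inner_self_eq_norm_sq, smul_eq_mul] at key
    linarith
  · have e1 := h φ
    have e2 := h' φ
    rw [integral_op_add_mul_test hA _ hv] at e1
    rw [integral_op_add_mul_test hA _ hv'] at e2
    have i1 := integrable_mul_test hv φ
    have i2 := integrable_mul_test hv' φ
    have i3 := (integrable_mul_test hw φ).const_mul Λ
    have e3 : ∫ x, (f (H10.fn v x) - f (H10.fn v' x) + Λ * H10.fn (v - v') x) * φ x ∂Ω.vol =
        (∫ x, f (H10.fn v x) * φ x ∂Ω.vol) - (∫ x, f (H10.fn v' x) * φ x ∂Ω.vol) +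
          Λ * ∫ x, H10.fn (v - v') x * φ x ∂Ω.vol := by
      have i4 : Integrable (fun x => f (H10.fn v x) * φ x - f (H10.fn v' x) * φ x) Ω.vol :=
        i1.sub i2
      rw [← integral_const_mul, ← integral_sub i1 i2, ← integral_add i4 i3]
      refine integral_congr_ae (Eventually.of_forall fun x => ?_)
      simp only
      ring
    rw [e3, add_apply, sub_apply, neg_apply,
      smul_apply, dualEmb_ofTest, smul_eq_mul, sub_apply, map_sub,
      sub_apply]
    linarith
  · have e1 : H10.fn (v - v') =ᵐ[Ω.vol] fun x => H10.fn v x - H10.fn v' x := by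
      rw [map_sub]; exact Lp.coeFn_sub _ _
    filter_upwards [e1] with x hx
    rw [hx]
    have := monotone_mul_sub_nonneg (monotone_add_mul hf hf') (H10.fn v x) (H10.fn v' x)
    linarith

theorem W.val_sub (y y' : W Ω T) : W.val (y - y') = W.val y - W.val y' := rfl

/-- An element of `W(0,T)` is determined by its values, as a distributional derivative is unique. -/
theorem W.eq_zero_of_val_eq_zero {y : W Ω T} (h : W.val y = 0) : y = 0 := by
  have h2 : W.timeDeriv y = 0 := by
    have hz : LocallyIntegrableOn (W.timeDeriv y) (Ioo 0 T) := by
      have h1 : IntegrableOn (W.timeDeriv y) (Ioo 0 T) :=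
        memLp_timeVol_integrableOn (Lp.memLp (W.timeDeriv y))
      exact h1.locallyIntegrableOn
    have h3 := isOpen_Ioo.ae_eq_zero_of_integral_contDiff_smul_eq_zero hz fun g hg hgc hgs => by
      have h4 := y.2 ⟨g, hg, hgc, hgs⟩
      have h5 : ∫ t in Ioo 0 T, deriv g t • H10.toHm1 (W.val y t) = 0 := by
        refine integral_eq_zero_of_ae ?_
        rw [h]
        filter_upwards [Lp.coeFn_zero (H10 Ω) 2 (timeVol T)] with t ht
        rw [ht, Pi.zero_apply, map_zero, smul_zero]
        rfl
      have h6 : ∫ t in Ioo 0 T, g t • W.timeDeriv y t = 0 := by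
        rw [← neg_eq_zero]
        exact h4.symm.trans h5
      rwa [setIntegral_eq_integral_of_forall_compl_eq_zero fun t ht => by
        rw [image_eq_zero_of_notMem_tsupport fun h' => ht (hgs h'), zero_smul]] at h6
    refine Lp.ext ?_
    filter_upwards [(ae_restrict_iff' measurableSet_Ioo).2 h3,
      Lp.coeFn_zero (Hm1 Ω) 2 (timeVol T)] with t e1 e2
    rw [e1, e2, Pi.zero_apply]
  refine Subtype.ext ?_
  exact WithLp.ofLp_injective 2 (Prod.ext h h2)

/-- A solution in `W(0,T)` is a path, its continuous representative being part of the initial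
condition. -/
theorem IsSolution.exists_isPath (hT : 0 < T) {u : L2Q Ω T} {y₀ : Sp n → ℝ} {y : W Ω T}
    (h : IsSolution a a₀ f u y₀ y) :
    ∃ Y, IsPath H10.fn T (W.val y) (W.timeDeriv y) Y ∧ ⇑(Y 0) =ᵐ[Ω.vol] y₀ := by
  obtain ⟨Y, hY, hae, h0⟩ := h.2
  exact ⟨Y, isPath_of_integral_deriv_smul hT (Lp.memLp _) (Lp.memLp _) hY hae y.2, h0⟩

/-- Uniqueness: the difference of two solutions, tested with itself, satisfies an energy estimate
with zero data. -/
theorem IsSolution.unique (hT : 0 < T) (hA : IsEllipticOperator Ω a a₀) (hf : ContDiff ℝ 1 f)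
    {Λ : ℝ} (hΛ : 0 ≤ Λ) (hf' : ∀ s, -Λ ≤ deriv f s) {u : L2Q Ω T} {y₀ : Sp n → ℝ}
    {y y' : W Ω T} (h : IsSolution a a₀ f u y₀ y) (h' : IsSolution a a₀ f u y₀ y') : y = y' := by
  obtain ⟨α, hα, hcoer⟩ := hA.exists_coercive
  obtain ⟨Y, hp, hY0⟩ := h.exists_isPath hT
  obtain ⟨Y', hp', hY0'⟩ := h'.exists_isPath hT
  have hw := hp.sub hp'
  have h0 : Y 0 - Y' 0 = 0 := sub_eq_zero.2 (Lp.ext (hY0.trans hY0'.symm))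
  have hT' : T ∈ Icc 0 T := ⟨hT.le, le_rfl⟩
  have h1 := hw.energy_gronwall hT.le hα.le hΛ (p := fun _ => 0) (ρ := fun _ => 0)
    integrableOn_zero (by
      filter_upwards [h.1, h'.1, hw.ae_eq] with t e1 e2 e3
      have := sub_apply_sub_le hA hf hf' e1.1 e2.1 e1.2 e2.2
      rw [e3]
      have e4 := hcoer (W.val y t - W.val y' t)
      simp only [Pi.sub_apply] at e3 ⊢
      linarith) continuousOn_const (fun _ _ => le_rfl) (fun t _ => by simp [h0]) T hT'
  simp only [intervalIntegral.integral_zero, mul_zero, add_zero] at h1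
  have h2 : ∫ s in 0..T, ‖(⇑(W.val y) - ⇑(W.val y')) s‖ ^ 2 ≤ 0 := by
    by_contra! h3
    have := mul_pos (mul_pos two_pos hα) h3
    linarith [sq_nonneg ‖(Y - Y') T‖]
  have h3 : W.val (y - y') = 0 := by
    have h4 : ‖W.val (y - y')‖ ^ 2 ≤ 0 := by
      rw [norm_Lp_two_sq]
      refine le_trans (le_of_eq ?_) h2
      rw [← setIntegral_timeVol_eq hT.le]
      refine integral_congr_ae ?_
      filter_upwards [Lp.coeFn_sub (W.val y) (W.val y')] with t ht
      rw [W.val_sub, ht]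
    have h5 := pow_eq_zero_iff two_ne_zero |>.1 (le_antisymm h4 (sq_nonneg _))
    exact norm_eq_zero.1 h5
  exact sub_eq_zero.1 (W.eq_zero_of_val_eq_zero h3)

end Uniqueness

/-! ### Solutions as elements of `W(0,T)` -/

section ToW

variable {n : ℕ} {Ω : BoundedDomain n} {T : ℝ} {a : Fin n → Fin n → Sp n → ℝ} {a₀ : Sp n → ℝ}
  {f : ℝ → ℝ}

/-- The element `(y, z)` of `W(0,T)`. -/
noncomputable def IsPath.toW {y : ℝ → H10 Ω} {z : ℝ → Hm1 Ω} {Y : ℝ → L2 Ω}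
    (h : IsPath H10.fn T y z Y) (hT : 0 ≤ T) : W Ω T :=
  ⟨WithLp.toLp 2 (h.memLp.toLp y, h.memLp_deriv.toLp z), fun ψ => by
    have h1 := h.integral_deriv_smul hT ψ
    have e1 : ∫ t in Ioo 0 T, deriv ψ t • H10.toHm1 (h.memLp.toLp y t) =
        ∫ t in Ioo 0 T, deriv ψ t • dualEmb H10.fn (H10.fn (y t)) := by
      refine integral_congr_ae ?_
      filter_upwards [h.memLp.coeFn_toLp] with t ht
      rw [ht]; rfl
    have e2 : ∫ t in Ioo 0 T, ψ t • h.memLp_deriv.toLp z t = ∫ t in Ioo 0 T, ψ t • z t := by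
      refine integral_congr_ae ?_
      filter_upwards [h.memLp_deriv.coeFn_toLp] with t ht
      rw [ht]
    exact e1.trans (h1.trans (congrArg Neg.neg e2.symm))⟩

variable {y : ℝ → H10 Ω} {z : ℝ → Hm1 Ω} {Y : ℝ → L2 Ω}

theorem IsPath.val_toW (h : IsPath H10.fn T y z Y) (hT : 0 ≤ T) :
    W.val (h.toW hT) = h.memLp.toLp y := rfl

theorem IsPath.timeDeriv_toW (h : IsPath H10.fn T y z Y) (hT : 0 ≤ T) :
    W.timeDeriv (h.toW hT) = h.memLp_deriv.toLp z := rfl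

theorem IsPathSolution.isSolution_toW {hA : IsEllipticOperator Ω a a₀}
    {U F : Lp (L2 Ω) 2 (timeVol T)} (h : IsPathSolution hA f U y F Y) (hT : 0 ≤ T) {u : L2Q Ω T}
    (hu : IsSlice u U) {y₀ : Sp n → ℝ} (h0 : ⇑(Y 0) =ᵐ[Ω.vol] y₀) :
    IsSolution a a₀ f u y₀ (h.path.toW hT) := by
  refine ⟨?_, Y, h.path.continuousOn, ?_, h0⟩
  · rw [h.path.val_toW, h.path.timeDeriv_toW]
    filter_upwards [h.path.memLp.coeFn_toLp, h.path.memLp_deriv.coeFn_toLp, h.path.ae_eq,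
      h.superposition, hu] with t e1 e2 e3 e4 e5
    rw [e1, e2, ← e3]
    have hF : F t =ᵐ[Ω.vol] fun x => f (Y t x) := e4
    have hloc : LocallyIntegrableOn (fun x => f (Y t x)) (Ω.carrier : Set (Sp n)) := by
      have hfin := isFiniteMeasure_vol Ω
      have h1 : IntegrableOn (fun x => f (Y t x)) (Ω.carrier : Set (Sp n)) :=
        ((Lp.memLp (F t)).integrable (by norm_num)).congr hF
      exact h1.locallyIntegrableOn
    refine ⟨hloc, fun φ => ?_⟩
    have h2 := integral_op_add_mul_test hA (y t) hloc φ
    rw [← e3] at h2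
    rw [h2, sub_apply, sub_apply, dualEmb_ofTest, dualEmb_ofTest]
    have h3 : ∫ x, F t x * φ x ∂Ω.vol = ∫ x, f (Y t x) * φ x ∂Ω.vol := by
      refine integral_congr_ae ?_
      filter_upwards [hF] with x hx
      rw [hx]
    have h4 : ∫ x, U t x * φ x ∂Ω.vol = ∫ x, u (x, t) * φ x ∂Ω.vol := by
      refine integral_congr_ae ?_
      filter_upwards [e5] with x hx
      rw [hx]
    rw [h3, h4]
    ring
  · filter_upwards [h.path.memLp.coeFn_toLp, h.path.ae_eq] with t e1 e2
    rw [h.path.val_toW, e1, e2]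

theorem IsPathSolution.isSuperposition_toW {hA : IsEllipticOperator Ω a a₀}
    {U F : Lp (L2 Ω) 2 (timeVol T)} (h : IsPathSolution hA f U y F Y) (hT : 0 ≤ T) {g : L2Q Ω T}
    (hg : IsSlice g F) : IsSuperposition f (h.path.toW hT) g := by
  unfold IsSuperposition
  rw [h.path.val_toW]
  filter_upwards [h.path.memLp.coeFn_toLp, h.path.ae_eq, h.superposition, hg] with t e1 e2 e3 e4
  filter_upwards [e3, e4] with x h1 h2
  rw [e1, ← e2, ← h1, h2]

end ToW

end SemilinearParabolic

namespace SemilinearParabolic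

/-! ### The a priori estimate -/

section Estimate

variable {n : ℕ} {Ω : BoundedDomain n} {T : ℝ} {a : Fin n → Fin n → Sp n → ℝ} {a₀ : Sp n → ℝ}
  {f : ℝ → ℝ} {hA : IsEllipticOperator Ω a a₀} {u F u' F' : Lp (L2 Ω) 2 (timeVol T)}
  {y y' : ℝ → H10 Ω} {Y Y' : ℝ → L2 Ω}

/-- `f` is monotone up to the constant `Λ`, as a superposition operator. -/
theorem inner_superposition_sub (hf : ContDiff ℝ 1 f) {Λ : ℝ} (hf' : ∀ s, -Λ ≤ deriv f s)
    {p p' G G' : L2 Ω} (hG : G =ᵐ[Ω.vol] fun x => f (p x)) (hG' : G' =ᵐ[Ω.vol] fun x => f (p' x)) :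
    -(Λ * ‖p - p'‖ ^ 2) ≤ inner ℝ (G - G') (p - p') := by
  have h1 : 0 ≤ inner ℝ (G - G' + Λ • (p - p')) (p - p') := by
    rw [L2.inner_def]
    refine integral_nonneg_of_ae ?_
    filter_upwards [hG, hG', Lp.coeFn_sub G G', Lp.coeFn_sub p p', Lp.coeFn_smul Λ (p - p'),
      Lp.coeFn_add (G - G') (Λ • (p - p'))] with x e1 e2 e3 e4 e5 e6
    rw [e6, Pi.add_apply, e5, Pi.smul_apply, e3, e4, Pi.sub_apply, Pi.sub_apply, e1, e2]
    refine (monotone_mul_sub_nonneg (monotone_add_mul hf hf') (p x) (p' x)).trans (le_of_eq ?_)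
    simp only [RCLike.inner_apply, conj_trivial, smul_eq_mul]
    ring
  rw [inner_add_left, inner_smul_left, real_inner_self_eq_norm_sq] at h1
  simp only [conj_trivial] at h1
  linarith

/-- The equation, as an identity in `L²(0,T;H⁻¹(Ω))`. -/
theorem IsPathSolution.toLp_deriv (h : IsPathSolution hA f u y F Y) :
    h.path.memLp_deriv.toLp _ = (dualEmb H10.fn).compLpL 2 (timeVol T) u -
      hA.op.compLpL 2 (timeVol T) (h.path.memLp.toLp y) -
        (dualEmb H10.fn).compLpL 2 (timeVol T) F := by
  refine Lp.ext ?_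
  filter_upwards [h.path.memLp_deriv.coeFn_toLp, h.path.memLp.coeFn_toLp,
    (dualEmb H10.fn).coeFn_compLpL u, (dualEmb H10.fn).coeFn_compLpL F,
    hA.op.coeFn_compLpL (h.path.memLp.toLp y),
    Lp.coeFn_sub ((dualEmb H10.fn).compLpL 2 (timeVol T) u -
      hA.op.compLpL 2 (timeVol T) (h.path.memLp.toLp y))
        ((dualEmb H10.fn).compLpL 2 (timeVol T) F),
    Lp.coeFn_sub ((dualEmb H10.fn).compLpL 2 (timeVol T) u)
      (hA.op.compLpL 2 (timeVol T) (h.path.memLp.toLp y))] with t e1 e2 e3 e4 e5 e6 e7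
  rw [e1, e6, Pi.sub_apply, e7, Pi.sub_apply, e3, e4, e5, e2]

theorem IsPathSolution.toLp_path (h : IsPathSolution hA f u y F Y) :
    (memLp_timeVol_of_continuousOn h.path.continuousOn 2).toLp Y =
      H10.fn.compLpL 2 (timeVol T) (h.path.memLp.toLp y) := by
  refine Lp.ext ?_
  filter_upwards [(memLp_timeVol_of_continuousOn h.path.continuousOn 2).coeFn_toLp,
    h.path.memLp.coeFn_toLp, H10.fn.coeFn_compLpL (h.path.memLp.toLp y), h.path.ae_eq]
    with t e1 e2 e3 e4
  rw [e1, e3, e2, e4]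

theorem norm_compLpL_apply_le {α E G : Type*} [MeasurableSpace α] {μ : Measure α}
    [NormedAddCommGroup E] [NormedSpace ℝ E] [NormedAddCommGroup G] [NormedSpace ℝ G]
    (B : E →L[ℝ] G) (p : Lp E 2 μ) : ‖B.compLpL 2 μ p‖ ≤ ‖B‖ * ‖p‖ :=
  B.norm_compLp_le p

theorem W.norm_le (w : W Ω T) : ‖w‖ ≤ ‖W.val w‖ + ‖W.timeDeriv w‖ := by
  have h1 : ‖w‖ = √(‖W.val w‖ ^ 2 + ‖W.timeDeriv w‖ ^ 2) := WithLp.prod_norm_eq_of_L2 w.1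
  rw [h1]
  have h2 := mul_nonneg (norm_nonneg (W.val w)) (norm_nonneg (W.timeDeriv w))
  exact Real.sqrt_le_iff.2 ⟨by positivity, by linarith [add_sq ‖W.val w‖ ‖W.timeDeriv w‖]⟩

theorem W.norm_val_le (w : W Ω T) : ‖W.val w‖ ≤ ‖w‖ := by
  have h1 : ‖w‖ = √(‖W.val w‖ ^ 2 + ‖W.timeDeriv w‖ ^ 2) := WithLp.prod_norm_eq_of_L2 w.1
  rw [h1]
  exact Real.le_sqrt_of_sq_le (by nlinarith [sq_nonneg ‖W.timeDeriv w‖])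

theorem W.norm_timeDeriv_le (w : W Ω T) : ‖W.timeDeriv w‖ ≤ ‖w‖ := by
  have h1 : ‖w‖ = √(‖W.val w‖ ^ 2 + ‖W.timeDeriv w‖ ^ 2) := WithLp.prod_norm_eq_of_L2 w.1
  rw [h1]
  exact Real.le_sqrt_of_sq_le (by nlinarith [sq_nonneg ‖W.val w‖])

/-- The energy estimate for a solution. -/
theorem IsPathSolution.energy (h : IsPathSolution hA f u y F Y) (hT : 0 < T)
    (hf : ContDiff ℝ 1 f) (hf0 : f 0 = 0) {Λ : ℝ} (hΛ : 0 ≤ Λ) (hf' : ∀ s, -Λ ≤ deriv f s)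
    {α : ℝ} (hα : 0 < α) (hcoer : ∀ v, α * ‖v‖ ^ 2 ≤ hA.op v v) :
    ∀ t ∈ Icc 0 T, ‖Y t‖ ^ 2 + 2 * α * ∫ s in 0..t, ‖y s‖ ^ 2 ≤
      (‖Y 0‖ ^ 2 + ‖u‖ ^ 2) * (1 + (2 * Λ + 1) * Real.exp ((2 * Λ + 1) * T) * T) := by
  have hu2 : IntegrableOn (fun t => ‖u t‖ ^ 2) (Ioo 0 T) :=
    memLp_two_norm_sq_integrable (Lp.memLp u)
  have h1 := h.path.energy_gronwall hT.le hα.le (c := Λ + 1 / 2) (by positivity)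
    (p := fun t => 1 / 2 * ‖u t‖ ^ 2) (ρ := fun _ => ‖Y 0‖ ^ 2 + ‖u‖ ^ 2)
    (hu2.const_mul _) (by
      filter_upwards [h.path.ae_eq, h.superposition] with t e1 e2
      have e3 := inner_superposition_sub hf hf' e2 (p' := 0) (G' := 0) (by
        filter_upwards [Lp.coeFn_zero ℝ 2 Ω.vol] with x hx
        rw [hx, Pi.zero_apply, hf0])
      rw [sub_zero, sub_zero] at e3
      rw [sub_apply, sub_apply, dualEmb_apply, dualEmb_apply, ← e1]
      have e4 := hcoer (y t)
      have e5 := real_inner_le_norm (u t) (Y t)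
      nlinarith [sq_nonneg (‖u t‖ - ‖Y t‖)]) continuousOn_const
    (fun _ _ => by positivity) (fun t ht => by
      have e1 := intervalIntegral_le_of_nonneg hu2 (fun t => by positivity) ht
      rw [intervalIntegral.integral_const_mul, norm_Lp_sq_intervalIntegral hT.le u]
      linarith)
  intro t ht
  refine (h1 t ht).trans_eq ?_
  rw [intervalIntegral.integral_const, smul_eq_mul, show 2 * (Λ + 1 / 2) = 2 * Λ + 1 by ring]
  ring

theorem sqrt_mul_le_of_sq_le {x c σ : ℝ} (hσ : 0 ≤ σ) (h : x ^ 2 ≤ c * σ ^ 2) : x ≤ √c * σ := by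
  rcases le_total 0 c with hc | hc
  · refine le_trans (Real.le_sqrt_of_sq_le h) ?_
    rw [Real.sqrt_mul hc, Real.sqrt_sq hσ]
  · have h1 : x ^ 2 ≤ 0 := h.trans (mul_nonpos_of_nonpos_of_nonneg hc (sq_nonneg σ))
    have h2 : x = 0 := pow_eq_zero_iff two_ne_zero |>.1 (le_antisymm h1 (sq_nonneg x))
    rw [h2]
    positivity

/-- The estimate in `W(0,T)`, linear in the data. The initial value enters the constant only through
the number `L` in the bound for the nonlinear term. -/
theorem exists_norm_le (hT : 0 < T) (hA : IsEllipticOperator Ω a a₀)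
    (hf : ContDiff ℝ 1 f) (hf0 : f 0 = 0) {Λ : ℝ} (hΛ : 0 ≤ Λ) (hf' : ∀ s, -Λ ≤ deriv f s) :
    ∃ K : ℝ → ℝ, ∀ L, 0 ≤ L → 0 ≤ K L ∧
      ∀ (u : Lp (L2 Ω) 2 (timeVol T)) (y : ℝ → H10 Ω) (F : Lp (L2 Ω) 2 (timeVol T))
        (Y : ℝ → L2 Ω) (h : IsPathSolution hA f u y F Y),
        ‖F + Λ • (memLp_timeVol_of_continuousOn h.path.continuousOn 2).toLp Y‖ ^ 2 ≤
          2 * L * ‖Y 0‖ ^ 2 +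
            ‖u + Λ • (memLp_timeVol_of_continuousOn h.path.continuousOn 2).toLp Y‖ ^ 2 →
        ‖h.path.toW hT.le‖ + ‖F‖ ≤ K L * (‖u‖ + ‖Y 0‖) := by
  obtain ⟨α, hα, hcoer⟩ := hA.exists_coercive
  set E := 1 + (2 * Λ + 1) * Real.exp ((2 * Λ + 1) * T) * T with hE
  set R := ‖dualEmb (H10.fn (Ω := Ω))‖
  set J := ‖(H10.fn (Ω := Ω))‖
  set A := ‖hA.op‖
  set k₁ := √(E / (2 * α)) with hk₁
  refine ⟨fun L => k₁ + (R * 1 + A * k₁ + R * (√(2 * L) + 1 + 2 * Λ * (J * k₁))) +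
    (√(2 * L) + 1 + 2 * Λ * (J * k₁)), fun L hL => ⟨by positivity, fun u y F Y h hF => ?_⟩⟩
  set σ := ‖u‖ + ‖Y 0‖ with hσ
  have hσ0 : 0 ≤ σ := by positivity
  have huσ : ‖u‖ ≤ σ := by rw [hσ]; linarith [norm_nonneg (Y 0)]
  have hYσ : ‖Y 0‖ ≤ σ := by rw [hσ]; linarith [norm_nonneg u]
  have hE0 : 0 ≤ E := by positivity
  have h1 : ‖h.path.memLp.toLp y‖ ≤ k₁ * σ := by
    refine sqrt_mul_le_of_sq_le hσ0 ?_
    have h2 := h.energy hT hf hf0 hΛ hf' hα hcoer T ⟨hT.le, le_rfl⟩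
    rw [← norm_toLp_sq_intervalIntegral hT.le h.path.memLp] at h2
    have h3 : ‖Y 0‖ ^ 2 + ‖u‖ ^ 2 ≤ σ ^ 2 := by
      rw [hσ]; nlinarith [mul_nonneg (norm_nonneg u) (norm_nonneg (Y 0))]
    have h4 : 2 * α * ‖h.path.memLp.toLp y‖ ^ 2 ≤ σ ^ 2 * E := by
      have := mul_le_mul_of_nonneg_right h3 hE0
      linarith [sq_nonneg ‖Y T‖]
    rw [div_mul_eq_mul_div, le_div_iff₀ (by positivity)]
    linarith
  set P := (memLp_timeVol_of_continuousOn h.path.continuousOn 2).toLp Y with hP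
  have h2 : ‖P‖ ≤ J * k₁ * σ := by
    rw [hP, h.toLp_path, mul_assoc]
    exact (norm_compLpL_apply_le _ _).trans (mul_le_mul_of_nonneg_left h1 (norm_nonneg _))
  have hΛP : ‖Λ • P‖ ≤ Λ * (J * k₁ * σ) := by
    rw [norm_smul, Real.norm_of_nonneg hΛ]
    exact mul_le_mul_of_nonneg_left h2 hΛ
  have h3 : ‖F + Λ • P‖ ≤ √(2 * L) * ‖Y 0‖ + ‖u + Λ • P‖ := by
    refine (sq_le_sq₀ (norm_nonneg _) (by positivity)).1 (hF.trans ?_)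
    rw [add_sq, mul_pow, Real.sq_sqrt (by positivity)]
    linarith [mul_nonneg (mul_nonneg (Real.sqrt_nonneg (2 * L)) (norm_nonneg (Y 0)))
      (norm_nonneg (u + Λ • P))]
  have h4 : ‖F‖ ≤ (√(2 * L) + 1 + 2 * Λ * (J * k₁)) * σ := by
    have e1 : ‖F‖ ≤ ‖F + Λ • P‖ + ‖Λ • P‖ := by
      have := norm_sub_le (F + Λ • P) (Λ • P)
      rwa [add_sub_cancel_right] at this
    have e2 := norm_add_le u (Λ • P)
    have e3 := mul_le_mul_of_nonneg_left hYσ (Real.sqrt_nonneg (2 * L))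
    nlinarith
  have h5 : ‖h.path.memLp_deriv.toLp _‖ ≤
      (R * 1 + A * k₁ + R * (√(2 * L) + 1 + 2 * Λ * (J * k₁))) * σ := by
    rw [h.toLp_deriv]
    have e1 := norm_compLpL_apply_le (dualEmb H10.fn) u
    have e2 := norm_compLpL_apply_le hA.op (h.path.memLp.toLp y)
    have e3 := norm_compLpL_apply_le (dualEmb H10.fn) F
    have e4 := mul_le_mul_of_nonneg_left huσ (norm_nonneg (dualEmb (H10.fn (Ω := Ω))))
    have e5 := mul_le_mul_of_nonneg_left h1 (norm_nonneg hA.op)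
    have e6 := mul_le_mul_of_nonneg_left h4 (norm_nonneg (dualEmb (H10.fn (Ω := Ω))))
    refine (norm_sub_le _ _).trans ((add_le_add_left (norm_sub_le _ _) _).trans ?_)
    refine (add_le_add (add_le_add (e1.trans e4) (e2.trans e5)) (e3.trans e6)).trans_eq ?_
    ring
  have h6 := W.norm_le (h.path.toW hT.le)
  rw [h.path.val_toW, h.path.timeDeriv_toW] at h6
  refine (add_le_add (h6.trans (add_le_add h1 h5)) h4).trans_eq ?_
  ring

end Estimate

end SemilinearParabolic

namespace SemilinearParabolic

/-! ### Weak continuity -/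

section StrongConvergence

variable {V H : Type*} [NormedAddCommGroup V] [InnerProductSpace ℝ V] [CompleteSpace V]
  [NormedAddCommGroup H] [InnerProductSpace ℝ H] [CompleteSpace H] {j : V →L[ℝ] H} {T : ℝ}

/-- Paths starting at `0` whose sources converge weakly to `0` converge strongly to `0`: the work
`r_k(t) = ∫₀ᵗ ⟨D_k, Z_k⟩` done by the sources tends to zero, and Gronwall's inequality applies with
`ρ = 2 |r_k|`. -/
theorem tendsto_integral_norm_sq_path {ι : Type*} (hT : 0 ≤ T) {α c : ℝ} (hα : 0 < α) (hc : 0 ≤ c)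
    (hj : ∀ ε : ℝ, 0 < ε → ∃ (S : Finset ι) (p : ι → V) (g : ι → H),
      ∀ v, ‖j v - ∑ m ∈ S, inner ℝ (j (p m)) (j v) • g m‖ ≤ ε * ‖v‖)
    {D : ℕ → Lp H 2 (timeVol T)} (hD : WeaklyTendsto D 0)
    {w : ℕ → ℝ → V} {ζ : ℕ → ℝ → StrongDual ℝ V} {Z : ℕ → ℝ → H}
    (hw : ∀ k, IsPath j T (w k) (ζ k) (Z k)) (hZ0 : ∀ k, Z k 0 = 0) {B : ℝ}
    (hwB : ∀ k, ∫ s in 0..T, ‖w k s‖ ^ 2 ≤ B) (hζB : ∀ k, ∫ s in 0..T, ‖ζ k s‖ ^ 2 ≤ B)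
    (hζ : ∀ k, ∀ᵐ t ∂timeVol T,
      ζ k t (w k t) ≤ inner ℝ (D k t) (Z k t) + c * ‖Z k t‖ ^ 2 - α * ‖w k t‖ ^ 2) :
    Tendsto (fun k => ∫ s in 0..T, ‖w k s‖ ^ 2) atTop (𝓝 0) := by
  have hT' : T ∈ Icc 0 T := ⟨hT, le_rfl⟩
  obtain ⟨M, hM⟩ := exists_bound_of_weaklyTendsto hD
  set r : ℕ → ℝ → ℝ := fun k t => ∫ s in 0..t, inner ℝ (D k s) (Z k s) with hr
  have hr0 : ∀ t ∈ Icc 0 T, Tendsto (fun k => r k t) atTop (𝓝 0) := fun t ht =>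
    tendsto_integral_inner_path hj hD hw hZ0 hwB hζB ht
  have hpi : ∀ k, IntegrableOn (fun s => (inner ℝ (D k s) (Z k s) : ℝ)) (Ioo 0 T) := fun k =>
    memLp_two_bilin_integrable (innerSL ℝ) (Lp.memLp (D k))
      (memLp_timeVol_of_continuousOn (hw k).continuousOn 2)
  have hrc : ∀ k, ContinuousOn (fun t => 2 * |r k t|) (Icc 0 T) := fun k => by
    refine continuousOn_const.mul (ContinuousOn.abs ?_)
    rw [← uIcc_of_le hT]
    refine intervalIntegral.continuousOn_primitive_interval ?_
    rw [uIcc_of_le hT]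
    exact (integrableOn_Icc_iff_integrableOn_Ioo).2 (hpi k)
  have hrb : ∀ k, ∀ t ∈ Icc 0 T, |r k t| ≤ 1 / 2 * (M ^ 2 + ‖j‖ ^ 2 * B) := fun k t ht => by
    have i3 : IntegrableOn (fun s => ‖D k s‖ ^ 2) (Ioo 0 T) :=
      memLp_two_norm_sq_integrable (Lp.memLp (D k))
    have i4 : IntegrableOn (fun s => ‖j‖ ^ 2 * ‖w k s‖ ^ 2) (Ioo 0 T) :=
      (memLp_two_norm_sq_integrable (hw k).memLp).const_mul _
    have i5 : IntegrableOn (fun s => 1 / 2 * (‖D k s‖ ^ 2 + ‖j‖ ^ 2 * ‖w k s‖ ^ 2)) (Ioo 0 T) :=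
      (i3.add i4).const_mul _
    refine (intervalIntegral.abs_integral_le_integral_abs ht.1).trans ?_
    refine (intervalIntegral_mono_timeVol (hpi k).abs i5 ?_ ht).trans ?_
    · filter_upwards [(hw k).ae_eq] with s hs
      refine (abs_real_inner_le_norm _ _).trans ?_
      have e1 : ‖Z k s‖ ≤ ‖j‖ * ‖w k s‖ := by
        rw [hs]
        exact j.le_opNorm _
      have e2 := pow_le_pow_left₀ (norm_nonneg _) e1 2
      nlinarith [sq_nonneg (‖D k s‖ - ‖Z k s‖)]
    · refine (intervalIntegral_le_of_nonneg i5 (fun s => by positivity) ht).trans ?_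
      rw [intervalIntegral.integral_const_mul, intervalIntegral.integral_add
        (intervalIntegrable_zero_of_mem i3 hT') (intervalIntegrable_zero_of_mem i4 hT'),
        intervalIntegral.integral_const_mul, ← norm_Lp_sq_intervalIntegral hT]
      have h2 := pow_le_pow_left₀ (norm_nonneg _) (hM k) 2
      have h3 := hwB k
      gcongr
  -- `r_k` is bounded uniformly, so that pointwise convergence gives convergence of its integral
  have hrI : Tendsto (fun k => ∫ t in 0..T, 2 * |r k t|) atTop (𝓝 0) := by
    have h1 : Tendsto (fun k => ∫ t, 2 * |r k t| ∂timeVol T) atTop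
        (𝓝 (∫ t, (0 : ℝ) ∂timeVol T)) := by
      refine tendsto_integral_of_dominated_convergence
        (fun _ => 2 * (1 / 2 * (M ^ 2 + ‖j‖ ^ 2 * B)))
        (fun k => (memLp_timeVol_of_continuousOn (hrc k) 2).1) (integrable_const _)
        (fun k => ?_) ?_
      · filter_upwards [ae_restrict_mem measurableSet_Ioo] with t ht
        rw [Real.norm_of_nonneg (by positivity)]
        exact mul_le_mul_of_nonneg_left (hrb k t (Ioo_subset_Icc_self ht)) zero_le_two
      · filter_upwards [ae_restrict_mem measurableSet_Ioo] with t ht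
        have h2 := ((hr0 t (Ioo_subset_Icc_self ht)).abs).const_mul 2
        simpa using h2
    rw [integral_zero] at h1
    simpa only [setIntegral_timeVol_eq hT] using h1
  have henergy : ∀ k, 2 * α * ∫ s in 0..T, ‖w k s‖ ^ 2 ≤
      2 * |r k T| + 2 * c * (Real.exp (2 * c * T) * ∫ t in 0..T, 2 * |r k t|) := fun k => by
    have h1 := (hw k).energy_gronwall hT hα.le hc (hpi k) (ρ := fun t => 2 * |r k t|) (hζ k)
      (hrc k) (fun t _ => by positivity) (fun t _ => by
        rw [hZ0 k, norm_zero, zero_pow two_ne_zero, zero_add]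
        exact mul_le_mul_of_nonneg_left (le_abs_self (r k t)) zero_le_two) T hT'
    linarith [sq_nonneg ‖Z k T‖]
  have h1 : Tendsto (fun k => (2 * |r k T| + 2 * c * (Real.exp (2 * c * T) *
      ∫ t in 0..T, 2 * |r k t|)) / (2 * α)) atTop (𝓝 0) := by
    have h2 := ((((hr0 T hT').abs).const_mul 2).add
      ((hrI.const_mul (Real.exp (2 * c * T))).const_mul (2 * c))).div_const (2 * α)
    simpa using h2
  refine squeeze_zero (fun k => intervalIntegral.integral_nonneg hT fun _ _ => by positivity)
    (fun k => ?_) h1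
  rw [le_div_iff₀ (by positivity), mul_comm]
  exact henergy k

end StrongConvergence

section WeakContinuity

variable {n : ℕ} {Ω : BoundedDomain n} {T : ℝ} {a : Fin n → Fin n → Sp n → ℝ} {a₀ : Sp n → ℝ}
  {f : ℝ → ℝ} {hA : IsEllipticOperator Ω a a₀}

theorem WeaklyTendsto.map {X X' : Type*} [NormedAddCommGroup X] [NormedSpace ℝ X]
    [NormedAddCommGroup X'] [NormedSpace ℝ X'] {x : ℕ → X} {z : X} (h : WeaklyTendsto x z)
    (B : X →L[ℝ] X') : WeaklyTendsto (fun k => B (x k)) (B z) :=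
  weaklyTendsto_iff.2 fun ℓ => weaklyTendsto_iff.1 h (ℓ.comp B)

theorem weaklyTendsto_of_tendsto {X : Type*} [NormedAddCommGroup X] [NormedSpace ℝ X]
    {x : ℕ → X} {z : X} (h : Tendsto x atTop (𝓝 z)) : WeaklyTendsto x z :=
  weaklyTendsto_iff.2 fun ℓ => (ℓ.continuous.tendsto z).comp h

theorem WeaklyTendsto.sub {X : Type*} [NormedAddCommGroup X] [NormedSpace ℝ X]
    {x x' : ℕ → X} {z z' : X} (h : WeaklyTendsto x z) (h' : WeaklyTendsto x' z') :
    WeaklyTendsto (fun k => x k - x' k) (z - z') :=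
  weaklyTendsto_iff.2 fun ℓ => by
    simpa only [map_sub] using (weaklyTendsto_iff.1 h ℓ).sub (weaklyTendsto_iff.1 h' ℓ)

theorem W.weaklyTendsto {w : ℕ → W Ω T} {w₀ : W Ω T}
    (h : WeaklyTendsto (fun k => W.val (w k)) (W.val w₀))
    (h' : WeaklyTendsto (fun k => W.timeDeriv (w k)) (W.timeDeriv w₀)) : WeaklyTendsto w w₀ := by
  refine weaklyTendsto_iff.2 fun ℓ => ?_
  -- a functional on the subspace `W(0,T)` extends to the product
  obtain ⟨m, hm, -⟩ := exists_extension_norm_eq (W Ω T) ℓ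
  set m' := m.comp (WithLp.prodContinuousLinearEquiv 2 ℝ (Lp (H10 Ω) 2 (timeVol T))
    (Lp (Hm1 Ω) 2 (timeVol T))).symm.toContinuousLinearMap with hm'
  have e : ∀ p : W Ω T, ℓ p =
      m'.comp (ContinuousLinearMap.inl ℝ _ _) (W.val p) +
        m'.comp (ContinuousLinearMap.inr ℝ _ _) (W.timeDeriv p) := fun p => by
    rw [← hm p, ContinuousLinearMap.comp_apply m', ContinuousLinearMap.comp_apply m', ← map_add,
      ContinuousLinearMap.inl_apply, ContinuousLinearMap.inr_apply, Prod.mk_add_mk, add_zero,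
      zero_add]
    rfl
  simp only [e]
  exact (weaklyTendsto_iff.1 h _).add (weaklyTendsto_iff.1 h' _)

variable {u F : ℕ → Lp (L2 Ω) 2 (timeVol T)} {y : ℕ → ℝ → H10 Ω} {Y : ℕ → ℝ → L2 Ω}
  {u₀ F₀ : Lp (L2 Ω) 2 (timeVol T)} {y₀ : ℝ → H10 Ω} {Y₀ : ℝ → L2 Ω}

theorem norm_sq_intervalIntegral_sub_le {E : Type*} [NormedAddCommGroup E] (hT : 0 ≤ T)
    {p q : ℝ → E} (hp : MemLp p 2 (timeVol T)) (hq : MemLp q 2 (timeVol T)) {C : ℝ}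
    (hpC : ‖hp.toLp p‖ ≤ C) (hqC : ‖hq.toLp q‖ ≤ C) :
    ∫ s in 0..T, ‖(p - q) s‖ ^ 2 ≤ (2 * C) ^ 2 := by
  rw [← norm_toLp_sq_intervalIntegral hT (hp.sub hq), MemLp.toLp_sub hp hq]
  refine pow_le_pow_left₀ (norm_nonneg _) ((norm_sub_le _ _).trans ?_) 2
  linarith

/-- If the right-hand sides converge weakly, the solutions converge strongly in
`L²(0,T;H₀¹(Ω))`. -/
theorem tendsto_path_of_weaklyTendsto (hT : 0 < T)
    (hf : ContDiff ℝ 1 f) {Λ : ℝ} (hΛ : 0 ≤ Λ) (hf' : ∀ s, -Λ ≤ deriv f s)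
    (h : ∀ k, IsPathSolution hA f (u k) (y k) (F k) (Y k)) (h₀ : IsPathSolution hA f u₀ y₀ F₀ Y₀)
    (h0 : ∀ k, Y k 0 = Y₀ 0) (hu : WeaklyTendsto u u₀) {C : ℝ}
    (hC : ∀ k, ‖(h k).path.toW hT.le‖ ≤ C) :
    Tendsto (fun k => (h k).path.memLp.toLp (y k)) atTop (𝓝 (h₀.path.memLp.toLp y₀)) := by
  obtain ⟨α, hα, hcoer⟩ := hA.exists_coercive
  have hD : WeaklyTendsto (fun k => u k - u₀) 0 := by
    have := hu.sub (weaklyTendsto_of_tendsto (tendsto_const_nhds (x := u₀)))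
    rwa [sub_self] at this
  have hw := fun k => (h k).path.sub h₀.path
  set C' := max C ‖h₀.path.toW hT.le‖ with hC'
  have hlim := tendsto_integral_norm_sq_path hT.le hα hΛ (fun ε hε => exists_finite_rank Ω hε) hD hw
    (fun k => by rw [Pi.sub_apply, h0 k, sub_self]) (B := (2 * C') ^ 2)
    (fun k => norm_sq_intervalIntegral_sub_le hT.le (h k).path.memLp h₀.path.memLp
      ((W.norm_val_le ((h k).path.toW hT.le)).trans ((hC k).trans (le_max_left _ _)))
      ((W.norm_val_le (h₀.path.toW hT.le)).trans (le_max_right _ _)))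
    (fun k => norm_sq_intervalIntegral_sub_le hT.le (h k).path.memLp_deriv
      h₀.path.memLp_deriv ((W.norm_timeDeriv_le ((h k).path.toW hT.le)).trans
        ((hC k).trans (le_max_left _ _)))
      ((W.norm_timeDeriv_le (h₀.path.toW hT.le)).trans (le_max_right _ _)))
    (fun k => by
      filter_upwards [(h k).path.ae_eq, h₀.path.ae_eq, (h k).superposition, h₀.superposition,
        Lp.coeFn_sub (u k) u₀] with t e1 e2 e3 e4 e5
      have e6 := inner_superposition_sub hf hf' e3 e4
      have e7 := hcoer (y k t - y₀ t)
      have e9 : H10.fn (y k t - y₀ t) = Y k t - Y₀ t := by rw [map_sub, e1, e2]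
      rw [e5]
      simp only [Pi.sub_apply, sub_apply, dualEmb_apply, e9]
      have e8 : hA.op (y k t - y₀ t) = hA.op (y k t) - hA.op (y₀ t) := map_sub _ _ _
      rw [e8, sub_apply] at e7
      rw [inner_sub_left] at e6 ⊢
      linarith)
  rw [tendsto_iff_norm_sub_tendsto_zero]
  have h1 := (Real.continuous_sqrt.tendsto 0).comp hlim
  rw [Real.sqrt_zero] at h1
  refine h1.congr fun k => ?_
  rw [Function.comp_apply, ← MemLp.toLp_sub (h k).path.memLp h₀.path.memLp,
    ← norm_toLp_sq_intervalIntegral hT.le ((h k).path.memLp.sub h₀.path.memLp),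
    Real.sqrt_sq (norm_nonneg _)]

/-- Weak convergence of the right-hand sides implies weak convergence of the solutions and of the
nonlinear terms. -/
theorem weaklyTendsto_toW (hT : 0 < T)
    (hf : ContDiff ℝ 1 f) {Λ : ℝ} (hΛ : 0 ≤ Λ) (hf' : ∀ s, -Λ ≤ deriv f s)
    (h : ∀ k, IsPathSolution hA f (u k) (y k) (F k) (Y k)) (h₀ : IsPathSolution hA f u₀ y₀ F₀ Y₀)
    (h0 : ∀ k, Y k 0 = Y₀ 0) (hu : WeaklyTendsto u u₀) {C : ℝ}
    (hC : ∀ k, ‖(h k).path.toW hT.le‖ ≤ C) (hF : ∀ k, ‖F k‖ ≤ C) :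
    WeaklyTendsto (fun k => (h k).path.toW hT.le) (h₀.path.toW hT.le) ∧ WeaklyTendsto F F₀ := by
  have hfin := isFiniteMeasure_vol Ω
  have hy := tendsto_path_of_weaklyTendsto hT hf hΛ hf' h h₀ h0 hu hC
  have hYm := fun k => memLp_timeVol_of_continuousOn (h k).path.continuousOn 2
  have hY₀m := memLp_timeVol_of_continuousOn h₀.path.continuousOn 2
  have hFw : WeaklyTendsto F F₀ := by
    have hY : Tendsto (fun k => (hYm k).toLp (Y k)) atTop (𝓝 (hY₀m.toLp Y₀)) := by
      have h1 := ((H10.fn.compLpL 2 (timeVol T)).continuous.tendsto _).comp hy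
      rw [← h₀.toLp_path] at h1
      exact h1.congr fun k => (h k).toLp_path.symm
    obtain ⟨G, hG, hGw⟩ := exists_weak_limit_superposition_slice hf.continuous hY (G := F)
      (fun k => by
        filter_upwards [(h k).superposition, (hYm k).coeFn_toLp] with t e1 e2
        rw [e2]
        exact e1) hF
    -- the weak limit is `f(Y₀)`
    have hGF : G = F₀ := by
      refine Lp.ext ?_
      filter_upwards [hG, h₀.superposition, hY₀m.coeFn_toLp] with t e1 e2 e3
      rw [e3] at e1
      exact Lp.ext (e1.trans e2.symm)
    rw [← hGF]
    exact weaklyTendsto_iff_inner.2 hGw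
  refine ⟨W.weaklyTendsto ?_ ?_, hFw⟩
  · exact weaklyTendsto_of_tendsto hy
  · simp only [h₀.path.timeDeriv_toW, (h _).path.timeDeriv_toW, h₀.toLp_deriv, (h _).toLp_deriv]
    exact ((hu.map _).sub ((weaklyTendsto_of_tendsto hy).map _)).sub (hFw.map _)

end WeakContinuity

/-! ### Bounded initial values -/

section Nonlinearity

/-- A `C¹` function vanishing at `0` grows at most linearly on bounded intervals. -/
theorem exists_abs_le_mul_abs {g : ℝ → ℝ} (hg : ContDiff ℝ 1 g) (hg0 : g 0 = 0) :
    ∃ L : ℝ → ℝ, ∀ M, 0 ≤ L M ∧ ∀ s, |s| ≤ M → |g s| ≤ L M * |s| := by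
  have key : ∀ M : ℝ, ∃ L : ℝ, 0 ≤ L ∧ ∀ s, |s| ≤ M → |g s| ≤ L * |s| := fun M => by
    obtain ⟨L, hL⟩ := (isCompact_Icc (a := -M) (b := M)).exists_bound_of_continuousOn
      (hg.continuous_deriv le_rfl).continuousOn
    refine ⟨max L 0, le_max_right _ _, fun s hs => ?_⟩
    have h0 : (0 : ℝ) ∈ Icc (-M) M := by
      have := (abs_nonneg s).trans hs
      exact ⟨by linarith, this⟩
    have h1 := (convex_Icc (-M) M).norm_image_sub_le_of_norm_deriv_le
      (fun x _ => hg.differentiable (by simp) x)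
      (fun x hx => (hL x hx).trans (le_max_left L 0)) h0 (abs_le.1 hs)
    simpa [hg0] using h1
  choose L hL using key
  exact ⟨L, hL⟩

end Nonlinearity

end SemilinearParabolic

/-! ### Existence, uniqueness, estimate and weak continuity -/

theorem theorem2p1 {n : ℕ} (Ω : BoundedDomain n) (T : ℝ) (hT : 0 < T)
    (a : Fin n → Fin n → EuclideanSpace ℝ (Fin n) → ℝ) (a₀ : EuclideanSpace ℝ (Fin n) → ℝ)
    (hA : IsEllipticOperator Ω a a₀)
    (f : ℝ → ℝ) (hf : ContDiff ℝ 1 f) (hf0 : f 0 = 0)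
    (hf' : ∃ Λ : ℝ, 0 ≤ Λ ∧ ∀ s : ℝ, -Λ ≤ deriv f s) :
    ∃ C : ℝ → ℝ, ∀ y₀ : Lp ℝ ∞ Ω.vol,
      ∃ (S : L2Q Ω T → W Ω T) (F : L2Q Ω T → L2Q Ω T),
        -- `S u = y_u` is the unique solution
        (∀ u, IsSolution a a₀ f u y₀ (S u) ∧ ∀ y : W Ω T, IsSolution a a₀ f u y₀ y → y = S u) ∧
        -- `f(y_u)` belongs to `L²(Q)`, and it is `F u`
        (∀ u, IsSuperposition f (S u) (F u)) ∧
        (∀ u, ‖S u‖ + ‖F u‖ ≤ C ‖y₀‖ * (‖u‖ + ‖y₀‖)) ∧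
        (∀ (u : ℕ → L2Q Ω T) (v : L2Q Ω T), WeaklyTendsto u v →
          WeaklyTendsto (fun k => S (u k)) (S v) ∧ WeaklyTendsto (fun k => F (u k)) (F v)) := by
  obtain ⟨Λ, hΛ, hf'⟩ := hf'
  have hfin := isFiniteMeasure_vol Ω
  obtain ⟨K, hK⟩ := exists_norm_le hT hA hf hf0 hΛ hf'
  obtain ⟨L, hL⟩ := exists_abs_le_mul_abs (g := fun s => f s + Λ * s)
    (hf.add (contDiff_const.mul contDiff_id)) (by simp [hf0])
  -- `c = |Ω|^{1/2}` bounds the `L²` norm by the `L^∞` norm; the initial value enters the constant `C`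
  -- through the bound `L M` for `|g(s) / s|` on `[-M, M]`, where `g(s) = f(s) + Λ s`
  set c := Ω.vol.real univ ^ (2 : ℝ≥0∞).toReal⁻¹ with hc
  have hc0 : 0 ≤ c := by positivity
  refine ⟨fun M => K (L M) * (1 + c), fun y₀ => ?_⟩
  -- the initial value, as an element of `L²(Ω)`
  have hb : ∀ᵐ x ∂Ω.vol, ‖y₀ x‖ ≤ ‖y₀‖ := by
    rw [Lp.norm_def, eLpNorm_exponent_top]
    have hfinite : eLpNormEssSup y₀ Ω.vol ≠ ⊤ := by
      rw [← eLpNorm_exponent_top]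
      exact Lp.eLpNorm_ne_top y₀
    filter_upwards [enorm_ae_le_eLpNormEssSup y₀ Ω.vol] with x hx
    rw [← toReal_enorm]
    exact ENNReal.toReal_mono hfinite hx
  have hm : MemLp y₀ 2 Ω.vol := MemLp.of_bound (Lp.aestronglyMeasurable y₀) ‖y₀‖ hb
  set p₀ : L2 Ω := hm.toLp y₀ with hp₀
  have hp₀n : ‖p₀‖ ≤ c * ‖y₀‖ := by
    refine Lp.norm_le_of_ae_bound (norm_nonneg y₀) ?_
    filter_upwards [hm.coeFn_toLp, hb] with x e1 e2
    rw [hp₀, e1]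
    exact e2
  have hp₀L : ∀ᵐ x ∂Ω.vol, |f (p₀ x) + Λ * p₀ x| ≤ L ‖y₀‖ * |p₀ x| := by
    filter_upwards [hm.coeFn_toLp, hb] with x e1 e2
    rw [hp₀, e1]
    exact (hL ‖y₀‖).2 _ e2
  set e := sliceEquiv Ω.vol (timeVol T) with he
  choose y G Y h hY0 hG using fun u : L2Q Ω T =>
    exists_isPathSolution hT hA hf hf0 hΛ hf' (e u) p₀ (hL ‖y₀‖).1 hp₀L
  have hsol : ∀ u, IsSolution a a₀ f u y₀ ((h u).path.toW hT.le) := fun u =>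
    (h u).isSolution_toW hT.le (isSlice_sliceEquiv u) (by rw [hY0]; exact hm.coeFn_toLp)
  obtain ⟨hK0, hKb⟩ := hK (L ‖y₀‖) (hL ‖y₀‖).1
  have hbound : ∀ u, ‖(h u).path.toW hT.le‖ + ‖G u‖ ≤
      K (L ‖y₀‖) * (1 + c) * (‖u‖ + ‖y₀‖) := fun u => by
    have h1 := hKb (e u) (y u) (G u) (Y u) (h u) (by rw [hY0]; exact hG u)
    rw [hY0, e.norm_map] at h1
    refine h1.trans ?_
    rw [mul_assoc]
    refine mul_le_mul_of_nonneg_left ?_ hK0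
    have h2 := mul_nonneg hc0 (norm_nonneg u)
    linarith [norm_nonneg y₀]
  refine ⟨fun u => (h u).path.toW hT.le, fun u => e.symm (G u), fun u => ⟨hsol u, fun w hw =>
    hw.unique hT hA hf hΛ hf' (hsol u)⟩, fun u => (h u).isSuperposition_toW hT.le
      (isSlice_sliceEquiv_symm (G u)), fun u => ?_, fun u v huv => ?_⟩
  · rw [e.symm.norm_map]
    exact hbound u
  · obtain ⟨M, hM⟩ := exists_bound_of_weaklyTendsto huv
    have hM' : ∀ k, ‖(h (u k)).path.toW hT.le‖ + ‖G (u k)‖ ≤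
        K (L ‖y₀‖) * (1 + c) * (M + ‖y₀‖) := fun k =>
      (hbound (u k)).trans (mul_le_mul_of_nonneg_left (add_le_add_left (hM k) _) (by positivity))
    obtain ⟨h1, h2⟩ := weaklyTendsto_toW hT hf hΛ hf' (fun k => h (u k)) (h v)
      (fun k => (hY0 _).trans (hY0 v).symm) (huv.map (e : L2Q Ω T →L[ℝ] Lp (L2 Ω) 2 (timeVol T)))
      (fun k => (le_add_of_nonneg_right (norm_nonneg _)).trans (hM' k))
      (fun k => (le_add_of_nonneg_left (norm_nonneg _)).trans (hM' k))
    exact ⟨h1, h2.map (e.symm : Lp (L2 Ω) 2 (timeVol T) →L[ℝ] L2Q Ω T)⟩
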